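/- Let $a>0$. For $q\in L_1(0,\infty)$ (complex-valued) vanishing almost everywhere outside $[0,a]$ and $z\in\mathbb C$ with $\operatorname{Im}z\ge 0$, let $y_q(\cdot,z)$ be the Jost solution, i.e. the unique solution of $-y''+q(x)y=z^2y$ on $[0,\infty)$ with $y_q(x,z)e^{-izx}\to 1$ as $x\to\infty$. Let $\psi_q$ be the Jost function: the entire function with $\psi_q(z)=y_q(0,z)$ for $\operatorname{Im}z\ge 0$. For $R,\varepsilon>0$ say that two entire functions $\psi_1,\psi_2\not\equiv0$ have $\varepsilon$-close zeros in $\{|z|\le R\}$ if $z=0$ is a zero of the same multiplicity ($0$ allowed) of both, if they have the same number $N$ of nonzero zeros in $\{|z|\le R\}$ counted with multiplicity, and if these zeros can be numbered as $z^{(j)}_1,\dots,z^{(j)}_N$ ($j=1,2$) so that $\bigl|1/z^{(2)}_n-1/z^{(1)}_n\bigr|<\varepsilon$ for $n=1,\dots,N$. **Theorem.** Let $a,Q_1,D_p>0$, $D_r'\ge 0$, $p,r\in(1,\infty]$ and $\delta\in(0,1)$. There exist constants $C_0',R_0'>0$ and functions $\psi'(R,\varepsilon)$ and $\chi'(R)$,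 depending only on $a,Q_1,p,D_p,r,D_r',\delta$, with $\chi'(R)=O(\ln R)$ as $R\to\infty$ and, for each $R>R_0'$, $\psi'(R,\varepsilon)=O(\varepsilon)$ as $\varepsilon\to0+$, such that the following holds. Let $q_1,q_2\in L_1(0,\infty)$ vanish almost everywhere outside $[0,a]$ and satisfy $\|q_1\|_1\le Q_1$, $\|q_2\|_1\le Q_1$, $\|q_2-q_1\|_p\le D_p$, $\int_0^aq_1(t)\,dt=\int_0^aq_2(t)\,dt$; let $q_2-q_1$ be absolutely continuous on $[0,a]$ (after modification on a null set) with $\|(q_2-q_1)'\|_{L_r(0,a)}\le D_r'$. If $R>R_0'$, $\varepsilon>0$ and $\psi_{q_1},\psi_{q_2}$ have $\varepsilon$-close zeros in $\{|z|\le R\}$, then $$\|q_1-q_2\|_{\infty}\le\psi'(R,\varepsilon)+C_0'\,R^{-(1-\delta)\frac{r-1}{2r-1}\cdot\frac{p-1}{3p-2}}\bigl(1+\chi'(R)\bigr),$$ where $\frac{p-1}{3p-2}$ is read as $\frac13$ for $p=\infty$ and $\frac{r-1}{2r-1}$ as $\frac12$ for $r=\infty$. -/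

import Mathlib

open MeasureTheory Set Filter Topology Asymptotics
open scoped ENNReal

/-- Lebesgue measure on the half-line `(0, ∞)`. -/
noncomputable def halfLine : Measure ℝ := volume.restrict (Ioi 0)

/-- `y : [0, ∞) → ℂ` is a (Carathéodory) solution of `-y'' + q y = z² y` on `[0, ∞)`, that is,
`y` is continuously differentiable with derivative `v`, where `v` is an indefinite integral of
`(q - z²) y`. It is meant for potentials `q` that are integrable on bounded intervals. Only the
values of `q` and `y` on `[0, ∞)` matter. -/
def IsSchrodingerSolution (q : ℝ → ℂ) (z : ℂ) (y : ℝ → ℂ) : Prop :=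
  ∃ v : ℝ → ℂ, ContinuousOn y (Ici 0) ∧ ContinuousOn v (Ici 0) ∧
    (∀ x : ℝ, 0 ≤ x → y x = y 0 + ∫ t in (0 : ℝ)..x, v t) ∧
    (∀ x : ℝ, 0 ≤ x → v x = v 0 + ∫ t in (0 : ℝ)..x, (q t - z ^ 2) * y t)

/-- `y` is the Jost solution at the spectral parameter `z` (meant for `0 ≤ z.im`): the solution of
`-y'' + q y = z² y` on `[0, ∞)` with `y(x) / e^{izx} → 1` as `x → ∞`. -/
def IsJostSolution (q : ℝ → ℂ) (z : ℂ) (y : ℝ → ℂ) : Prop :=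
  IsSchrodingerSolution q z y ∧
    Tendsto (fun x : ℝ => y x / Complex.exp (Complex.I * z * x)) atTop (𝓝 1)

/-- `ψ` is an entire function with `ψ(z) = y(0, z)` for all `z` in the closed upper half-plane,
where `y(·, z)` is the Jost solution. -/
def IsJostFunction (q : ℝ → ℂ) (ψ : ℂ → ℂ) : Prop :=
  Differentiable ℂ ψ ∧ ∀ z : ℂ, 0 ≤ z.im → ∃ y : ℝ → ℂ, IsJostSolution q z y ∧ y 0 = ψ z

/-- The Jost function of `q`, continued to an entire function. For an integrable potential with
bounded support exactly one function satisfies `IsJostFunction q`, and this is that function. -/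
noncomputable def jostFunction (q : ℝ → ℂ) : ℂ → ℂ :=
  Classical.epsilon (IsJostFunction q)

/-- The finite sequence `ζ` lists all nonzero zeros of `f` in the closed disc `|z| ≤ R`, each
repeated according to its multiplicity. -/
def IsNonzeroZeroList (f : ℂ → ℂ) (R : ℝ) {N : ℕ} (ζ : Fin N → ℂ) : Prop :=
  (∀ n, ζ n ≠ 0 ∧ ‖ζ n‖ ≤ R) ∧
    ∀ w : ℂ, w ≠ 0 → ‖w‖ ≤ R → (Nat.card {n : Fin N // ζ n = w} : ℕ∞) = analyticOrderAt f w

/-- `f₁` and `f₂` vanish to the same order at `0`, they have the same number `N` of nonzero zeros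
in the closed disc `|z| ≤ R` (with multiplicities), and these zeros can be numbered so that
`|1 / ζ₂ n - 1 / ζ₁ n| < ε` for all `n`. -/
def ZerosClose (f₁ f₂ : ℂ → ℂ) (R ε : ℝ) : Prop :=
  analyticOrderAt f₁ 0 = analyticOrderAt f₂ 0 ∧
    ∃ (N : ℕ) (ζ₁ ζ₂ : Fin N → ℂ), IsNonzeroZeroList f₁ R ζ₁ ∧ IsNonzeroZeroList f₂ R ζ₂ ∧
      ∀ n, ‖1 / ζ₂ n - 1 / ζ₁ n‖ < ε

/-- `q ∈ L₁(0, ∞)`, the support of `q` is contained in `[0, a]`, and `‖q‖₁ ≤ Q`. -/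
def IsAdmissiblePotential (a Q : ℝ) (q : ℝ → ℂ) : Prop :=
  MemLp q 1 halfLine ∧ (∀ᵐ x ∂halfLine, a < x → q x = 0) ∧
    eLpNorm q 1 halfLine ≤ ENNReal.ofReal Q

/-- `g` agrees almost everywhere on `[0, a]` with an absolutely continuous function whose
derivative has `L_r(0, a)` norm at most `D`. -/
def HasACRepresentative (a : ℝ) (r : ℝ≥0∞) (D : ℝ) (g : ℝ → ℂ) : Prop :=
  ∃ h : ℝ → ℂ, g =ᵐ[volume.restrict (Icc 0 a)] h ∧ AbsolutelyContinuousOnInterval h 0 a ∧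
    eLpNorm (deriv h) r (volume.restrict (Icc 0 a)) ≤ ENNReal.ofReal D

/-- `(p - 1) / (3 p - 2)`, with the limiting value `1 / 3` at `p = ∞`. -/
noncomputable def expP (p : ℝ≥0∞) : ℝ :=
  if p = ⊤ then 1 / 3 else (p.toReal - 1) / (3 * p.toReal - 2)

/-- `(r - 1) / (2 r - 1)`, with the limiting value `1 / 2` at `r = ∞`. -/
noncomputable def expR (r : ℝ≥0∞) : ℝ :=
  if r = ⊤ then 1 / 2 else (r.toReal - 1) / (2 * r.toReal - 1)

/-!
The difference `q₂ - q₁` is recovered from the quantity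
`D(z) = ψ₁(-z) ψ₂(z) - ψ₁(z) ψ₂(-z)` on the real axis, and closeness of the zeros makes `D` small.

*Direct problem.* Let `φ_j(x, z)` be the solution with `φ_j(0) = 0`, `φ_j'(0) = 1`, built by
successive approximations (`cauchySol`). Constancy of Wronskians and uniqueness show that the Jost
function is `ψ_j(z) = 1 + ∫₀ᵃ e^{izt} q_j(t) φ_j(t, z) dt` (`jostFunction_eq_jostIntegral`). Hence
`ψ_j` has exponential type and `ψ_j(z) = 1 + O(1 / |z|)` in the closed upper half-plane, uniformly
in the class of potentials (`HasJostGrowth`). The Wronskian of `φ₁` and `φ₂` at the endpoint `a` gives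
`∫₀ᵃ (q₂ - q₁) (z φ₁) (z φ₂) dx = z D(z) / (2i)` (`integral_sub_mul_cauchySol_mul_cauchySol`).

*Zeros.* After division by the polynomials whose zeros are those in `|z| ≤ R`, the quotients have
holomorphic logarithms in the disc, and Borel–Carathéodory bounds these by `O(R)` on a smaller disc.
The difference of the two logarithms is therefore a quadratic polynomial up to an error
`O(|z|³ / R²)`. The three coefficients are controlled at the points `is`, `2is`, `3is` with `s = √R`,
where both Jost functions are `1 + O(1 / s)`. If the zeros agree up to an error that is small enough
in dependence on `R`, then `D(z) = O((1 + |z|) / R)` for real `|z| ≤ √R`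
(`exists_norm_cross_difference_le_of_zerosClose`).

*Inversion.* The function `z φ(x, z) - sin (z x)` is the Fourier transform of a bounded kernel
supported in `[-x, x]`. Only the dual form of this fact is used: integrals against a test function
are dominated by an integral of its transform over `[-x, x]` (`FourierDominated`). This form is
stable under the Picard iteration and under products. Testing the Wronskian identity against a
modulated Gaussian of width `σ` localizes `q₂ - q₁` at a point `t` at resolution `1 / σ`. The mean
value condition removes the constant in `sin² (z x) = (1 - cos (2 z x)) / 2`, and the remaining
terms form a Volterra operator, so that Gronwall's inequality on `[t, a]` applies
(`norm_le_of_norm_crossDifference_le`).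

*Choice of parameters.* The difference is Hölder continuous with exponent `α = 1 - 1 / r`, so the
error is of order `σ^{-α} + σ³ / R + σ⁸ / R³`. With `σ = R^{1 / (3 (1 + α))}` it becomes
`R^{-α / (3 (1 + α))}`, where `α / (1 + α) = (r - 1) / (2 r - 1)`; since `(p - 1) / (3 p - 2) ≤ 1 / 3`,
this is enough. For `ε` above the threshold `ε₀(R)` the a priori bound for `|q₂ - q₁|` is a multiple
of `ε`, with a factor depending on `R` (`mainTheorem2`).
-/

/-! ### Absolutely continuous complex functions and primitives -/

theorem AbsolutelyContinuousOnInterval.complex_ofReal {f : ℝ → ℝ} {a b : ℝ}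
    (hf : AbsolutelyContinuousOnInterval f a b) :
    AbsolutelyContinuousOnInterval (fun x => (f x : ℂ)) a b := by
  rw [absolutelyContinuousOnInterval_iff] at hf ⊢
  simpa only [Complex.isometry_ofReal.dist_eq] using hf

theorem IntervalIntegrable.complex_ofReal {f : ℝ → ℝ} {a b : ℝ}
    (hf : IntervalIntegrable f volume a b) :
    IntervalIntegrable (fun t => (f t : ℂ)) volume a b :=
  ⟨Integrable.ofReal hf.1, Integrable.ofReal hf.2⟩

theorem IntervalIntegrable.absolutelyContinuousOnInterval_integral_complex {f : ℝ → ℂ} {a b : ℝ}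
    (hf : IntervalIntegrable f volume a b) :
    AbsolutelyContinuousOnInterval (fun x => ∫ t in a..x, f t) a b := by
  have hre : IntervalIntegrable (fun t => (f t).re) volume a b := ⟨hf.1.re, hf.2.re⟩
  have him : IntervalIntegrable (fun t => (f t).im) volume a b := ⟨hf.1.im, hf.2.im⟩
  have h1 := (hre.absolutelyContinuousOnInterval_intervalIntegral
    (c := a) left_mem_uIcc).complex_ofReal
  have h2 := ((him.absolutelyContinuousOnInterval_intervalIntegral
    (c := a) left_mem_uIcc).complex_ofReal).const_smul Complex.I
  have h3 := h1.add h2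
  have key : ∀ x ∈ uIcc a b, (∫ t in a..x, f t) =
      ((∫ t in a..x, (f t).re : ℝ) : ℂ) + Complex.I • ((∫ t in a..x, (f t).im : ℝ) : ℂ) := by
    intro x hx
    have hfx : IntervalIntegrable f volume a x := hf.mono_set (uIcc_subset_uIcc_left hx)
    have hrex : IntervalIntegrable (fun t => (f t).re) volume a x := ⟨hfx.1.re, hfx.2.re⟩
    have himx : IntervalIntegrable (fun t => (f t).im) volume a x := ⟨hfx.1.im, hfx.2.im⟩
    rw [← intervalIntegral.integral_ofReal, ← intervalIntegral.integral_ofReal,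
      smul_eq_mul, ← intervalIntegral.integral_const_mul, ← intervalIntegral.integral_add
        hrex.complex_ofReal (himx.complex_ofReal.continuousOn_mul
          (continuousOn_const (c := Complex.I)))]
    refine intervalIntegral.integral_congr fun t _ => ?_
    change f t = _ + Complex.I * _
    rw [mul_comm Complex.I, Complex.re_add_im]
  rw [absolutelyContinuousOnInterval_iff] at h3 ⊢
  intro ε hε
  obtain ⟨δ, hδ, H⟩ := h3 ε hε
  refine ⟨δ, hδ, fun E hE hl => ?_⟩
  refine lt_of_eq_of_lt (Finset.sum_congr rfl fun i hi => ?_) (H E hE hl)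
  have hm := hE.1 i hi
  simp only [key _ hm.1, key _ hm.2, Pi.add_apply]

/-- Product rule in integrated form: no differentiability beyond that of a primitive of an
integrable function is assumed. -/
theorem primitive_mul_primitive {f g u w : ℝ → ℂ} {a b : ℝ}
    (hf : IntervalIntegrable f volume a b) (hg : IntervalIntegrable g volume a b)
    (hu : ∀ x ∈ uIcc a b, u x = u a + ∫ t in a..x, f t)
    (hw : ∀ x ∈ uIcc a b, w x = w a + ∫ t in a..x, g t) :
    u b * w b = u a * w a + ∫ t in a..b, (f t * w t + u t * g t) := by
  set U : ℝ → ℂ := fun x => u a + ∫ t in a..x, f t with hU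
  set W : ℝ → ℂ := fun x => w a + ∫ t in a..x, g t with hW
  have hc (c : ℂ) : AbsolutelyContinuousOnInterval (fun _ : ℝ => c) a b :=
    ((LipschitzWith.const' (K := 0) c).lipschitzOnWith (s := uIcc a b)).absolutelyContinuousOnInterval
  have hUac : AbsolutelyContinuousOnInterval U a b :=
    (hc (u a)).add hf.absolutelyContinuousOnInterval_integral_complex
  have hWac : AbsolutelyContinuousOnInterval W a b :=
    (hc (w a)).add hg.absolutelyContinuousOnInterval_integral_complex
  have hI : IntervalIntegrable (fun t => f t * W t + U t * g t) volume a b :=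
    (hf.mul_continuousOn hWac.continuousOn).add (hg.continuousOn_mul hUac.continuousOn)
  have hac := (hUac.smul hWac).sub hI.absolutelyContinuousOnInterval_integral_complex
  have h0 : ∀ᵐ x, x ∈ uIcc a b → HasDerivAt
      (((fun x => U x • W x)) - fun x => ∫ t in a..x, (f t * W t + U t * g t)) 0 x := by
    filter_upwards [hf.ae_hasDerivAt_integral, hg.ae_hasDerivAt_integral,
      hI.ae_hasDerivAt_integral] with x h1 h2 h3 hx
    have h1 := (h1 hx a left_mem_uIcc).const_add (u a)
    have h2 := (h2 hx a left_mem_uIcc).const_add (w a)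
    have h3 := h3 hx a left_mem_uIcc
    have := (h1.mul h2).sub h3
    convert! this using 1
    exact (sub_self _).symm
  obtain ⟨C, hC⟩ := hac.const_of_ae_hasDerivAt_zero h0
  have ha := hC a left_mem_uIcc
  have hb := hC b right_mem_uIcc
  simp only [Pi.sub_apply, Pi.mul_apply, smul_eq_mul, intervalIntegral.integral_same,
    sub_zero] at ha hb
  have hUa : U a = u a := by simp [hU]
  have hWa : W a = w a := by simp [hW]
  have hcongr : ∫ t in a..b, (f t * w t + u t * g t) = ∫ t in a..b, (f t * W t + U t * g t) := by
    refine intervalIntegral.integral_congr fun t ht => ?_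
    simp only [hu t ht, hw t ht, hU, hW]
  rw [hcongr, hu b right_mem_uIcc, hw b right_mem_uIcc]
  change U b * W b = _
  rw [hUa, hWa] at ha
  rw [ha, ← hb]
  ring

/-- `∫ f Fⁿ = Fⁿ⁺¹ / (n + 1)` for `F` a primitive of an integrable `f` vanishing at the left
endpoint. -/
theorem integral_mul_primitive_pow {f : ℝ → ℂ} {a b : ℝ} (hf : IntervalIntegrable f volume a b)
    (n : ℕ) : ∫ t in a..b, f t * (∫ s in a..t, f s) ^ n = (∫ s in a..b, f s) ^ (n + 1) / (n + 1) := by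
  have hF := hf.absolutelyContinuousOnInterval_integral_complex.continuousOn
  have main : ∀ n : ℕ, ∀ x ∈ uIcc a b, (∫ s in a..x, f s) ^ (n + 1) =
      ∫ t in a..x, (n + 1) * (f t * (∫ s in a..t, f s) ^ n) := by
    intro n
    induction n with
    | zero => intro x _; simp
    | succ n ih =>
      intro x hx
      have hsub := uIcc_subset_uIcc_left hx
      have hfx := hf.mono_set hsub
      have hi : IntervalIntegrable (fun t => ((n : ℂ) + 1) * (f t * (∫ s in a..t, f s) ^ n))
          volume a x := (hfx.mul_continuousOn ((hF.mono hsub).pow n)).const_mul _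
      have := primitive_mul_primitive (u := fun x => (∫ s in a..x, f s) ^ (n + 1))
        (w := fun x => ∫ s in a..x, f s) hi hfx
        (fun y hy => by simpa using ih y (hsub hy)) (fun y hy => by simp)
      simp only [intervalIntegral.integral_same] at this
      rw [pow_succ (∫ s in a..x, f s) (n + 1), this]
      simp only [ne_eq, Nat.add_eq_zero_iff, one_ne_zero, and_false, not_false_eq_true, zero_pow,
        mul_zero, zero_add]
      refine intervalIntegral.integral_congr fun t _ => ?_
      push_cast
      ring
  have h := main n b right_mem_uIcc
  rw [intervalIntegral.integral_const_mul] at h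
  rw [h]
  have : (n : ℂ) + 1 ≠ 0 := by exact_mod_cast Nat.succ_ne_zero n
  field_simp

theorem integral_mul_primitive_pow_real {f : ℝ → ℝ} {a b : ℝ}
    (hf : IntervalIntegrable f volume a b) (n : ℕ) :
    ∫ t in a..b, f t * (∫ s in a..t, f s) ^ n = (∫ s in a..b, f s) ^ (n + 1) / (n + 1) := by
  have h := integral_mul_primitive_pow (f := fun t => (f t : ℂ))
    hf.complex_ofReal n
  simp only [intervalIntegral.integral_ofReal] at h
  have h2 : ∀ t, (f t : ℂ) * ((∫ s in a..t, f s : ℝ) : ℂ) ^ n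
      = ((f t * (∫ s in a..t, f s) ^ n : ℝ) : ℂ) := fun t => by push_cast; rfl
  simp only [h2, intervalIntegral.integral_ofReal] at h
  exact_mod_cast h

/-- The fundamental theorem of calculus for absolutely continuous complex-valued functions. -/
theorem AbsolutelyContinuousOnInterval.integral_deriv_eq_sub_complex {f : ℝ → ℂ} {a b : ℝ}
    (hf : AbsolutelyContinuousOnInterval f a b) :
    IntervalIntegrable (deriv f) volume a b ∧ ∫ x in a..b, deriv f x = f b - f a := by
  have hre : AbsolutelyContinuousOnInterval (fun x => (f x).re) a b := by
    rw [absolutelyContinuousOnInterval_iff] at hf ⊢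
    intro ε hε
    obtain ⟨δ, hδ, H⟩ := hf ε hε
    refine ⟨δ, hδ, fun E hE hl => lt_of_le_of_lt (Finset.sum_le_sum fun i _ => ?_) (H E hE hl)⟩
    rw [Real.dist_eq, dist_eq_norm, ← Complex.sub_re]
    exact Complex.abs_re_le_norm _
  have him : AbsolutelyContinuousOnInterval (fun x => (f x).im) a b := by
    rw [absolutelyContinuousOnInterval_iff] at hf ⊢
    intro ε hε
    obtain ⟨δ, hδ, H⟩ := hf ε hε
    refine ⟨δ, hδ, fun E hE hl => lt_of_le_of_lt (Finset.sum_le_sum fun i _ => ?_) (H E hE hl)⟩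
    rw [Real.dist_eq, dist_eq_norm, ← Complex.sub_im]
    exact Complex.abs_im_le_norm _
  have hd : ∀ᵐ x, x ∈ uIcc a b → deriv f x =
      ((deriv (fun x => (f x).re) x : ℝ) : ℂ) + ((deriv (fun x => (f x).im) x : ℝ) : ℂ) * Complex.I := by
    filter_upwards [hre.ae_differentiableAt, him.ae_differentiableAt] with x h1 h2 hx
    have := ((h1 hx).hasDerivAt.ofReal_comp).add ((h2 hx).hasDerivAt.ofReal_comp.mul_const Complex.I)
    refine HasDerivAt.deriv ?_
    convert! this using 1
    ext y
    exact (Complex.re_add_im (f y)).symm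
  have hd' : ∀ᵐ x, x ∈ uIoc a b → ((deriv (fun x => (f x).re) x : ℝ) : ℂ) +
      ((deriv (fun x => (f x).im) x : ℝ) : ℂ) * Complex.I = deriv f x := by
    filter_upwards [hd] with x h hx using (h (uIoc_subset_uIcc hx)).symm
  have i1 : IntervalIntegrable (fun x => ((deriv (fun x => (f x).re) x : ℝ) : ℂ)) volume a b :=
    hre.intervalIntegrable_deriv.complex_ofReal
  have i2 : IntervalIntegrable (fun x => ((deriv (fun x => (f x).im) x : ℝ) : ℂ)) volume a b :=
    him.intervalIntegrable_deriv.complex_ofReal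
  refine ⟨(i1.add (i2.mul_const Complex.I)).congr_ae ?_, ?_⟩
  · exact (ae_restrict_iff' measurableSet_uIoc).2 hd'
  · rw [← intervalIntegral.integral_congr_ae hd', intervalIntegral.integral_add i1
      (i2.mul_const Complex.I), intervalIntegral.integral_mul_const,
      intervalIntegral.integral_ofReal, intervalIntegral.integral_ofReal,
      hre.integral_deriv_eq_sub, him.integral_deriv_eq_sub]
    apply Complex.ext <;> simp

/-! ### The kernel `sin (z u) / z` -/

/-- The entire function `z ↦ sin (z u) / z`, with the value `u` at `z = 0`. -/
noncomputable def sinKer (z : ℂ) (u : ℝ) : ℂ := u * dslope Complex.sin 0 (z * u)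

theorem mul_sinKer (z : ℂ) (u : ℝ) : z * sinKer z u = Complex.sin (z * u) := by
  have h := sub_smul_dslope Complex.sin 0 (z * u)
  simp only [sub_zero, smul_eq_mul, Complex.sin_zero] at h
  rw [sinKer, ← h]; ring

theorem sinKer_zero_left (u : ℝ) : sinKer 0 u = u := by
  simp [sinKer, dslope_same, (Complex.hasDerivAt_sin 0).deriv]

@[simp] theorem sinKer_zero_right (z : ℂ) : sinKer z 0 = 0 := by simp [sinKer]

theorem sinKer_neg_left (z : ℂ) (u : ℝ) : sinKer (-z) u = sinKer z u := by
  rcases eq_or_ne z 0 with rfl | hz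
  · simp
  · have h1 := mul_sinKer (-z) u
    have h2 := mul_sinKer z u
    rw [neg_mul, neg_mul, Complex.sin_neg, neg_inj, ← h2] at h1
    exact mul_left_cancel₀ hz h1

theorem differentiable_sinKer (u : ℝ) : Differentiable ℂ (fun z => sinKer z u) := by
  have h : Differentiable ℂ (dslope Complex.sin 0) := by
    rw [← differentiableOn_univ]
    exact (Complex.differentiableOn_dslope univ_mem).2 Complex.differentiable_sin.differentiableOn
  exact (h.comp (differentiable_id.mul_const _)).const_mul _

theorem continuous_sinKer : Continuous (fun p : ℂ × ℝ => sinKer p.1 p.2) := by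
  have h : Continuous (dslope Complex.sin 0) := by
    refine Differentiable.continuous (𝕜 := ℂ) ?_
    rw [← differentiableOn_univ]
    exact (Complex.differentiableOn_dslope univ_mem).2 Complex.differentiable_sin.differentiableOn
  exact (Complex.continuous_ofReal.comp continuous_snd).mul
    (h.comp (continuous_fst.mul (Complex.continuous_ofReal.comp continuous_snd)))

theorem continuous_sinKer_right (z : ℂ) : Continuous (sinKer z) :=
  continuous_sinKer.comp (Continuous.prodMk_right z)

theorem hasDerivAt_sin_mul_ofReal (z : ℂ) (u : ℝ) :
    HasDerivAt (fun u : ℝ => Complex.sin (z * u)) (z * Complex.cos (z * u)) u := by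
  have h := ((hasDerivAt_id (u : ℂ)).const_mul z).csin.comp_ofReal
  simpa [mul_comm] using h

theorem hasDerivAt_cos_mul_ofReal (z : ℂ) (u : ℝ) :
    HasDerivAt (fun u : ℝ => Complex.cos (z * u)) (-(z ^ 2 * sinKer z u)) u := by
  have h := ((hasDerivAt_id (u : ℂ)).const_mul z).ccos.comp_ofReal
  convert! h using 1
  rw [sq, mul_assoc, mul_sinKer]; simp [mul_comm]

theorem hasDerivAt_sinKer (z : ℂ) (u : ℝ) :
    HasDerivAt (sinKer z) (Complex.cos (z * u)) u := by
  rcases eq_or_ne z 0 with rfl | hz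
  · have : sinKer 0 = fun u : ℝ => (u : ℂ) := funext sinKer_zero_left
    rw [this]
    simpa using (hasDerivAt_id u).ofReal_comp
  · have h := (hasDerivAt_sin_mul_ofReal z u).const_mul z⁻¹
    convert! h using 1
    · ext v; rw [← mul_sinKer, inv_mul_cancel_left₀ hz]
    · rw [inv_mul_cancel_left₀ hz]

theorem continuous_cos_mul_ofReal (z : ℂ) : Continuous fun u : ℝ => Complex.cos (z * u) := by
  fun_prop

theorem sinKer_eq_integral (z : ℂ) (u : ℝ) : sinKer z u = ∫ v in (0 : ℝ)..u, Complex.cos (z * v) := by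
  rw [intervalIntegral.integral_eq_sub_of_hasDerivAt (fun x _ => hasDerivAt_sinKer z x)
    ((continuous_cos_mul_ofReal z).intervalIntegrable _ _)]
  simp

theorem cos_sq_add_sinKer_sq (z : ℂ) (u : ℝ) :
    Complex.cos (z * u) ^ 2 + z ^ 2 * sinKer z u ^ 2 = 1 := by
  rw [← mul_pow, mul_sinKer, Complex.cos_sq_add_sin_sq]

theorem sinKer_sub (z : ℂ) (x t : ℝ) : sinKer z (x - t) =
    sinKer z x * Complex.cos (z * t) - Complex.cos (z * x) * sinKer z t := by
  rcases eq_or_ne z 0 with rfl | hz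
  · simp [sinKer_zero_left]
  · apply mul_left_cancel₀ hz
    rw [mul_sub, ← mul_assoc, mul_sinKer, mul_left_comm z, mul_sinKer, mul_sinKer]
    push_cast
    rw [mul_sub, Complex.sin_sub]

theorem cos_sub_I_mul_sinKer (z : ℂ) (x : ℝ) :
    Complex.cos (z * x) - Complex.I * z * sinKer z x = Complex.exp (-(Complex.I * z * x)) := by
  rw [mul_assoc, mul_sinKer, show -(Complex.I * z * x) = (-(z * x)) * Complex.I by ring,
    Complex.exp_mul_I, Complex.cos_neg, Complex.sin_neg]
  ring

theorem cos_add_I_mul_sinKer (z : ℂ) (x : ℝ) :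
    Complex.cos (z * x) + Complex.I * z * sinKer z x = Complex.exp (Complex.I * z * x) := by
  rw [mul_assoc, mul_sinKer, show (Complex.I * z * x) = ((z * x)) * Complex.I by ring,
    Complex.exp_mul_I]
  ring

theorem norm_exp_I_mul_ofReal (z : ℂ) (u : ℝ) :
    ‖Complex.exp (Complex.I * z * u)‖ = Real.exp (-(z.im * u)) := by
  rw [Complex.norm_exp]; simp

theorem norm_cos_le (z : ℂ) {u : ℝ} (hu : 0 ≤ u) :
    ‖Complex.cos (z * u)‖ ≤ Real.exp (|z.im| * u) := by
  have h1 := cos_sub_I_mul_sinKer z u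
  have h2 := cos_add_I_mul_sinKer z u
  have h : Complex.cos (z * u) =
      (Complex.exp (Complex.I * z * u) + Complex.exp (Complex.I * (-z) * u)) / 2 := by
    rw [show Complex.I * (-z) * u = -(Complex.I * z * u) by ring, ← h1, ← h2]; ring
  have e1 : Real.exp (-(z.im * u)) ≤ Real.exp (|z.im| * u) :=
    Real.exp_le_exp.2 (by nlinarith [neg_abs_le z.im])
  have e2 : Real.exp (-((-z).im * u)) ≤ Real.exp (|z.im| * u) :=
    Real.exp_le_exp.2 (by simp only [Complex.neg_im]; nlinarith [le_abs_self z.im])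
  rw [h, norm_div, Complex.norm_two]
  have := norm_add_le (Complex.exp (Complex.I * z * u)) (Complex.exp (Complex.I * (-z) * u))
  rw [norm_exp_I_mul_ofReal, norm_exp_I_mul_ofReal] at this
  linarith

theorem norm_mul_sinKer_le (z : ℂ) {u : ℝ} (hu : 0 ≤ u) :
    ‖z‖ * ‖sinKer z u‖ ≤ Real.exp (|z.im| * u) := by
  have h1 := cos_sub_I_mul_sinKer z u
  have h2 := cos_add_I_mul_sinKer z u
  have h : Complex.I * (z * sinKer z u) =
      (Complex.exp (Complex.I * z * u) - Complex.exp (Complex.I * (-z) * u)) / 2 := by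
    rw [show Complex.I * (-z) * u = -(Complex.I * z * u) by ring, ← h1, ← h2]; ring
  have e1 : Real.exp (-(z.im * u)) ≤ Real.exp (|z.im| * u) :=
    Real.exp_le_exp.2 (by nlinarith [neg_abs_le z.im])
  have e2 : Real.exp (-((-z).im * u)) ≤ Real.exp (|z.im| * u) :=
    Real.exp_le_exp.2 (by simp only [Complex.neg_im]; nlinarith [le_abs_self z.im])
  have h3 : ‖z‖ * ‖sinKer z u‖ = ‖Complex.I * (z * sinKer z u)‖ := by simp
  rw [h3, h, norm_div, Complex.norm_two]
  have := norm_sub_le (Complex.exp (Complex.I * z * u)) (Complex.exp (Complex.I * (-z) * u))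
  rw [norm_exp_I_mul_ofReal, norm_exp_I_mul_ofReal] at this
  linarith

theorem norm_sinKer_le (z : ℂ) {u : ℝ} (hu : 0 ≤ u) :
    ‖sinKer z u‖ ≤ u * Real.exp (|z.im| * u) := by
  rw [sinKer_eq_integral]
  have := intervalIntegral.norm_integral_le_of_norm_le_const (a := 0) (b := u)
    (f := fun v : ℝ => Complex.cos (z * v)) (C := Real.exp (|z.im| * u)) (fun v hv => by
      rw [uIoc_of_le hu] at hv
      exact (norm_cos_le z hv.1.le).trans
        (Real.exp_le_exp.2 (mul_le_mul_of_nonneg_left hv.2 (abs_nonneg _))))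
  rwa [sub_zero, abs_of_nonneg hu, mul_comm] at this

/-! ### Holomorphic dependence of integrals on a parameter -/

theorem differentiable_intervalIntegral_of_locally_bounded {F : ℂ → ℝ → ℂ} {a b : ℝ}
    (hd : ∀ t, Differentiable ℂ (fun z => F z t))
    (hi : ∀ z, IntervalIntegrable (F z) volume a b)
    (hb : ∀ r : ℝ, ∃ B : ℝ → ℝ, IntervalIntegrable B volume a b ∧
      ∀ z : ℂ, ‖z‖ ≤ r → ∀ t ∈ uIoc a b, ‖F z t‖ ≤ B t) :
    Differentiable ℂ (fun z => ∫ t in a..b, F z t) := by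
  intro z₀
  obtain ⟨B, hB, hFB⟩ := hb (‖z₀‖ + 2)
  have hmeas : AEStronglyMeasurable (fun t => deriv (fun z => F z t) z₀)
      (volume.restrict (uIoc a b)) := by
    have hseq : Tendsto (fun n : ℕ => (((n : ℂ) + 1)⁻¹)) atTop (𝓝[≠] 0) := by
      refine tendsto_nhdsWithin_iff.2 ⟨?_, Eventually.of_forall fun n => ?_⟩
      · have := tendsto_one_div_add_atTop_nhds_zero_nat (𝕜 := ℂ)
        simpa using this
      · simpa using (Nat.cast_add_one_ne_zero n : (n : ℂ) + 1 ≠ 0)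
    refine aestronglyMeasurable_of_tendsto_ae atTop
      (f := fun (n : ℕ) t => (((n : ℂ) + 1)⁻¹)⁻¹ • (F (z₀ + ((n : ℂ) + 1)⁻¹) t - F z₀ t))
      (fun n => ?_) (Eventually.of_forall fun t => ?_)
    · exact AEStronglyMeasurable.const_smul
        ((intervalIntegrable_iff.1 (hi _)).aestronglyMeasurable.sub
          (intervalIntegrable_iff.1 (hi _)).aestronglyMeasurable) ((((n : ℂ) + 1)⁻¹)⁻¹)
    · exact ((hd t z₀).hasDerivAt.tendsto_slope_zero).comp hseq
  have key := intervalIntegral.hasDerivAt_integral_of_dominated_loc_of_deriv_le (𝕜 := ℂ)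
    (μ := volume) (F := F) (F' := fun z t => deriv (fun z => F z t) z) (x₀ := z₀)
    (s := Metric.ball z₀ 1) (bound := fun t => B t) (a := a) (b := b)
    (Metric.ball_mem_nhds _ one_pos)
    (Eventually.of_forall fun z => (intervalIntegrable_iff.1 (hi z)).aestronglyMeasurable)
    (hi z₀) hmeas
    (Eventually.of_forall fun t ht z hz => ?_) hB
    (Eventually.of_forall fun t _ z _ => (hd t z).hasDerivAt)
  · exact key.2.differentiableAt
  · have := Complex.norm_deriv_le_of_forall_mem_sphere_norm_le (c := z) (R := 1) (C := B t)
      (f := fun z => F z t) one_pos (hd t).diffContOnCl (fun w hw => ?_)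
    · simpa using this
    · refine hFB w ?_ t ht
      rw [Metric.mem_ball, dist_eq_norm] at hz
      rw [mem_sphere_iff_norm] at hw
      have h1 : w = (w - z) + (z - z₀) + z₀ := by ring
      rw [h1]
      refine (norm_add₃_le).trans ?_
      rw [hw]; linarith

/-! ### Successive approximations for `-y'' + q y = z² y` -/

/-- The `n`-th term of the series of successive approximations for the solution of
`-y'' + q y = z² y` with `y(0) = C` and `y'(0) = S`. -/
noncomputable def picard (q : ℝ → ℂ) (C S : ℂ) : ℕ → ℂ → ℝ → ℂ
  | 0, z, x => C * Complex.cos (z * x) + S * sinKer z x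
  | n + 1, z, x => ∫ t in (0 : ℝ)..x, sinKer z (x - t) * (q t * picard q C S n z t)

/-- The solution of `-y'' + q y = z² y` with `y(0) = C` and `y'(0) = S`. -/
noncomputable def cauchySol (q : ℝ → ℂ) (C S : ℂ) (z : ℂ) (x : ℝ) : ℂ :=
  ∑' n, picard q C S n z x

section Picard

variable {q : ℝ → ℂ}

theorem integral_sinKer_sub_mul {f : ℝ → ℂ} (z : ℂ) (x : ℝ)
    (hf : IntervalIntegrable f volume 0 x) :
    ∫ t in (0 : ℝ)..x, sinKer z (x - t) * f t =
      sinKer z x * (∫ t in (0 : ℝ)..x, Complex.cos (z * t) * f t) -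
        Complex.cos (z * x) * ∫ t in (0 : ℝ)..x, sinKer z t * f t := by
  rw [← intervalIntegral.integral_const_mul, ← intervalIntegral.integral_const_mul,
    ← intervalIntegral.integral_sub]
  · refine intervalIntegral.integral_congr fun t _ => ?_
    rw [sinKer_sub]; ring
  · exact (hf.continuousOn_mul (continuous_cos_mul_ofReal z).continuousOn).const_mul _
  · exact (hf.continuousOn_mul (continuous_sinKer_right z).continuousOn).const_mul _

theorem continuous_picard (hq : Integrable q) (C S : ℂ) (n : ℕ) (z : ℂ) :
    Continuous (picard q C S n z) := by
  induction n with
  | zero =>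
    exact (continuous_const.mul (continuous_cos_mul_ofReal z)).add
      (continuous_const.mul (continuous_sinKer_right z))
  | succ n ih =>
    have hi : ∀ x y, IntervalIntegrable (fun t => q t * picard q C S n z t) volume x y :=
      fun x y => hq.intervalIntegrable.mul_continuousOn ih.continuousOn
    have h : picard q C S (n + 1) z = fun x =>
        sinKer z x * (∫ t in (0 : ℝ)..x, Complex.cos (z * t) * (q t * picard q C S n z t)) -
        Complex.cos (z * x) * ∫ t in (0 : ℝ)..x, sinKer z t * (q t * picard q C S n z t) := by
      ext x
      exact integral_sinKer_sub_mul z x (hi 0 x)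
    rw [h]
    refine ((continuous_sinKer_right z).mul ?_).sub ((continuous_cos_mul_ofReal z).mul ?_)
    · exact intervalIntegral.continuous_primitive (fun x y =>
        (hi x y).continuousOn_mul (continuous_cos_mul_ofReal z).continuousOn) 0
    · exact intervalIntegral.continuous_primitive (fun x y =>
        (hi x y).continuousOn_mul (continuous_sinKer_right z).continuousOn) 0

theorem exists_norm_sinKer_le (r X : ℝ) :
    ∃ K, 0 ≤ K ∧ ∀ z : ℂ, ‖z‖ ≤ r → ∀ u : ℝ, |u| ≤ X → ‖sinKer z u‖ ≤ K := by
  have hcomp : IsCompact (Metric.closedBall (0 : ℂ) r ×ˢ Icc (-X) X) :=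
    (isCompact_closedBall _ _).prod isCompact_Icc
  obtain ⟨K, hK⟩ := hcomp.exists_bound_of_continuousOn continuous_sinKer.continuousOn
  refine ⟨max K 0, le_max_right _ _, fun z hz u hu => ?_⟩
  exact (hK (z, u) ⟨by simpa using hz, abs_le.1 hu⟩).trans (le_max_left _ _)

theorem exists_norm_picard_le (hq : Integrable q) (C S : ℂ) (n : ℕ) (r X : ℝ) :
    ∃ B, 0 ≤ B ∧ ∀ z : ℂ, ‖z‖ ≤ r → ∀ x : ℝ, |x| ≤ X → ‖picard q C S n z x‖ ≤ B := by
  induction n with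
  | zero =>
    have hcomp : IsCompact (Metric.closedBall (0 : ℂ) r ×ˢ Icc (-X) X) :=
      (isCompact_closedBall _ _).prod isCompact_Icc
    have hc : Continuous fun p : ℂ × ℝ => picard q C S 0 p.1 p.2 := by
      have := continuous_sinKer
      simp only [picard]
      fun_prop
    obtain ⟨K, hK⟩ := hcomp.exists_bound_of_continuousOn hc.continuousOn
    refine ⟨max K 0, le_max_right _ _, fun z hz u hu => ?_⟩
    exact (hK (z, u) ⟨by simpa using hz, abs_le.1 hu⟩).trans (le_max_left _ _)
  | succ n ih =>
    obtain ⟨B, hB0, hB⟩ := ih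
    obtain ⟨K, hK0, hK⟩ := exists_norm_sinKer_le r (2 * X)
    refine ⟨K * B * ∫ t, ‖q t‖, by positivity, fun z hz x hx => ?_⟩
    rw [picard]
    have h1 : ∀ t ∈ uIoc 0 x, ‖sinKer z (x - t) * (q t * picard q C S n z t)‖ ≤ K * B * ‖q t‖ := by
      intro t ht
      have ht' : |t| ≤ X := by
        rw [uIoc, mem_Ioc] at ht
        rw [abs_le] at hx ⊢
        rcases le_total 0 x with h | h
        · rw [min_eq_left h, max_eq_right h] at ht; constructor <;> linarith
        · rw [min_eq_right h, max_eq_left h] at ht; constructor <;> linarith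
      have hxt : |x - t| ≤ 2 * X := (abs_sub _ _).trans (by linarith)
      rw [norm_mul, norm_mul]
      calc _ ≤ K * (‖q t‖ * B) := by
            gcongr
            · exact hK z hz _ hxt
            · exact hB z hz t ht'
        _ = _ := by ring
    have hint : Integrable (fun t => K * B * ‖q t‖) := hq.norm.const_mul _
    calc _ ≤ ∫ t in uIoc 0 x, ‖sinKer z (x - t) * (q t * picard q C S n z t)‖ :=
          intervalIntegral.norm_integral_le_integral_norm_uIoc
      _ ≤ ∫ t in uIoc 0 x, K * B * ‖q t‖ := by
          refine integral_mono_of_nonneg (Eventually.of_forall fun _ => norm_nonneg _)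
            hint.integrableOn ?_
          exact (ae_restrict_iff' measurableSet_uIoc).2 (Eventually.of_forall h1)
      _ ≤ ∫ t, K * B * ‖q t‖ := setIntegral_le_integral hint
          (Eventually.of_forall fun t => by positivity)
      _ = _ := integral_const_mul _ _

theorem intervalIntegrable_picard_integrand (hq : Integrable q) (C S : ℂ) (n : ℕ) (z : ℂ)
    (x a b : ℝ) :
    IntervalIntegrable (fun t => sinKer z (x - t) * (q t * picard q C S n z t)) volume a b :=
  (hq.intervalIntegrable.mul_continuousOn
    (continuous_picard hq C S n z).continuousOn).continuousOn_mul
    ((continuous_sinKer_right z).comp (continuous_const.sub continuous_id)).continuousOn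

theorem differentiable_picard (hq : Integrable q) (C S : ℂ) (n : ℕ) (x : ℝ) :
    Differentiable ℂ (fun z => picard q C S n z x) := by
  induction n generalizing x with
  | zero =>
    simp only [picard]
    have h1 : Differentiable ℂ (fun z : ℂ => Complex.cos (z * x)) := by fun_prop
    exact (h1.const_mul C).add ((differentiable_sinKer x).const_mul S)
  | succ n ih =>
    simp only [picard]
    refine differentiable_intervalIntegral_of_locally_bounded (fun t => ?_)
      (fun z => intervalIntegrable_picard_integrand hq C S n z x 0 x) (fun r => ?_)
    · exact (differentiable_sinKer _).mul ((ih t).const_mul _)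
    · obtain ⟨B, hB0, hB⟩ := exists_norm_picard_le hq C S n r |x|
      obtain ⟨K, hK0, hK⟩ := exists_norm_sinKer_le r (2 * |x|)
      refine ⟨fun t => K * B * ‖q t‖, (hq.norm.const_mul _).intervalIntegrable, ?_⟩
      intro z hz t ht
      have ht' : |t| ≤ |x| := by
        rw [uIoc, mem_Ioc] at ht
        rcases le_total 0 x with h | h
        · rw [min_eq_left h, max_eq_right h] at ht
          rw [abs_of_nonneg h, abs_of_pos ht.1]; exact ht.2
        · rw [min_eq_right h, max_eq_left h] at ht
          rw [abs_of_nonpos h, abs_of_nonpos ht.2]; linarith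
      have hxt : |x - t| ≤ 2 * |x| := (abs_sub _ _).trans (by linarith)
      rw [norm_mul, norm_mul]
      calc _ ≤ K * (‖q t‖ * B) := by
            gcongr
            · exact hK z hz _ hxt
            · exact hB z hz t ht'
        _ = _ := by ring

theorem picard_neg_left (C S : ℂ) (n : ℕ) (z : ℂ) (x : ℝ) :
    picard q C S n (-z) x = picard q C S n z x := by
  induction n generalizing x with
  | zero => simp [picard, sinKer_neg_left, Complex.cos_neg]
  | succ n ih => simp only [picard, sinKer_neg_left, ih]

/-- Factorial decay of the successive approximations, given bounds on the kernel and on the free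
term of the same exponential type. -/
theorem norm_picard_le (hq : Integrable q) {C S z : ℂ} {κ M X : ℝ} (hκ : 0 ≤ κ)
    (hs : ∀ u ∈ Icc 0 X, ‖sinKer z u‖ ≤ κ * Real.exp (|z.im| * u))
    (h0 : ∀ x ∈ Icc 0 X, ‖picard q C S 0 z x‖ ≤ M * Real.exp (|z.im| * x))
    (n : ℕ) {x : ℝ} (hx : x ∈ Icc 0 X) :
    ‖picard q C S n z x‖ ≤
      M * Real.exp (|z.im| * x) * ((κ * ∫ t in (0 : ℝ)..x, ‖q t‖) ^ n / n.factorial) := by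
  induction n generalizing x with
  | zero => simpa using h0 x hx
  | succ n ih =>
    have hqi : ∀ a b, IntervalIntegrable (fun t => ‖q t‖) volume a b :=
      fun _ _ => hq.norm.intervalIntegrable
    have hcont : Continuous fun t => (∫ s in (0 : ℝ)..t, ‖q s‖) ^ n :=
      (intervalIntegral.continuous_primitive hqi 0).pow n
    rw [picard]
    set c := M * Real.exp (|z.im| * x) * κ ^ (n + 1) / n.factorial with hc
    have hM : 0 ≤ M * Real.exp (|z.im| * x) := (norm_nonneg _).trans (h0 x hx)
    calc _ ≤ ∫ t in (0 : ℝ)..x, c * (‖q t‖ * (∫ s in (0 : ℝ)..t, ‖q s‖) ^ n) := by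
          refine intervalIntegral.norm_integral_le_of_norm_le hx.1 (Eventually.of_forall ?_)
            (((hqi 0 x).mul_continuousOn hcont.continuousOn).const_mul c)
          intro t ht
          have htX : t ∈ Icc 0 X := ⟨ht.1.le, ht.2.trans hx.2⟩
          have h1 := hs (x - t) ⟨by linarith [ht.2], by linarith [hx.2, ht.1]⟩
          have h2 := ih htX
          rw [norm_mul, norm_mul]
          calc _ ≤ (κ * Real.exp (|z.im| * (x - t))) * (‖q t‖ * (M * Real.exp (|z.im| * t) *
                ((κ * ∫ s in (0 : ℝ)..t, ‖q s‖) ^ n / n.factorial))) := by gcongr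
            _ = (M * (Real.exp (|z.im| * (x - t)) * Real.exp (|z.im| * t))) * κ ^ (n + 1) /
                n.factorial * (‖q t‖ * (∫ s in (0 : ℝ)..t, ‖q s‖) ^ n) := by
                rw [mul_pow]; ring
            _ = _ := by
                rw [← Real.exp_add, show |z.im| * (x - t) + |z.im| * t = |z.im| * x by ring, hc]
      _ = c * ((∫ s in (0 : ℝ)..x, ‖q s‖) ^ (n + 1) / (n + 1)) := by
          rw [intervalIntegral.integral_const_mul, integral_mul_primitive_pow_real (hqi 0 x)]
      _ = _ := by
          rw [hc, Nat.factorial_succ, mul_pow]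
          push_cast
          field_simp

/-- The hypotheses of the factorial bound hold on every `[0, X]` with constants that depend on
`X` only through crude bounds. -/
theorem norm_picard_zero_le (C S z : ℂ) {X x : ℝ} (hx : x ∈ Icc 0 X) :
    ‖picard q C S 0 z x‖ ≤ (‖C‖ + ‖S‖ * X) * Real.exp (|z.im| * x) := by
  have h1 := norm_cos_le z hx.1
  have h2 : ‖sinKer z x‖ ≤ X * Real.exp (|z.im| * x) :=
    (norm_sinKer_le z hx.1).trans (by gcongr; exact hx.2)
  calc _ ≤ ‖C‖ * ‖Complex.cos (z * x)‖ + ‖S‖ * ‖sinKer z x‖ := by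
        rw [picard, ← norm_mul, ← norm_mul]; exact norm_add_le _ _
    _ ≤ ‖C‖ * Real.exp (|z.im| * x) + ‖S‖ * (X * Real.exp (|z.im| * x)) := by gcongr
    _ = _ := by ring

theorem norm_sinKer_le_of_mem_Icc (z : ℂ) {X u : ℝ} (hu : u ∈ Icc 0 X) :
    ‖sinKer z u‖ ≤ X * Real.exp (|z.im| * u) :=
  (norm_sinKer_le z hu.1).trans (by gcongr; exact hu.2)

theorem norm_picard_le_uniform (hq : Integrable q) (C S z : ℂ) {X x : ℝ} (hx : x ∈ Icc 0 X)
    (n : ℕ) : ‖picard q C S n z x‖ ≤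
      (‖C‖ + ‖S‖ * X) * Real.exp (|z.im| * X) * ((X * ∫ t, ‖q t‖) ^ n / n.factorial) := by
  have hX : 0 ≤ X := hx.1.trans hx.2
  have h := norm_picard_le hq (C := C) (S := S) (z := z) hX
    (fun u hu => norm_sinKer_le_of_mem_Icc z hu) (fun x hx => norm_picard_zero_le C S z hx) n hx
  have h1 : ∫ t in (0 : ℝ)..x, ‖q t‖ ≤ ∫ t, ‖q t‖ := by
    rw [intervalIntegral.integral_of_le hx.1]
    exact setIntegral_le_integral hq.norm (Eventually.of_forall fun t => norm_nonneg _)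
  have h0 : 0 ≤ ∫ t in (0 : ℝ)..x, ‖q t‖ :=
    intervalIntegral.integral_nonneg hx.1 fun _ _ => norm_nonneg _
  refine h.trans ?_
  gcongr
  exact hx.2

theorem summable_picard_bound (A B : ℝ) : Summable fun n : ℕ => A * (B ^ n / n.factorial) :=
  (Real.summable_pow_div_factorial B).mul_left A

theorem hasSum_picard (hq : Integrable q) (C S z : ℂ) {x : ℝ} (hx : 0 ≤ x) :
    HasSum (fun n => picard q C S n z x) (cauchySol q C S z x) :=
  (Summable.of_norm_bounded (summable_picard_bound _ _)
    (norm_picard_le_uniform hq C S z (X := x) ⟨hx, le_rfl⟩)).hasSum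

theorem continuousOn_cauchySol (hq : Integrable q) (C S z : ℂ) :
    ContinuousOn (cauchySol q C S z) (Ici 0) := by
  have h : ∀ X : ℝ, ContinuousOn (cauchySol q C S z) (Icc 0 X) := fun X =>
    continuousOn_tsum (fun n => (continuous_picard hq C S n z).continuousOn)
      (summable_picard_bound _ _) fun n x hx => norm_picard_le_uniform hq C S z hx n
  intro x hx
  refine ((h (x + 1)) x ⟨hx, by linarith⟩).mono_of_mem_nhdsWithin ?_
  exact mem_nhdsWithin.2 ⟨Iio (x + 1), isOpen_Iio, by simp, fun y hy => ⟨hy.2, hy.1.le⟩⟩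

theorem differentiable_cauchySol (hq : Integrable q) (C S : ℂ) {x : ℝ} (hx : 0 ≤ x) :
    Differentiable ℂ (fun z => cauchySol q C S z x) := by
  intro z₀
  have h : DifferentiableOn ℂ (fun z => cauchySol q C S z x) (Metric.ball 0 (‖z₀‖ + 1)) := by
    refine Complex.differentiableOn_tsum_of_summable_norm
      (u := fun n => (‖C‖ + ‖S‖ * x) * Real.exp ((‖z₀‖ + 1) * x) *
        ((x * ∫ t, ‖q t‖) ^ n / n.factorial)) (summable_picard_bound _ _)
      (fun n => (differentiable_picard hq C S n x).differentiableOn) Metric.isOpen_ball ?_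
    intro n z hz
    have hz' : |z.im| ≤ ‖z₀‖ + 1 :=
      (Complex.abs_im_le_norm z).trans (by simpa using (mem_ball_zero_iff.1 hz).le)
    have h0 : 0 ≤ ∫ t, ‖q t‖ := integral_nonneg fun _ => norm_nonneg _
    refine (norm_picard_le_uniform hq C S z (X := x) ⟨hx, le_rfl⟩ n).trans ?_
    gcongr
  exact (h z₀ (by simp)).differentiableAt (Metric.isOpen_ball.mem_nhds (by simp))

theorem cauchySol_neg_left (C S z : ℂ) (x : ℝ) : cauchySol q C S (-z) x = cauchySol q C S z x := by
  simp only [cauchySol, picard_neg_left]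

theorem norm_cauchySol_le (hq : Integrable q) {C S z : ℂ} {κ M X : ℝ} (hκ : 0 ≤ κ)
    (hs : ∀ u ∈ Icc 0 X, ‖sinKer z u‖ ≤ κ * Real.exp (|z.im| * u))
    (h0 : ∀ x ∈ Icc 0 X, ‖picard q C S 0 z x‖ ≤ M * Real.exp (|z.im| * x))
    {x : ℝ} (hx : x ∈ Icc 0 X) :
    ‖cauchySol q C S z x‖ ≤
      M * Real.exp (|z.im| * x) * Real.exp (κ * ∫ t in (0 : ℝ)..x, ‖q t‖) := by
  have h1 : HasSum (fun n : ℕ => M * Real.exp (|z.im| * x) *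
      ((κ * ∫ t in (0 : ℝ)..x, ‖q t‖) ^ n / n.factorial))
      (M * Real.exp (|z.im| * x) * Real.exp (κ * ∫ t in (0 : ℝ)..x, ‖q t‖)) := by
    refine HasSum.mul_left _ ?_
    rw [Real.exp_eq_exp_ℝ]
    exact NormedSpace.expSeries_div_hasSum_exp _
  exact (hasSum_picard hq C S z hx.1).norm_le_of_bounded h1
    (fun n => norm_picard_le hq hκ hs h0 n hx)

theorem intervalIntegrable_mul_cauchySol (hq : Integrable q) (C S z : ℂ) {x : ℝ} (hx : 0 ≤ x) :
    IntervalIntegrable (fun t => q t * cauchySol q C S z t) volume 0 x :=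
  hq.intervalIntegrable.mul_continuousOn ((continuousOn_cauchySol hq C S z).mono (by
    rw [uIcc_of_le hx]; exact fun t ht => ht.1))

/-- The Volterra integral equation satisfied by the sum of the successive approximations. -/
theorem cauchySol_eq (hq : Integrable q) (C S z : ℂ) {x : ℝ} (hx : 0 ≤ x) :
    cauchySol q C S z x = C * Complex.cos (z * x) + S * sinKer z x +
      ∫ t in (0 : ℝ)..x, sinKer z (x - t) * (q t * cauchySol q C S z t) := by
  have h1 := hasSum_picard hq C S z hx
  have h2 : HasSum (fun n => picard q C S (n + 1) z x)
      (∫ t in (0 : ℝ)..x, sinKer z (x - t) * (q t * cauchySol q C S z t)) := by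
    set A := (‖C‖ + ‖S‖ * x) * Real.exp (|z.im| * x)
    set B := x * ∫ t, ‖q t‖
    obtain ⟨K, hK0, hK⟩ := exists_norm_sinKer_le ‖z‖ x
    simp only [picard]
    refine intervalIntegral.hasSum_integral_of_dominated_convergence
      (fun n t => K * ‖q t‖ * (A * (B ^ n / n.factorial))) (fun n => ?_) (fun n => ?_) ?_ ?_ ?_
    · exact (intervalIntegrable_iff.1
        (intervalIntegrable_picard_integrand hq C S n z x 0 x)).aestronglyMeasurable
    · refine Eventually.of_forall fun t ht => ?_
      rw [uIoc_of_le hx] at ht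
      rw [norm_mul, norm_mul, mul_assoc K]
      gcongr
      · exact hK z le_rfl _ (by rw [abs_le]; constructor <;> linarith [ht.1, ht.2])
      · exact norm_picard_le_uniform hq C S z ⟨ht.1.le, ht.2⟩ n
    · exact Eventually.of_forall fun t _ => (summable_picard_bound A B).mul_left _
    · simp only [tsum_mul_left]
      exact ((hq.norm.const_mul K).mul_const _).intervalIntegrable
    · refine Eventually.of_forall fun t ht => ?_
      rw [uIoc_of_le hx] at ht
      exact ((hasSum_picard hq C S z ht.1.le).mul_left _).mul_left _
  have h3 := (hasSum_nat_add_iff' 1).2 h1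
  have h4 := h3.unique h2
  simp only [Finset.range_one, Finset.sum_singleton] at h4
  rw [← h4]
  simp [picard]

end Picard

/-! ### Solutions, Wronskians and the Jost function -/

/-- `y` is a Carathéodory solution of `-y'' + q y = z² y` on `[0, ∞)` and `v` is its derivative. -/
def IsSolutionPair (q : ℝ → ℂ) (z : ℂ) (y v : ℝ → ℂ) : Prop :=
  ContinuousOn y (Ici 0) ∧ ContinuousOn v (Ici 0) ∧
    (∀ x : ℝ, 0 ≤ x → y x = y 0 + ∫ t in (0 : ℝ)..x, v t) ∧
    (∀ x : ℝ, 0 ≤ x → v x = v 0 + ∫ t in (0 : ℝ)..x, (q t - z ^ 2) * y t)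

/-- The Jost function of a potential supported in `[0, a]`, in terms of the solution `φ` with
`φ(0) = 0` and `φ'(0) = 1`: it is `1 + ∫₀ᵃ e^{izt} q(t) φ(t, z) dt` for every complex `z`. -/
noncomputable def jostIntegral (q : ℝ → ℂ) (a : ℝ) (z : ℂ) : ℂ :=
  1 + ∫ t in (0 : ℝ)..a, Complex.exp (Complex.I * z * t) * (q t * cauchySol q 0 1 z t)

theorem hasDerivAt_exp_mul_ofReal (c : ℂ) (x : ℝ) :
    HasDerivAt (fun t : ℝ => Complex.exp (c * t)) (c * Complex.exp (c * x)) x := by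
  have h := ((hasDerivAt_id (x : ℂ)).const_mul c).cexp.comp_ofReal
  simpa [mul_comm] using h

theorem continuous_exp_mul_ofReal (c : ℂ) : Continuous fun t : ℝ => Complex.exp (c * t) := by
  fun_prop

theorem exp_mul_eq_primitive (c : ℂ) (x y : ℝ) : Complex.exp (c * y) =
    Complex.exp (c * x) + ∫ t in x..y, c * Complex.exp (c * t) := by
  rw [intervalIntegral.integral_eq_sub_of_hasDerivAt (fun t _ => hasDerivAt_exp_mul_ofReal c t)
    ((continuous_const.mul (continuous_exp_mul_ofReal c)).intervalIntegrable _ _)]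
  ring

namespace IsSolutionPair

variable {q q₁ q₂ : ℝ → ℂ} {z : ℂ} {y v y₁ v₁ y₂ v₂ : ℝ → ℂ}

theorem congr (h : q₁ =ᵐ[halfLine] q₂) (H : IsSolutionPair q₁ z y v) :
    IsSolutionPair q₂ z y v := by
  refine ⟨H.1, H.2.1, H.2.2.1, fun x hx => ?_⟩
  rw [H.2.2.2 x hx]
  congr 1
  refine intervalIntegral.integral_congr_ae ?_
  filter_upwards [(ae_restrict_iff' measurableSet_Ioi).1 h] with t ht htx
  rw [uIoc_of_le hx] at htx
  rw [ht htx.1]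

theorem continuousOn_uIcc (H : IsSolutionPair q z y v) {x : ℝ} (hx : 0 ≤ x) :
    ContinuousOn y (uIcc 0 x) ∧ ContinuousOn v (uIcc 0 x) := by
  have : uIcc 0 x ⊆ Ici 0 := by rw [uIcc_of_le hx]; exact fun t ht => ht.1
  exact ⟨H.1.mono this, H.2.1.mono this⟩

theorem intervalIntegrable_potential (H : IsSolutionPair q z y v) (hq : Integrable q) {x : ℝ}
    (hx : 0 ≤ x) : IntervalIntegrable (fun t => (q t - z ^ 2) * y t) volume 0 x :=
  (hq.intervalIntegrable.sub intervalIntegrable_const).mul_continuousOn (H.continuousOn_uIcc hx).1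

theorem linear_combination (H₁ : IsSolutionPair q z y₁ v₁) (H₂ : IsSolutionPair q z y₂ v₂)
    (hq : Integrable q) (α β : ℂ) :
    IsSolutionPair q z (fun x => α * y₁ x + β * y₂ x) (fun x => α * v₁ x + β * v₂ x) := by
  refine ⟨(continuousOn_const.mul H₁.1).add (continuousOn_const.mul H₂.1),
    (continuousOn_const.mul H₁.2.1).add (continuousOn_const.mul H₂.2.1), fun x hx => ?_,
    fun x hx => ?_⟩
  · have i1 := (H₁.continuousOn_uIcc hx).2.intervalIntegrable (μ := volume)
    have i2 := (H₂.continuousOn_uIcc hx).2.intervalIntegrable (μ := volume)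
    rw [intervalIntegral.integral_add (i1.const_mul _) (i2.const_mul _),
      intervalIntegral.integral_const_mul, intervalIntegral.integral_const_mul]
    change α * y₁ x + β * y₂ x = α * y₁ 0 + β * y₂ 0 + _
    rw [H₁.2.2.1 x hx, H₂.2.2.1 x hx]
    ring
  · have i1 := H₁.intervalIntegrable_potential hq hx
    have i2 := H₂.intervalIntegrable_potential hq hx
    rw [show (fun t => (q t - z ^ 2) * (α * y₁ t + β * y₂ t)) = fun t =>
      α * ((q t - z ^ 2) * y₁ t) + β * ((q t - z ^ 2) * y₂ t) by ext t; ring,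
      intervalIntegral.integral_add (i1.const_mul _) (i2.const_mul _),
      intervalIntegral.integral_const_mul, intervalIntegral.integral_const_mul]
    change α * v₁ x + β * v₂ x = α * v₁ 0 + β * v₂ 0 + _
    rw [H₁.2.2.2 x hx, H₂.2.2.2 x hx]
    ring

theorem primitives (H : IsSolutionPair q z y v) {x : ℝ} (hx : 0 ≤ x) :
    (∀ s ∈ uIcc 0 x, y s = y 0 + ∫ t in (0 : ℝ)..s, v t) ∧
      (∀ s ∈ uIcc 0 x, v s = v 0 + ∫ t in (0 : ℝ)..s, (q t - z ^ 2) * y t) := by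
  rw [uIcc_of_le hx]
  exact ⟨fun s hs => H.2.2.1 s hs.1, fun s hs => H.2.2.2 s hs.1⟩

theorem wronskian (H₁ : IsSolutionPair q₁ z y₁ v₁) (H₂ : IsSolutionPair q₂ z y₂ v₂)
    (hq₁ : Integrable q₁) (hq₂ : Integrable q₂) {x : ℝ} (hx : 0 ≤ x) :
    y₁ x * v₂ x - v₁ x * y₂ x = y₁ 0 * v₂ 0 - v₁ 0 * y₂ 0 +
      ∫ t in (0 : ℝ)..x, (q₂ t - q₁ t) * (y₁ t * y₂ t) := by
  have c1 := H₁.continuousOn_uIcc hx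
  have c2 := H₂.continuousOn_uIcc hx
  have p1 := H₁.intervalIntegrable_potential hq₁ hx
  have p2 := H₂.intervalIntegrable_potential hq₂ hx
  have e1 := primitive_mul_primitive c1.2.intervalIntegrable p2 (H₁.primitives hx).1
    (H₂.primitives hx).2
  have e2 := primitive_mul_primitive p1 c2.2.intervalIntegrable (H₁.primitives hx).2
    (H₂.primitives hx).1
  rw [e1, e2, add_sub_add_comm, ← intervalIntegral.integral_sub]
  · congr 1
    refine intervalIntegral.integral_congr fun t _ => ?_
    ring
  · exact (c1.2.mul c2.2).intervalIntegrable.add (p2.continuousOn_mul c1.1)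
  · exact (p1.mul_continuousOn c2.1).add (c1.2.mul c2.2).intervalIntegrable

/-- The function `e^{izx} (y' - iz y)` is a primitive of `e^{izx} q y`. -/
theorem exp_mul_sub (H : IsSolutionPair q z y v) (hq : Integrable q) {x : ℝ} (hx : 0 ≤ x) :
    Complex.exp (Complex.I * z * x) * (v x - Complex.I * z * y x) = (v 0 - Complex.I * z * y 0) +
      ∫ t in (0 : ℝ)..x, Complex.exp (Complex.I * z * t) * (q t * y t) := by
  set c := Complex.I * z with hc
  have c1 := H.continuousOn_uIcc hx
  have p1 := H.intervalIntegrable_potential hq hx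
  have hexp := (continuous_exp_mul_ofReal c)
  have ie : IntervalIntegrable (fun t : ℝ => c * Complex.exp (c * t)) volume 0 x :=
    (continuous_const.mul hexp).intervalIntegrable 0 x
  have e1 := primitive_mul_primitive ie p1 (fun s _ => exp_mul_eq_primitive c 0 s)
    (H.primitives hx).2
  have e2 := primitive_mul_primitive ie c1.2.intervalIntegrable
    (fun s _ => exp_mul_eq_primitive c 0 s) (H.primitives hx).1
  have i1 : IntervalIntegrable (fun t : ℝ => c * Complex.exp (c * t) * v t +
      Complex.exp (c * t) * ((q t - z ^ 2) * y t)) volume 0 x :=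
    (ie.mul_continuousOn c1.2).add (p1.continuousOn_mul hexp.continuousOn)
  have i2 : IntervalIntegrable (fun t : ℝ => c * Complex.exp (c * t) * y t +
      Complex.exp (c * t) * v t) volume 0 x :=
    (ie.mul_continuousOn c1.1).add (hexp.continuousOn.mul c1.2).intervalIntegrable
  rw [mul_sub, mul_left_comm, e1, e2]
  have e3 : ∫ t in (0 : ℝ)..x, Complex.exp (c * t) * (q t * y t) =
      (∫ t in (0 : ℝ)..x, (c * Complex.exp (c * t) * v t +
        Complex.exp (c * t) * ((q t - z ^ 2) * y t))) -
      c * ∫ t in (0 : ℝ)..x, (c * Complex.exp (c * t) * y t + Complex.exp (c * t) * v t) := by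
    rw [← intervalIntegral.integral_const_mul, ← intervalIntegral.integral_sub i1 (i2.const_mul _)]
    refine intervalIntegral.integral_congr fun t _ => ?_
    have hc2 : c ^ 2 = -z ^ 2 := by rw [hc, mul_pow, Complex.I_sq]; ring
    change _ = c * Complex.exp (c * t) * v t + Complex.exp (c * t) * ((q t - z ^ 2) * y t) -
      c * (c * Complex.exp (c * t) * y t + Complex.exp (c * t) * v t)
    linear_combination (Complex.exp (c * t) * y t) * hc2
  rw [e3]
  simp only [Complex.ofReal_zero, mul_zero, Complex.exp_zero, one_mul]
  ring

/-- Beyond the support of the potential, `e^{izx} (y' - iz y)` is constant. -/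
theorem exp_mul_sub_of_le (H : IsSolutionPair q z y v) (hq : Integrable q) {a x : ℝ} (ha : 0 ≤ a)
    (hqa : ∀ t, a < t → q t = 0) (hx : a ≤ x) :
    Complex.exp (Complex.I * z * x) * (v x - Complex.I * z * y x) =
      Complex.exp (Complex.I * z * a) * (v a - Complex.I * z * y a) := by
  have hx0 := ha.trans hx
  rw [H.exp_mul_sub hq hx0, H.exp_mul_sub hq ha]
  have hi : ∀ b, 0 ≤ b → IntervalIntegrable (fun t : ℝ => Complex.exp (Complex.I * z * t) *
      (q t * y t)) volume 0 b := fun b hb =>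
    (hq.intervalIntegrable.mul_continuousOn (H.continuousOn_uIcc hb).1).continuousOn_mul
      (continuous_exp_mul_ofReal _).continuousOn
  rw [← intervalIntegral.integral_add_adjacent_intervals (hi a ha)
    ((hi a ha).symm.trans (hi x hx0))]
  have : ∫ t in a..x, Complex.exp (Complex.I * z * t) * (q t * y t) = 0 := by
    rw [intervalIntegral.integral_congr_ae (g := fun _ => 0) (Eventually.of_forall fun t ht => ?_)]
    · simp
    · rw [uIoc_of_le hx] at ht
      simp [hqa t ht.1]
  rw [this, add_zero]

/-- Beyond the support of the potential a solution is a combination of two exponentials. -/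
theorem exp_neg_mul_of_le (H : IsSolutionPair q z y v) (hq : Integrable q) {a x : ℝ} (ha : 0 ≤ a)
    (hqa : ∀ t, a < t → q t = 0) (hx : a ≤ x) :
    Complex.exp (-(Complex.I * z) * x) * y x = Complex.exp (-(Complex.I * z) * a) * y a +
      Complex.exp (Complex.I * z * a) * (v a - Complex.I * z * y a) *
        ∫ t in a..x, Complex.exp (-(2 * Complex.I * z) * t) := by
  set c := Complex.I * z with hc
  have hx0 := ha.trans hx
  have hsub : uIcc a x ⊆ Ici 0 := by rw [uIcc_of_le hx]; exact fun t ht => ha.trans ht.1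
  have cy := H.1.mono hsub
  have cv := H.2.1.mono hsub
  have ie : IntervalIntegrable (fun t : ℝ => -c * Complex.exp (-c * t)) volume a x :=
    (continuous_const.mul (continuous_exp_mul_ofReal (-c))).intervalIntegrable a x
  have hv : ∀ b, 0 ≤ b → IntervalIntegrable v volume 0 b := fun b hb =>
    (H.continuousOn_uIcc hb).2.intervalIntegrable
  have hy : ∀ s ∈ uIcc a x, y s = y a + ∫ t in a..s, v t := by
    intro s hs
    rw [uIcc_of_le hx] at hs
    have hs0 := ha.trans hs.1
    rw [H.2.2.1 s hs0, H.2.2.1 a ha, add_assoc, intervalIntegral.integral_add_adjacent_intervals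
      (hv a ha) ((hv a ha).symm.trans (hv s hs0))]
  rw [primitive_mul_primitive ie cv.intervalIntegrable (fun s _ => exp_mul_eq_primitive (-c) a s) hy,
    ← intervalIntegral.integral_const_mul]
  congr 1
  refine intervalIntegral.integral_congr fun t ht => ?_
  rw [uIcc_of_le hx] at ht
  have h := H.exp_mul_sub_of_le hq ha hqa ht.1
  change -c * Complex.exp (-c * t) * y t + Complex.exp (-c * t) * v t = _ * _
  rw [← h, ← hc, show -(2 * Complex.I * z) * (t : ℂ) = -c * t + -c * t by rw [hc]; ring,
    Complex.exp_add]
  have h2 : Complex.exp (c * t) * Complex.exp (-c * t) = 1 := by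
    rw [← Complex.exp_add]; simp
  linear_combination (-(Complex.exp (-c * t) * (v t - c * y t))) * h2

end IsSolutionPair

section CauchySol

variable {q : ℝ → ℂ}

/-- The derivative of `cauchySol q C S z`, by variation of parameters. -/
noncomputable def cauchySolDeriv (q : ℝ → ℂ) (C S : ℂ) (z : ℂ) (x : ℝ) : ℂ :=
  Complex.cos (z * x) *
      (S + ∫ t in (0 : ℝ)..x, Complex.cos (z * t) * (q t * cauchySol q C S z t)) +
    z ^ 2 * (sinKer z x *
      (-C + ∫ t in (0 : ℝ)..x, sinKer z t * (q t * cauchySol q C S z t)))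

@[simp] theorem cauchySol_zero (hq : Integrable q) (C S z : ℂ) : cauchySol q C S z 0 = C := by
  rw [cauchySol_eq hq C S z le_rfl]; simp

@[simp] theorem cauchySolDeriv_zero (C S z : ℂ) : cauchySolDeriv q C S z 0 = S := by
  simp [cauchySolDeriv]

theorem isSolutionPair_cauchySol (hq : Integrable q) (C S z : ℂ) :
    IsSolutionPair q z (cauchySol q C S z) (cauchySolDeriv q C S z) := by
  set f : ℝ → ℂ := fun t => q t * cauchySol q C S z t with hf
  have hfi : ∀ x, 0 ≤ x → IntervalIntegrable f volume 0 x := fun x hx =>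
    intervalIntegrable_mul_cauchySol hq C S z hx
  set A : ℝ → ℂ := fun x => S + ∫ t in (0 : ℝ)..x, Complex.cos (z * t) * f t with hA
  set B : ℝ → ℂ := fun x => -C + ∫ t in (0 : ℝ)..x, sinKer z t * f t with hB
  have hci : ∀ x, 0 ≤ x → IntervalIntegrable (fun t : ℝ => Complex.cos (z * t) * f t) volume 0 x :=
    fun x hx => (hfi x hx).continuousOn_mul (continuous_cos_mul_ofReal z).continuousOn
  have hsi : ∀ x, 0 ≤ x → IntervalIntegrable (fun t : ℝ => sinKer z t * f t) volume 0 x :=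
    fun x hx => (hfi x hx).continuousOn_mul (continuous_sinKer_right z).continuousOn
  have hAc : ∀ x, 0 ≤ x → ContinuousOn A (uIcc 0 x) := fun x hx =>
    continuousOn_const.add (hci x hx).absolutelyContinuousOnInterval_integral_complex.continuousOn
  have hBc : ∀ x, 0 ≤ x → ContinuousOn B (uIcc 0 x) := fun x hx =>
    continuousOn_const.add (hsi x hx).absolutelyContinuousOnInterval_integral_complex.continuousOn
  have hv : cauchySolDeriv q C S z = fun x : ℝ => Complex.cos (z * x) * A x +
    z ^ 2 * (sinKer z x * B x) := rfl
  have hy : ∀ x, 0 ≤ x → cauchySol q C S z x = sinKer z x * A x - Complex.cos (z * x) * B x := by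
    intro x hx
    rw [cauchySol_eq hq C S z hx, integral_sinKer_sub_mul z x (hfi x hx)]
    simp only [hA, hB]
    ring
  have hvc : ∀ x, 0 ≤ x → ContinuousOn (cauchySolDeriv q C S z) (uIcc 0 x) := fun x hx => by
    rw [hv]
    exact ((continuous_cos_mul_ofReal z).continuousOn.mul (hAc x hx)).add
      (continuousOn_const.mul ((continuous_sinKer_right z).continuousOn.mul (hBc x hx)))
  have isin : ∀ x, IntervalIntegrable (fun u : ℝ => -(z ^ 2 * sinKer z u)) volume 0 x := fun x =>
    ((continuous_const.mul (continuous_sinKer_right z)).neg).intervalIntegrable _ _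
  have icos : ∀ x, IntervalIntegrable (fun u : ℝ => Complex.cos (z * u)) volume 0 x := fun x =>
    (continuous_cos_mul_ofReal z).intervalIntegrable _ _
  have pcos : ∀ s : ℝ, Complex.cos (z * s) = Complex.cos (z * (0 : ℝ)) +
      ∫ t in (0 : ℝ)..s, -(z ^ 2 * sinKer z t) := fun s => by
    rw [intervalIntegral.integral_eq_sub_of_hasDerivAt
      (fun t _ => hasDerivAt_cos_mul_ofReal z t) (isin s)]; ring
  have psin : ∀ s : ℝ, sinKer z s = sinKer z 0 + ∫ t in (0 : ℝ)..s, Complex.cos (z * t) :=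
    fun s => by rw [← sinKer_eq_integral]; simp
  have pA : ∀ s, A s = A 0 + ∫ t in (0 : ℝ)..s, Complex.cos (z * t) * f t := fun s => by simp [hA]
  have pB : ∀ s, B s = B 0 + ∫ t in (0 : ℝ)..s, sinKer z t * f t := fun s => by simp [hB]
  have hA0 : A 0 = S := by simp [hA]
  have hB0 : B 0 = -C := by simp [hB]
  refine ⟨continuousOn_cauchySol hq C S z, ?_, fun x hx => ?_, fun x hx => ?_⟩
  · intro x hx
    have hx1 : (0 : ℝ) ≤ x + 1 := by linarith [mem_Ici.1 hx]
    refine (hvc (x + 1) hx1 x ?_).mono_of_mem_nhdsWithin ?_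
    · rw [uIcc_of_le hx1]; exact ⟨hx, by linarith⟩
    · rw [uIcc_of_le hx1]
      exact mem_nhdsWithin.2 ⟨Iio (x + 1), isOpen_Iio, by simp, fun y hy => ⟨hy.2, hy.1.le⟩⟩
  · have e1 := primitive_mul_primitive (icos x) (hci x hx) (fun s _ => psin s) (fun s _ => pA s)
    have e2 := primitive_mul_primitive (isin x) (hsi x hx) (fun s _ => pcos s) (fun s _ => pB s)
    rw [cauchySol_zero hq, hy x hx, e1, e2, hB0, hv]
    simp only [sinKer_zero_right, zero_mul, Complex.ofReal_zero, mul_zero, Complex.cos_zero,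
      one_mul, zero_add]
    rw [sub_add_eq_sub_sub, sub_neg_eq_add, add_comm _ C, add_sub_assoc,
      ← intervalIntegral.integral_sub]
    · congr 1
      refine intervalIntegral.integral_congr fun t _ => ?_
      ring
    · exact ((icos x).mul_continuousOn (hAc x hx)).add
        ((hci x hx).continuousOn_mul (continuous_sinKer_right z).continuousOn)
    · exact ((isin x).mul_continuousOn (hBc x hx)).add
        ((hsi x hx).continuousOn_mul (continuous_cos_mul_ofReal z).continuousOn)
  · have e1 := primitive_mul_primitive (isin x) (hci x hx) (fun s _ => pcos s) (fun s _ => pA s)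
    have e2 := primitive_mul_primitive (icos x) (hsi x hx) (fun s _ => psin s) (fun s _ => pB s)
    rw [cauchySolDeriv_zero, hv]
    simp only []
    rw [e1, e2, hA0]
    simp only [sinKer_zero_right, zero_mul, Complex.ofReal_zero, mul_zero, Complex.cos_zero,
      one_mul, zero_add]
    rw [add_assoc, ← intervalIntegral.integral_const_mul, ← intervalIntegral.integral_add]
    · congr 1
      refine intervalIntegral.integral_congr fun t ht => ?_
      rw [uIcc_of_le hx] at ht
      have h1 := hy t ht.1
      have h2 := cos_sq_add_sinKer_sq z t
      have h3 : f t = q t * cauchySol q C S z t := rfl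
      linear_combination (f t) * h2 + h3 + z ^ 2 * h1
    · exact ((isin x).mul_continuousOn (hAc x hx)).add
        ((hci x hx).continuousOn_mul (continuous_cos_mul_ofReal z).continuousOn)
    · exact (((icos x).mul_continuousOn (hBc x hx)).add
        ((hsi x hx).continuousOn_mul (continuous_sinKer_right z).continuousOn)).const_mul _

theorem jostIntegral_eq (hq : Integrable q) {a : ℝ} (ha : 0 ≤ a) (z : ℂ) :
    jostIntegral q a z = Complex.exp (Complex.I * z * a) *
      (cauchySolDeriv q 0 1 z a - Complex.I * z * cauchySol q 0 1 z a) := by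
  rw [(isSolutionPair_cauchySol hq 0 1 z).exp_mul_sub hq ha]
  simp [jostIntegral, cauchySol_zero hq]

theorem cauchySolDeriv_neg_left (C S z : ℂ) (x : ℝ) :
    cauchySolDeriv q C S (-z) x = cauchySolDeriv q C S z x := by
  simp only [cauchySolDeriv, cauchySol_neg_left, sinKer_neg_left, neg_mul, Complex.cos_neg, neg_sq]

theorem jostIntegral_neg_eq (hq : Integrable q) {a : ℝ} (ha : 0 ≤ a) (z : ℂ) :
    jostIntegral q a (-z) = Complex.exp (-(Complex.I * z * a)) *
      (cauchySolDeriv q 0 1 z a + Complex.I * z * cauchySol q 0 1 z a) := by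
  rw [jostIntegral_eq hq ha, cauchySolDeriv_neg_left, cauchySol_neg_left]
  rw [show Complex.I * -z * (a : ℂ) = -(Complex.I * z * a) by ring]
  ring

theorem differentiable_jostIntegral (hq : Integrable q) {a : ℝ} (ha : 0 ≤ a) :
    Differentiable ℂ (jostIntegral q a) := by
  have hmax : ∀ z, EqOn (fun t : ℝ => Complex.exp (Complex.I * z * t) *
      (q t * cauchySol q 0 1 z (max t 0))) (fun t : ℝ => Complex.exp (Complex.I * z * t) *
      (q t * cauchySol q 0 1 z t)) (uIcc 0 a) := fun z t ht => by
    rw [uIcc_of_le ha] at ht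
    simp only [max_eq_left ht.1]
  have heq : jostIntegral q a = fun z => 1 + ∫ t in (0 : ℝ)..a, Complex.exp (Complex.I * z * t) *
      (q t * cauchySol q 0 1 z (max t 0)) := by
    ext z
    rw [jostIntegral, intervalIntegral.integral_congr (hmax z)]
  rw [heq]
  refine (differentiable_intervalIntegral_of_locally_bounded (fun t => ?_) (fun z => ?_)
    (fun r => ?_)).const_add 1
  · exact (by fun_prop : Differentiable ℂ fun z : ℂ => Complex.exp (Complex.I * z * t)).mul
      ((differentiable_cauchySol hq 0 1 (le_max_right t 0)).const_mul _)
  · refine ((intervalIntegrable_mul_cauchySol hq 0 1 z ha).continuousOn_mul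
      (continuous_exp_mul_ofReal (Complex.I * z)).continuousOn).congr_ae ?_
    exact (ae_restrict_iff' measurableSet_uIoc).2 (Eventually.of_forall fun t ht =>
      (hmax z (uIoc_subset_uIcc ht)).symm)
  · have hQ : 0 ≤ ∫ t, ‖q t‖ := integral_nonneg fun _ => norm_nonneg _
    refine ⟨fun t => Real.exp (|r| * a) * (‖q t‖ *
      (a * Real.exp (|r| * a) * Real.exp (a * ∫ t, ‖q t‖))),
      ((hq.norm.mul_const _).const_mul _).intervalIntegrable, fun z hz t ht => ?_⟩
    rw [uIoc_of_le ha] at ht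
    have him : |z.im| ≤ |r| := (Complex.abs_im_le_norm z).trans (hz.trans (le_abs_self r))
    have hta : |z.im| * t ≤ |r| * a := by
      gcongr
      · exact ht.1.le
      · exact ht.2
    rw [norm_mul, norm_mul, norm_exp_I_mul_ofReal, max_eq_left ht.1.le]
    have h1 : ∫ t in (0 : ℝ)..t, ‖q t‖ ≤ ∫ t, ‖q t‖ := by
      rw [intervalIntegral.integral_of_le ht.1.le]
      exact setIntegral_le_integral hq.norm (Eventually.of_forall fun t => norm_nonneg _)
    have h2 := norm_cauchySol_le hq (C := 0) (S := 1) (z := z) ha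
      (fun u hu => norm_sinKer_le_of_mem_Icc z hu) (fun x hx => norm_picard_zero_le 0 1 z hx)
      ⟨ht.1.le, ht.2⟩
    simp only [norm_zero, norm_one, one_mul, zero_add] at h2
    have h3 : -(z.im * t) ≤ |r| * a := by
      refine le_trans ?_ hta
      nlinarith [neg_abs_le z.im, ht.1]
    refine mul_le_mul (Real.exp_le_exp.2 h3) (mul_le_mul_of_nonneg_left (h2.trans ?_)
      (norm_nonneg _)) (by positivity) (by positivity)
    gcongr

end CauchySol

section JostIdentification

variable {q : ℝ → ℂ} {a : ℝ}

/-- In the closed upper half-plane, `∫ₐˣ e^{-2izt} dt` does not converge as `x → ∞`. -/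
theorem eq_zero_of_tendsto_integral_exp {z c l : ℂ} {a : ℝ} (hz : 0 ≤ z.im)
    (h : Tendsto (fun x : ℝ => c * ∫ t in a..x, Complex.exp (-(2 * Complex.I * z) * t)) atTop
      (𝓝 l)) : c = 0 := by
  by_contra hc
  set e : ℝ → ℂ := fun t => Complex.exp (-(2 * Complex.I * z) * t) with he
  have hec : Continuous e := continuous_exp_mul_ofReal _
  set J : ℝ → ℂ := fun x => ∫ t in a..x, e t with hJ
  have hJt : Tendsto J atTop (𝓝 (c⁻¹ * l)) := by
    have := h.const_mul c⁻¹
    simpa only [inv_mul_cancel_left₀ hc] using this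
  have hzero : ∀ b : ℝ, 0 ≤ b → ∫ t in (0 : ℝ)..b, e t = 0 := by
    intro b _
    have h1 : Tendsto (fun x => J (x + b) - J x) atTop (𝓝 0) := by
      have := (hJt.comp (tendsto_atTop_add_const_right atTop b tendsto_id)).sub hJt
      simpa using this
    have h2 : ∀ x : ℝ, J (x + b) - J x = e x * ∫ t in (0 : ℝ)..b, e t := by
      intro x
      rw [hJ]
      simp only
      rw [intervalIntegral.integral_interval_sub_left (hec.intervalIntegrable _ _)
        (hec.intervalIntegrable _ _), ← intervalIntegral.integral_const_mul]
      have h3 : ∫ t in x..(x + b), e t = ∫ t in (0 : ℝ)..b, e (x + t) := by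
        rw [intervalIntegral.integral_comp_add_left]; simp
      rw [h3]
      refine intervalIntegral.integral_congr fun t _ => ?_
      simp only [he]
      rw [← Complex.exp_add]
      congr 1; push_cast; ring
    have h4 : ∀ᶠ x in atTop, ‖∫ t in (0 : ℝ)..b, e t‖ ≤ ‖J (x + b) - J x‖ := by
      filter_upwards [eventually_ge_atTop 0] with x hx
      rw [h2, norm_mul]
      refine le_mul_of_one_le_left (norm_nonneg _) ?_
      have : 0 ≤ z.im * x := mul_nonneg hz hx
      rw [he]
      simp only
      rw [Complex.norm_exp]
      simp only [Real.one_le_exp_iff]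
      simp
      linarith
    have h5 := ge_of_tendsto h1.norm h4
    rw [norm_zero] at h5
    exact norm_le_zero_iff.1 h5
  have hd : HasDerivWithinAt (fun b => ∫ t in (0 : ℝ)..b, e t) (e 0) (Ici 0) 0 :=
    (intervalIntegral.integral_hasDerivAt_right (hec.intervalIntegrable _ _)
      (hec.stronglyMeasurableAtFilter _ _) hec.continuousAt).hasDerivWithinAt
  have hd0 : HasDerivWithinAt (fun b => ∫ t in (0 : ℝ)..b, e t) 0 (Ici 0) 0 :=
    (hasDerivWithinAt_const (0 : ℝ) (Ici (0 : ℝ)) (0 : ℂ)).congr (fun b hb => hzero b hb)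
      (hzero 0 le_rfl)
  have := (uniqueDiffWithinAt_Ici (0 : ℝ)).eq_deriv _ hd hd0
  simp [he] at this

theorem exp_mul_exp_neg (c : ℂ) : Complex.exp c * Complex.exp (-c) = 1 := by
  rw [← Complex.exp_add]; simp

/-- The Jost solution takes the value `jostIntegral q a z` at the origin. -/
theorem IsSolutionPair.apply_zero_eq_jostIntegral (hq : Integrable q) (ha : 0 ≤ a)
    (hqa : ∀ t, a < t → q t = 0) {z : ℂ} (hz : 0 ≤ z.im) {y v : ℝ → ℂ}
    (H : IsSolutionPair q z y v)
    (hy : Tendsto (fun x : ℝ => y x / Complex.exp (Complex.I * z * x)) atTop (𝓝 1)) :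
    y 0 = jostIntegral q a z := by
  set c := Complex.exp (Complex.I * z * a) * (v a - Complex.I * z * y a) with hc
  set k := Complex.exp (-(Complex.I * z) * a) * y a with hk
  have h1 : ∀ᶠ x : ℝ in atTop, y x / Complex.exp (Complex.I * z * x) =
      k + c * ∫ t in a..x, Complex.exp (-(2 * Complex.I * z) * t) := by
    filter_upwards [eventually_ge_atTop a] with x hx
    rw [← H.exp_neg_mul_of_le hq ha hqa hx, neg_mul, Complex.exp_neg, div_eq_inv_mul]
  have h2 := (hy.congr' h1).sub_const k
  simp only [add_sub_cancel_left] at h2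
  have hc0 : c = 0 := eq_zero_of_tendsto_integral_exp hz h2
  have hk1 : k = 1 := by
    rw [hc0] at h2
    simp only [zero_mul] at h2
    have := tendsto_nhds_unique h2 tendsto_const_nhds
    exact (sub_eq_zero.1 this).symm
  have hva : v a = Complex.I * z * y a := by
    rw [hc, mul_eq_zero, or_iff_right (Complex.exp_ne_zero _)] at hc0
    exact sub_eq_zero.1 hc0
  have hya : y a = Complex.exp (Complex.I * z * a) := by
    have h3 := exp_mul_exp_neg (Complex.I * z * a)
    rw [hk, neg_mul] at hk1
    linear_combination (-(y a)) * h3 + Complex.exp (Complex.I * z * a) * hk1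
  have hφ := isSolutionPair_cauchySol hq 0 1 z
  have hw := hφ.wronskian H hq hq ha
  simp only [sub_self, zero_mul, intervalIntegral.integral_zero, add_zero,
    cauchySol_zero hq, cauchySolDeriv_zero, one_mul, zero_sub] at hw
  rw [jostIntegral_eq hq ha, ← hya]
  rw [hva] at hw
  linear_combination hw

/-- Existence of the Jost solution in the closed upper half-plane. -/
theorem exists_isJostSolution (hq : Integrable q) (ha : 0 ≤ a) (hqa : ∀ t, a < t → q t = 0)
    (z : ℂ) : ∃ y, IsJostSolution q z y ∧ y 0 = jostIntegral q a z := by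
  have hφ := isSolutionPair_cauchySol hq 0 1 z
  have hθ := isSolutionPair_cauchySol hq 1 0 z
  set φ := cauchySol q 0 1 z
  set φ' := cauchySolDeriv q 0 1 z
  set θ := cauchySol q 1 0 z
  set θ' := cauchySolDeriv q 1 0 z
  have hw := hθ.wronskian hφ hq hq ha
  simp only [sub_self, zero_mul, intervalIntegral.integral_zero, add_zero] at hw
  have h0 : θ 0 * φ' 0 - θ' 0 * φ 0 = 1 := by
    simp [θ, φ, θ', φ', cauchySol_zero hq]
  rw [h0] at hw
  set e := Complex.exp (Complex.I * z * a) with he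
  -- coefficients for which the combination and its derivative match `e^{izx}` at `x = a`
  set α := e * (φ' a - Complex.I * z * φ a) with hα
  set β := e * (Complex.I * z * θ a - θ' a) with hβ
  have H := hθ.linear_combination hφ hq α β
  set y : ℝ → ℂ := fun x => α * θ x + β * φ x with hy
  set v : ℝ → ℂ := fun x => α * θ' x + β * φ' x with hv
  have hya : y a = e := by
    simp only [hy, hα, hβ]
    linear_combination e * hw
  have hva : v a = Complex.I * z * e := by
    simp only [hv, hα, hβ]
    linear_combination Complex.I * z * e * hw
  refine ⟨y, ⟨⟨v, H⟩, ?_⟩, ?_⟩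
  · refine (tendsto_congr' ?_).2 tendsto_const_nhds
    filter_upwards [eventually_ge_atTop a] with x hx
    have h1 := H.exp_neg_mul_of_le hq ha hqa hx
    rw [hya, hva, sub_self, mul_zero, zero_mul, add_zero] at h1
    rw [div_eq_inv_mul, ← Complex.exp_neg, ← neg_mul, h1, he, neg_mul, mul_comm, exp_mul_exp_neg]
  · rw [jostIntegral_eq hq ha]
    simp [hy, hα, θ, φ, φ', cauchySol_zero hq, he]

theorem isJostFunction_jostIntegral (hq : Integrable q) (ha : 0 ≤ a)
    (hqa : ∀ t, a < t → q t = 0) : IsJostFunction q (jostIntegral q a) :=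
  ⟨differentiable_jostIntegral hq ha, fun z _ => exists_isJostSolution hq ha hqa z⟩

theorem IsSchrodingerSolution.congr_potential {q₁ q₂ : ℝ → ℂ} (h : q₁ =ᵐ[halfLine] q₂) {z : ℂ}
    {y : ℝ → ℂ} (H : IsSchrodingerSolution q₁ z y) : IsSchrodingerSolution q₂ z y := by
  obtain ⟨v, hv⟩ := H
  exact ⟨v, IsSolutionPair.congr h hv⟩

theorem IsJostFunction.congr_potential {q₁ q₂ : ℝ → ℂ} (h : q₁ =ᵐ[halfLine] q₂) {ψ : ℂ → ℂ}
    (H : IsJostFunction q₁ ψ) : IsJostFunction q₂ ψ := by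
  refine ⟨H.1, fun z hz => ?_⟩
  obtain ⟨y, hy, h0⟩ := H.2 z hz
  exact ⟨y, ⟨hy.1.congr_potential h, hy.2⟩, h0⟩

theorem IsJostFunction.eq_jostIntegral (hq : Integrable q) (ha : 0 ≤ a)
    (hqa : ∀ t, a < t → q t = 0) {ψ : ℂ → ℂ} (h : IsJostFunction q ψ) :
    ψ = jostIntegral q a := by
  have h1 : AnalyticOnNhd ℂ ψ univ := h.1.differentiableOn.analyticOnNhd isOpen_univ
  have h2 : AnalyticOnNhd ℂ (jostIntegral q a) univ :=
    (differentiable_jostIntegral hq ha).differentiableOn.analyticOnNhd isOpen_univ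
  have hev : ψ =ᶠ[𝓝 Complex.I] jostIntegral q a := by
    have : {z : ℂ | 0 < z.im} ∈ 𝓝 Complex.I :=
      (isOpen_lt continuous_const Complex.continuous_im).mem_nhds (by simp)
    filter_upwards [this] with z hz
    obtain ⟨y, ⟨⟨v, hv⟩, hy⟩, h0⟩ := h.2 z (le_of_lt hz)
    rw [← h0]
    exact IsSolutionPair.apply_zero_eq_jostIntegral hq ha hqa (le_of_lt hz) hv hy
  exact h1.eq_of_eventuallyEq h2 hev

/-- The Jost function selected by `Classical.epsilon` is the explicit entire function
`jostIntegral` of any everywhere integrable representative of the potential. -/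
theorem jostFunction_eq_jostIntegral {p : ℝ → ℂ} (hq : Integrable q) (ha : 0 ≤ a)
    (hqa : ∀ t, a < t → q t = 0) (hpq : p =ᵐ[halfLine] q) :
    jostFunction p = jostIntegral q a := by
  have hex : ∃ ψ, IsJostFunction p ψ :=
    ⟨_, (isJostFunction_jostIntegral hq ha hqa).congr_potential hpq.symm⟩
  have h1 : IsJostFunction p (jostFunction p) := Classical.epsilon_spec hex
  exact (h1.congr_potential hpq).eq_jostIntegral hq ha hqa

/-- The Wronskian identity that expresses the difference of two potentials, tested against the
product of the regular solutions, through the two Jost functions. -/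
theorem integral_sub_mul_cauchySol_mul_cauchySol {q₁ q₂ : ℝ → ℂ} (hq₁ : Integrable q₁)
    (hq₂ : Integrable q₂) (ha : 0 ≤ a) (z : ℂ) :
    ∫ t in (0 : ℝ)..a, (q₂ t - q₁ t) *
        ((z * cauchySol q₁ 0 1 z t) * (z * cauchySol q₂ 0 1 z t)) =
      z * (jostIntegral q₁ a (-z) * jostIntegral q₂ a z -
        jostIntegral q₁ a z * jostIntegral q₂ a (-z)) / (2 * Complex.I) := by
  have hw := (isSolutionPair_cauchySol hq₁ 0 1 z).wronskian (isSolutionPair_cauchySol hq₂ 0 1 z)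
    hq₁ hq₂ ha
  simp only [cauchySol_zero hq₁, cauchySol_zero hq₂, zero_mul, mul_zero, sub_zero, zero_add] at hw
  have h1 : ∫ t in (0 : ℝ)..a, (q₂ t - q₁ t) *
        ((z * cauchySol q₁ 0 1 z t) * (z * cauchySol q₂ 0 1 z t)) =
      z ^ 2 * ∫ t in (0 : ℝ)..a, (q₂ t - q₁ t) *
        (cauchySol q₁ 0 1 z t * cauchySol q₂ 0 1 z t) := by
    rw [← intervalIntegral.integral_const_mul]
    refine intervalIntegral.integral_congr fun t _ => ?_
    ring
  rw [h1, ← hw, jostIntegral_neg_eq hq₁ ha, jostIntegral_neg_eq hq₂ ha, jostIntegral_eq hq₁ ha z,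
    jostIntegral_eq hq₂ ha z]
  have h3 := exp_mul_exp_neg (Complex.I * z * a)
  generalize Complex.exp (Complex.I * z * a) = e₁ at *
  generalize Complex.exp (-(Complex.I * z * a)) = e₂ at *
  field_simp
  linear_combination (-(2 * z ^ 2 * Complex.I * (cauchySol q₁ 0 1 z a * cauchySolDeriv q₂ 0 1 z a -
    cauchySolDeriv q₁ 0 1 z a * cauchySol q₂ 0 1 z a))) * h3

end JostIdentification

/-! ### Bounds for the Jost function -/

section Bounds

variable {q : ℝ → ℂ} {a Q : ℝ}

theorem norm_jostIntegral_sub_one_le_integral (hq : Integrable q) (ha : 0 ≤ a) {z : ℂ} {M : ℝ}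
    (hM : ∀ t ∈ Ioc 0 a, ‖Complex.exp (Complex.I * z * t)‖ * ‖cauchySol q 0 1 z t‖ ≤ M)
    (hQ : ∫ t, ‖q t‖ ≤ Q) (hM0 : 0 ≤ M) : ‖jostIntegral q a z - 1‖ ≤ M * Q := by
  rw [jostIntegral, add_sub_cancel_left]
  calc _ ≤ ∫ t in (0 : ℝ)..a, M * ‖q t‖ := by
        refine intervalIntegral.norm_integral_le_of_norm_le ha (Eventually.of_forall ?_)
          (hq.norm.const_mul M).intervalIntegrable
        intro t ht
        rw [norm_mul, norm_mul, mul_left_comm, mul_comm M]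
        exact mul_le_mul_of_nonneg_left (hM t ht) (norm_nonneg _)
    _ ≤ M * ∫ t, ‖q t‖ := by
        rw [intervalIntegral.integral_const_mul, intervalIntegral.integral_of_le ha]
        exact mul_le_mul_of_nonneg_left (setIntegral_le_integral hq.norm
          (Eventually.of_forall fun t => norm_nonneg _)) hM0
    _ ≤ M * Q := mul_le_mul_of_nonneg_left hQ hM0

theorem intervalIntegral_norm_le (hq : Integrable q) (hQ : ∫ t, ‖q t‖ ≤ Q) {x : ℝ} (hx : 0 ≤ x) :
    ∫ t in (0 : ℝ)..x, ‖q t‖ ≤ Q := by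
  rw [intervalIntegral.integral_of_le hx]
  exact (setIntegral_le_integral hq.norm (Eventually.of_forall fun t => norm_nonneg _)).trans hQ

theorem norm_cauchySol_le_exp (hq : Integrable q) (hQ : ∫ t, ‖q t‖ ≤ Q) (z : ℂ) {x : ℝ}
    (hx : x ∈ Icc 0 a) :
    ‖cauchySol q 0 1 z x‖ ≤ a * Real.exp (a * Q) * Real.exp (|z.im| * x) := by
  have ha : 0 ≤ a := hx.1.trans hx.2
  have h2 := norm_cauchySol_le hq (C := 0) (S := 1) (z := z) ha
      (fun u hu => norm_sinKer_le_of_mem_Icc z hu) (fun x hx => norm_picard_zero_le 0 1 z hx) hx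
  simp only [norm_zero, norm_one, one_mul, zero_add] at h2
  refine h2.trans ?_
  rw [mul_right_comm]
  have := intervalIntegral_norm_le hq hQ hx.1
  gcongr

theorem norm_mul_cauchySol_le_exp (hq : Integrable q) (hQ : ∫ t, ‖q t‖ ≤ Q) {z : ℂ}
    (hz : 1 ≤ ‖z‖) {x : ℝ} (hx : x ∈ Icc 0 a) :
    ‖z‖ * ‖cauchySol q 0 1 z x‖ ≤ Real.exp Q * Real.exp (|z.im| * x) := by
  have hz0 : 0 < ‖z‖ := by linarith
  have hb : ∀ u ∈ Icc 0 a, ‖sinKer z u‖ ≤ ‖z‖⁻¹ * Real.exp (|z.im| * u) := fun u hu => by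
    have := norm_mul_sinKer_le z hu.1
    rw [inv_mul_eq_div, le_div_iff₀ hz0, mul_comm]; exact this
  have h2 := norm_cauchySol_le hq (C := 0) (S := 1) (z := z) (by positivity) hb
    (M := ‖z‖⁻¹) (fun x hx => by simpa [picard] using hb x hx) hx
  have h3 := intervalIntegral_norm_le hq hQ hx.1
  have h4 : 0 ≤ ∫ t in (0 : ℝ)..x, ‖q t‖ :=
    intervalIntegral.integral_nonneg hx.1 fun _ _ => norm_nonneg _
  have h5 : ‖z‖⁻¹ * ∫ t in (0 : ℝ)..x, ‖q t‖ ≤ Q := by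
    refine le_trans ?_ h3
    exact mul_le_of_le_one_left h4 (inv_le_one_of_one_le₀ hz)
  calc ‖z‖ * ‖cauchySol q 0 1 z x‖ ≤ ‖z‖ * (‖z‖⁻¹ * Real.exp (|z.im| * x) * Real.exp Q) := by
        gcongr
        exact h2.trans (by gcongr)
    _ = _ := by field_simp

/-- Exponential type of the Jost function. -/
theorem norm_jostIntegral_le (hq : Integrable q) (ha : 0 ≤ a) (hQ : ∫ t, ‖q t‖ ≤ Q) (z : ℂ) :
    ‖jostIntegral q a z‖ ≤ (1 + a * Real.exp (a * Q) * Q) * Real.exp (2 * a * |z.im|) := by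
  have hQ0 : 0 ≤ Q := (integral_nonneg fun _ => norm_nonneg _).trans hQ
  have h := norm_jostIntegral_sub_one_le_integral hq ha (z := z)
    (M := a * Real.exp (a * Q) * Real.exp (2 * a * |z.im|)) (fun t ht => ?_) hQ (by positivity)
  · have h1 : (1 : ℝ) ≤ Real.exp (2 * a * |z.im|) := Real.one_le_exp (by positivity)
    have h2 : ‖jostIntegral q a z‖ ≤ ‖jostIntegral q a z - 1‖ + 1 := by
      simpa using norm_add_le (jostIntegral q a z - 1) 1
    nlinarith
  · have h1 := norm_cauchySol_le_exp hq hQ z (x := t) ⟨ht.1.le, ht.2⟩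
    rw [norm_exp_I_mul_ofReal]
    calc _ ≤ Real.exp (|z.im| * a) * (a * Real.exp (a * Q) * Real.exp (|z.im| * a)) := by
          refine mul_le_mul (Real.exp_le_exp.2 ?_) (h1.trans ?_) (norm_nonneg _) (by positivity)
          · nlinarith [neg_abs_le z.im, abs_nonneg z.im, ht.1, ht.2]
          · gcongr; exact ht.2
      _ = _ := by
          rw [mul_left_comm, ← Real.exp_add]; ring_nf

/-- The Jost function tends to `1` at infinity in the closed upper half-plane. -/
theorem norm_jostIntegral_sub_one_le (hq : Integrable q) (ha : 0 ≤ a) (hQ : ∫ t, ‖q t‖ ≤ Q) {z : ℂ}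
    (hz : 0 ≤ z.im) (hz1 : 1 ≤ ‖z‖) : ‖jostIntegral q a z - 1‖ ≤ Real.exp Q * Q / ‖z‖ := by
  have hz0 : 0 < ‖z‖ := by linarith
  have h := norm_jostIntegral_sub_one_le_integral hq ha (z := z) (M := Real.exp Q / ‖z‖)
    (fun t ht => ?_) hQ (by positivity)
  · rwa [div_mul_eq_mul_div] at h
  · have h1 := norm_mul_cauchySol_le_exp hq hQ hz1 (x := t) ⟨ht.1.le, ht.2⟩
    rw [norm_exp_I_mul_ofReal, le_div_iff₀ hz0, mul_assoc, mul_comm _ ‖z‖]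
    refine (mul_le_mul_of_nonneg_left h1 (Real.exp_nonneg _)).trans ?_
    rw [mul_left_comm, ← Real.exp_add, abs_of_nonneg hz]
    simp

end Bounds

/-! ### Dividing out the zeros of an entire function -/

section Zeros

variable {ι : Type*}

theorem analyticOrderAt_sub_const (c w : ℂ) :
    analyticOrderAt (fun z : ℂ => z - c) w = if c = w then 1 else 0 := by
  split_ifs with h
  · subst h
    have hc : AnalyticAt ℂ (fun z : ℂ => z - c) c := by fun_prop
    have := (hc.analyticOrderAt_eq_natCast (n := 1)).2
      ⟨fun _ => 1, analyticAt_const, one_ne_zero, by simp⟩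
    exact_mod_cast this
  · rw [AnalyticAt.analyticOrderAt_eq_zero (by fun_prop)]
    exact sub_ne_zero.2 (Ne.symm h)

theorem analyticOrderAt_prod_sub (ζ : ι → ℂ) (s : Finset ι) (w : ℂ) :
    analyticOrderAt (fun z => ∏ i ∈ s, (z - ζ i)) w = ((s.filter fun i => ζ i = w).card : ℕ∞) := by
  classical
  induction s using Finset.induction_on with
  | empty =>
    simp only [Finset.prod_empty, Finset.filter_empty, Finset.card_empty, Nat.cast_zero]
    rw [AnalyticAt.analyticOrderAt_eq_zero analyticAt_const]
    exact one_ne_zero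
  | insert i s his ih =>
    have h1 : (fun z => ∏ j ∈ insert i s, (z - ζ j)) =
        (fun z => z - ζ i) * fun z => ∏ j ∈ s, (z - ζ j) := by
      ext z; simp [Finset.prod_insert his]
    have h2 : AnalyticAt ℂ (fun z => ∏ j ∈ s, (z - ζ j)) w :=
      Finset.analyticAt_fun_prod s fun j _ => by fun_prop
    rw [h1, analyticOrderAt_mul (by fun_prop) h2, ih, analyticOrderAt_sub_const,
      Finset.filter_insert]
    split_ifs with h
    · rw [Finset.card_insert_of_notMem (by simp [his])]
      push_cast; rw [add_comm]
    · simp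

theorem exists_eq_prod_sub_mul {f : ℂ → ℂ} (hf : Differentiable ℂ f) (ζ : ι → ℂ) (s : Finset ι)
    (h : ∀ w, ((s.filter fun i => ζ i = w).card : ℕ∞) ≤ analyticOrderAt f w) :
    ∃ g : ℂ → ℂ, Differentiable ℂ g ∧ ∀ z, f z = (∏ i ∈ s, (z - ζ i)) * g z := by
  classical
  induction s using Finset.induction_on with
  | empty => exact ⟨f, hf, by simp⟩
  | insert i s his ih =>
    obtain ⟨g, hg, hfg⟩ := ih fun w => le_trans (by
      exact_mod_cast Finset.card_le_card (Finset.filter_subset_filter _ (Finset.subset_insert _ _)))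
      (h w)
    have hgi : g (ζ i) = 0 := by
      have ha : AnalyticAt ℂ g (ζ i) := hg.analyticAt _
      have h2 : AnalyticAt ℂ (fun z => ∏ j ∈ s, (z - ζ j)) (ζ i) :=
        Finset.analyticAt_fun_prod s fun j _ => by fun_prop
      by_contra hne
      have h0 := ha.analyticOrderAt_eq_zero.2 hne
      have h3 := h (ζ i)
      have h4 : f = (fun z => ∏ j ∈ s, (z - ζ j)) * g := funext hfg
      rw [h4, analyticOrderAt_mul h2 ha, h0, analyticOrderAt_prod_sub, add_zero,
        Finset.filter_insert, if_pos rfl, Finset.card_insert_of_notMem (by simp [his])] at h3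
      have h5 : (s.filter fun j => ζ j = ζ i).card + 1 ≤ (s.filter fun j => ζ j = ζ i).card := by
        exact_mod_cast h3
      omega
    refine ⟨dslope g (ζ i), ?_, fun z => ?_⟩
    · rw [← differentiableOn_univ]
      exact (Complex.differentiableOn_dslope univ_mem).2 hg.differentiableOn
    · have := sub_smul_dslope g (ζ i) z
      rw [hgi, sub_zero, smul_eq_mul] at this
      rw [hfg, Finset.prod_insert his, ← this]; ring

/-- An entire function is the product of the polynomial with the listed zeros and an entire
function without zeros in the disc that the list exhausts. -/
theorem exists_eq_prod_sub_mul_ne_zero [Fintype ι] {f : ℂ → ℂ} (hf : Differentiable ℂ f)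
    (ζ : ι → ℂ) {R : ℝ} (hR : ∀ i, ‖ζ i‖ ≤ R)
    (h : ∀ w, ‖w‖ ≤ R → (Nat.card {i // ζ i = w} : ℕ∞) = analyticOrderAt f w) :
    ∃ g : ℂ → ℂ, Differentiable ℂ g ∧ (∀ z, f z = (∏ i, (z - ζ i)) * g z) ∧
      ∀ w, ‖w‖ ≤ R → g w ≠ 0 := by
  classical
  have hcard : ∀ w, Nat.card {i // ζ i = w} = (Finset.univ.filter fun i => ζ i = w).card := by
    intro w
    rw [Nat.card_eq_fintype_card, Fintype.card_subtype]
  obtain ⟨g, hg, hfg⟩ := exists_eq_prod_sub_mul hf ζ Finset.univ fun w => by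
    rcases le_or_gt ‖w‖ R with hw | hw
    · rw [← h w hw, hcard]
    · have : (Finset.univ.filter fun i => ζ i = w) = ∅ := by
        rw [Finset.filter_eq_empty_iff]
        rintro i - rfl
        exact absurd (hR i) (not_le.2 hw)
      simp [this]
  refine ⟨g, hg, hfg, fun w hw hgw => ?_⟩
  have ha : AnalyticAt ℂ g w := hg.analyticAt _
  have h2 : AnalyticAt ℂ (fun z => ∏ j, (z - ζ j)) w :=
    Finset.analyticAt_fun_prod _ fun j _ => by fun_prop
  have h3 := h w hw
  have h4 : f = (fun z => ∏ j, (z - ζ j)) * g := funext hfg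
  rw [h4, analyticOrderAt_mul h2 ha, analyticOrderAt_prod_sub, hcard] at h3
  have h5 : analyticOrderAt g w = 0 := by
    have h6 : ((Finset.univ.filter fun i => ζ i = w).card : ℕ∞) + 0 =
        ((Finset.univ.filter fun i => ζ i = w).card : ℕ∞) + analyticOrderAt g w := by
      rw [add_zero]; exact h3
    exact (ENat.add_right_injective_of_ne_top (ENat.natCast_ne_top _) h6).symm
  exact ha.analyticOrderAt_eq_zero.1 h5 hgw

theorem norm_prod_sub_prod_le (s : Finset ι) {u v : ι → ℂ} {M η : ℝ} (hM : 1 ≤ M)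
    (hη : 0 ≤ η) (hu : ∀ i ∈ s, ‖u i‖ ≤ M) (hv : ∀ i ∈ s, ‖v i‖ ≤ M)
    (h : ∀ i ∈ s, ‖u i - v i‖ ≤ η) :
    ‖∏ i ∈ s, u i - ∏ i ∈ s, v i‖ ≤ s.card * M ^ s.card * η := by
  classical
  induction s using Finset.induction_on with
  | empty => simp
  | insert i s his ih =>
    have ih' := ih (fun j hj => hu j (Finset.mem_insert_of_mem hj))
      (fun j hj => hv j (Finset.mem_insert_of_mem hj))
      (fun j hj => h j (Finset.mem_insert_of_mem hj))
    rw [Finset.prod_insert his, Finset.prod_insert his, Finset.card_insert_of_notMem his]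
    have e : u i * ∏ j ∈ s, u j - v i * ∏ j ∈ s, v j =
        u i * (∏ j ∈ s, u j - ∏ j ∈ s, v j) + (u i - v i) * ∏ j ∈ s, v j := by ring
    have hpv : ‖∏ j ∈ s, v j‖ ≤ M ^ s.card := by
      rw [norm_prod]
      exact (Finset.prod_le_prod (fun _ _ => norm_nonneg _)
        (fun j hj => hv j (Finset.mem_insert_of_mem hj))).trans (by simp)
    have hM0 : 0 ≤ M := by linarith
    calc _ ≤ ‖u i‖ * ‖∏ j ∈ s, u j - ∏ j ∈ s, v j‖ + ‖u i - v i‖ * ‖∏ j ∈ s, v j‖ := by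
          rw [e, ← norm_mul, ← norm_mul]; exact norm_add_le _ _
      _ ≤ M * (s.card * M ^ s.card * η) + η * M ^ s.card := by
          gcongr
          · exact hu i (Finset.mem_insert_self _ _)
          · exact h i (Finset.mem_insert_self _ _)
      _ ≤ M * (s.card * M ^ s.card * η) + η * (M ^ s.card * M) := by
          gcongr
          exact le_mul_of_one_le_right (by positivity) hM
      _ = _ := by push_cast; ring

end Zeros

/-! ### Logarithms of zero-free functions -/

section Logarithm

theorem exists_log_on_ball {g : ℂ → ℂ} (hg : Differentiable ℂ g) {R : ℝ} {z₀ : ℂ}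
    (hz₀ : z₀ ∈ Metric.ball (0 : ℂ) R) (h0 : ∀ z ∈ Metric.ball (0 : ℂ) R, g z ≠ 0) :
    ∃ H : ℂ → ℂ, DifferentiableOn ℂ H (Metric.ball 0 R) ∧ H z₀ = 0 ∧
      ∀ z ∈ Metric.ball (0 : ℂ) R, g z = g z₀ * Complex.exp (H z) := by
  have hd : DifferentiableOn ℂ (fun z => deriv g z / g z) (Metric.ball 0 R) := by
    have h1 : Differentiable ℂ (deriv g) := by
      have := (hg.differentiableOn (s := univ)).deriv isOpen_univ
      exact differentiableOn_univ.1 this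
    exact h1.differentiableOn.div hg.differentiableOn h0
  obtain ⟨H, hH0, hH⟩ := hd.isExactOn_ball.with_val_at z₀ 0
  refine ⟨H, fun z hz => (hH z hz).differentiableAt.differentiableWithinAt, hH0, fun z hz => ?_⟩
  have hderiv : ∀ w ∈ Metric.ball (0 : ℂ) R,
      HasDerivAt (fun w => g w * Complex.exp (-H w)) 0 w := by
    intro w hw
    have h1 := (hg w).hasDerivAt.mul (hH w hw).neg.cexp
    convert! h1 using 1
    have := h0 w hw
    field_simp
    ring
  have hconst := Metric.isOpen_ball.is_const_of_deriv_eq_zero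
    (convex_ball (0 : ℂ) R).isPreconnected
    (fun w hw => (hderiv w hw).differentiableAt.differentiableWithinAt)
    (fun w hw => (hderiv w hw).deriv) hz hz₀
  simp only [hH0, neg_zero, Complex.exp_zero, mul_one] at hconst
  rw [← hconst, mul_assoc, ← Complex.exp_add]
  simp

theorem borelCaratheodory_centered {H : ℂ → ℂ} {R M : ℝ} {z₀ : ℂ} (hM : 0 < M) (hR : 0 < R)
    (hH : DifferentiableOn ℂ H (Metric.ball 0 R)) (hz₀ : ‖z₀‖ ≤ R / 4) (h0 : H z₀ = 0)
    (hre : ∀ z ∈ Metric.ball (0 : ℂ) R, (H z).re ≤ M) {z : ℂ} (hz : ‖z‖ ≤ R / 4) :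
    ‖H z‖ ≤ 4 * M := by
  have hsub : ∀ w ∈ Metric.ball (0 : ℂ) (3 * R / 4), z₀ + w ∈ Metric.ball (0 : ℂ) R := by
    intro w hw
    rw [mem_ball_zero_iff] at hw ⊢
    exact (norm_add_le _ _).trans_lt (by linarith)
  have hw : ‖z - z₀‖ ≤ R / 2 := (norm_sub_le _ _).trans (by linarith)
  have h := Complex.borelCaratheodory_zero (f := fun w => H (z₀ + w)) (R := 3 * R / 4) (M := M)
    (z := z - z₀) hM (hH.comp (by fun_prop) hsub) (fun w hw => hre _ (hsub w hw)) (by linarith)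
    (by rw [mem_ball_zero_iff]; linarith) (by simpa using h0)
  simp only [add_sub_cancel] at h
  refine h.trans ?_
  rw [div_le_iff₀ (by linarith)]
  nlinarith

/-- Quadratic Taylor approximation of a bounded holomorphic function on a disc. -/
theorem exists_quadratic_approx {h : ℂ → ℂ} {ρ B : ℝ} (hρ : 0 < ρ)
    (hd : DifferentiableOn ℂ h (Metric.ball 0 ρ)) (hB : ∀ z ∈ Metric.ball (0 : ℂ) ρ, ‖h z‖ ≤ B) :
    ∃ c₀ c₁ c₂ : ℂ, ∀ z ∈ Metric.ball (0 : ℂ) ρ,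
      ‖h z - (c₀ + c₁ * z + c₂ * z ^ 2)‖ ≤ 8 * B * (‖z‖ / ρ) ^ 3 := by
  have step : ∀ (f : ℂ → ℂ) (M : ℝ), DifferentiableOn ℂ f (Metric.ball 0 ρ) →
      (∀ z ∈ Metric.ball (0 : ℂ) ρ, ‖f z‖ ≤ M) →
      DifferentiableOn ℂ (dslope f 0) (Metric.ball 0 ρ) ∧
      (∀ z ∈ Metric.ball (0 : ℂ) ρ, ‖dslope f 0 z‖ ≤ 2 * M / ρ) ∧
      ∀ z, f z = f 0 + z * dslope f 0 z := by
    intro f M hf hM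
    refine ⟨(Complex.differentiableOn_dslope (Metric.ball_mem_nhds _ hρ)).2 hf, fun z hz => ?_,
      fun z => ?_⟩
    · refine Complex.norm_dslope_le_div_of_mapsTo_ball hf (fun w hw => ?_) hz
      rw [Metric.mem_closedBall, dist_eq_norm]
      have := hM w hw
      have := hM 0 (by simpa using hρ)
      exact (norm_sub_le _ _).trans (by linarith)
    · have := sub_smul_dslope f 0 z
      rw [sub_zero, smul_eq_mul] at this
      rw [this]; ring
  obtain ⟨d1, b1, e1⟩ := step h B hd hB
  obtain ⟨d2, b2, e2⟩ := step _ _ d1 b1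
  obtain ⟨d3, b3, e3⟩ := step _ _ d2 b2
  set h1 := dslope h 0
  set h2 := dslope h1 0
  refine ⟨h 0, h1 0, h2 0, fun z hz => ?_⟩
  have e : h z - (h 0 + h1 0 * z + h2 0 * z ^ 2) = z ^ 3 * dslope h2 0 z := by
    rw [e1 z, e2 z, e3 z]; ring
  rw [e, norm_mul, norm_pow]
  calc _ ≤ ‖z‖ ^ 3 * (2 * (2 * (2 * B / ρ) / ρ) / ρ) := by
        gcongr; exact b3 z hz
    _ = _ := by field_simp; ring

/-- A continuous logarithm that vanishes at one end of an interval stays on the principal branch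
as long as its exponential is close to `1`. -/
theorem norm_le_two_mul_of_norm_exp_sub_one_le {f : ℝ → ℂ} {s t η : ℝ} (hst : s ≤ t)
    (hf : ContinuousOn f (Icc s t)) (h0 : f s = 0) (hη : η < 1 / 4)
    (h : ∀ y ∈ Icc s t, ‖Complex.exp (f y) - 1‖ ≤ η) : ‖f t‖ ≤ 2 * η := by
  have hlow : ∀ y ∈ Icc s t, ‖f y‖ ≤ 1 / 2 → ‖f y‖ ≤ 2 * η := by
    intro y hy hle
    have h1 := Complex.norm_exp_sub_one_sub_id_le (x := f y) (by linarith)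
    have h2 := h y hy
    have h3 : ‖f y‖ ≤ ‖Complex.exp (f y) - 1‖ + ‖Complex.exp (f y) - 1 - f y‖ := by
      have e : f y = (Complex.exp (f y) - 1) - (Complex.exp (f y) - 1 - f y) := by ring
      calc ‖f y‖ = ‖(Complex.exp (f y) - 1) - (Complex.exp (f y) - 1 - f y)‖ := by rw [← e]
        _ ≤ _ := norm_sub_le _ _
    nlinarith [norm_nonneg (f y)]
  refine hlow t (right_mem_Icc.2 hst) ?_
  by_contra hgt
  push Not at hgt
  obtain ⟨y, hy, hyv⟩ := intermediate_value_Icc hst hf.norm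
    (show (1 / 2 : ℝ) ∈ Icc ‖f s‖ ‖f t‖ by rw [h0]; constructor <;> simp; linarith)
  have := hlow y hy (by simpa using hyv.le)
  simp only at hyv
  linarith

theorem norm_exp_sub_exp_le {u v : ℂ} (hu : ‖u‖ ≤ 1 / 2) (hv : ‖v‖ ≤ 1 / 2) :
    ‖Complex.exp u - Complex.exp v‖ ≤ 4 * ‖u - v‖ := by
  have h1 : ‖u - v‖ ≤ 1 := (norm_sub_le _ _).trans (by linarith)
  have e : Complex.exp u - Complex.exp v = Complex.exp v * (Complex.exp (u - v) - 1) := by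
    rw [mul_sub, ← Complex.exp_add]; simp
  have h2 : ‖Complex.exp v‖ ≤ 2 := by
    rw [Complex.norm_exp]
    have h3 : v.re ≤ 1 / 2 := (Complex.re_le_norm v).trans hv
    calc Real.exp v.re ≤ Real.exp (Real.log 2) := by
          apply Real.exp_le_exp.2
          linarith [Real.log_two_gt_d9]
      _ = 2 := Real.exp_log (by norm_num)
  rw [e, norm_mul]
  have h3 := Complex.norm_exp_sub_one_le h1
  nlinarith [norm_nonneg (Complex.exp (u - v) - 1), norm_nonneg (u - v)]

end Logarithm

/-! ### Two Jost functions with nearly the same zeros in a large disc -/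

/-- The growth properties shared by the Jost functions of all potentials with a given support and
a given bound on the norm. -/
structure HasJostGrowth (K b : ℝ) (ψ : ℂ → ℂ) : Prop where
  differentiable : Differentiable ℂ ψ
  norm_le : ∀ z, ‖ψ z‖ ≤ K * Real.exp (b * |z.im|)
  norm_sub_one_le : ∀ z, 0 ≤ z.im → 1 ≤ ‖z‖ → ‖ψ z - 1‖ ≤ K / ‖z‖

namespace HasJostGrowth

variable {K b : ℝ} {ψ : ℂ → ℂ}

theorem norm_ofReal_le (h : HasJostGrowth K b ψ) (x : ℝ) : ‖ψ x‖ ≤ K := by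
  simpa using h.norm_le x

theorem norm_sub_one_le_div (h : HasJostGrowth K b ψ) (hK : 1 ≤ K) {s y : ℝ} (hs : 1 ≤ s)
    (hy : s ≤ y) : ‖ψ (Complex.I * y) - 1‖ ≤ K / s := by
  have hy0 : 0 ≤ y := by linarith
  have hn : ‖Complex.I * (y : ℂ)‖ = y := by simp [abs_of_nonneg hy0]
  have := h.norm_sub_one_le (Complex.I * y) (by simpa using hy0) (by rw [hn]; linarith)
  rw [hn] at this
  exact this.trans (by gcongr)

/-- Zeros stay away from the imaginary half-axis beyond `2 K + 2`. -/
theorem one_le_norm_sub (h : HasJostGrowth K b ψ) (hK : 1 ≤ K) {y : ℝ} (hy : 2 * K + 2 ≤ y)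
    {w : ℂ} (hw : ψ w = 0) : 1 ≤ ‖Complex.I * y - w‖ := by
  by_contra hlt
  push Not at hlt
  have h1 : |(Complex.I * y - w).im| < 1 := (Complex.abs_im_le_norm _).trans_lt hlt
  simp only [Complex.sub_im, Complex.mul_im, Complex.I_re, Complex.ofReal_im, mul_zero,
    Complex.I_im, Complex.ofReal_re, one_mul, zero_add] at h1
  rw [abs_lt] at h1
  have h2 : 2 * K < w.im := by linarith
  have h3 : w.im ≤ ‖w‖ := (le_abs_self _).trans (Complex.abs_im_le_norm w)
  have h4 := h.norm_sub_one_le w (by linarith) (by linarith)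
  rw [hw] at h4
  simp only [zero_sub, norm_neg, norm_one] at h4
  rw [le_div_iff₀ (by linarith)] at h4
  linarith

theorem half_le_norm (h : HasJostGrowth K b ψ) (hK : 1 ≤ K) {s : ℝ} (hs : 2 * K + 2 ≤ s) :
    1 / 2 ≤ ‖ψ (Complex.I * s)‖ := by
  have h1 := h.norm_sub_one_le_div hK (show (1 : ℝ) ≤ s by linarith) le_rfl
  have h2 : K / s ≤ 1 / 2 := by rw [div_le_iff₀ (by linarith)]; linarith
  have h3 : ‖(1 : ℂ)‖ ≤ ‖ψ (Complex.I * s)‖ + ‖ψ (Complex.I * s) - 1‖ := by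
    have e : (1 : ℂ) = ψ (Complex.I * s) - (ψ (Complex.I * s) - 1) := by ring
    calc ‖(1 : ℂ)‖ = ‖ψ (Complex.I * s) - (ψ (Complex.I * s) - 1)‖ := by rw [← e]
      _ ≤ _ := norm_sub_le _ _
  rw [norm_one] at h3
  linarith

/-- Local factorization of a Jost function: after division by the polynomial with the zeros in
the disc `|z| ≤ R`, the logarithm, normalized at `i s`, is `O(R)` in the disc `|z| ≤ R / 4`, and
the number of zeros is bounded in terms of `R`. -/
theorem exists_log_bound (h : HasJostGrowth K b ψ) (hK : 1 ≤ K) (hb : 0 ≤ b) {R s : ℝ}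
    (hs : 2 * K + 2 ≤ s) (hsR : s ≤ R / 4) {ι : Type*} [Fintype ι] (ζ : ι → ℂ)
    (hζ : ∀ i, ‖ζ i‖ ≤ R)
    (hcard : ∀ w, ‖w‖ ≤ R → (Nat.card {i // ζ i = w} : ℕ∞) = analyticOrderAt ψ w) :
    (∀ i (y : ℝ), s ≤ y → 1 ≤ ‖Complex.I * y - ζ i‖) ∧
    (2 : ℝ) ^ Fintype.card ι ≤ Real.exp (Real.log (2 * K) + 5 * b * R) ∧
    ∃ H : ℂ → ℂ, DifferentiableOn ℂ H (Metric.ball 0 R) ∧ H (Complex.I * s) = 0 ∧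
      (∀ z ∈ Metric.ball (0 : ℂ) R, ψ z * ∏ i, (Complex.I * s - ζ i) =
        (∏ i, (z - ζ i)) * ψ (Complex.I * s) * Complex.exp (H z)) ∧
      ∀ z : ℂ, ‖z‖ ≤ R / 4 → ‖H z‖ ≤ 4 * (Real.log (2 * K) + 5 * b * R) := by
  obtain ⟨g, hg, hfg, hg0⟩ := exists_eq_prod_sub_mul_ne_zero h.differentiable ζ hζ hcard
  set z₀ : ℂ := Complex.I * s with hz₀
  set M := Real.log (2 * K) + 5 * b * R with hM
  have hs0 : 0 ≤ s := by linarith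
  have hR : 0 < R := by linarith
  have hM0 : 0 < M := add_pos_of_pos_of_nonneg (Real.log_pos (by linarith)) (by positivity)
  have hexpM : Real.exp M = 2 * K * Real.exp (5 * b * R) := by
    rw [hM, Real.exp_add, Real.exp_log (by linarith)]
  have hz₀n : ‖z₀‖ = s := by simp [hz₀, abs_of_nonneg hs0]
  have hdist : ∀ i (y : ℝ), s ≤ y → 1 ≤ ‖Complex.I * y - ζ i‖ := by
    intro i y hy
    refine h.one_le_norm_sub hK (hs.trans hy) ?_
    rw [hfg, Finset.prod_eq_zero (Finset.mem_univ i) (sub_self _), zero_mul]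
  have hP0 : 0 < ∏ i, ‖z₀ - ζ i‖ := Finset.prod_pos fun i _ => by
    linarith [hdist i s le_rfl]
  have hgz0 : 0 < ‖g z₀‖ := norm_pos_iff.2 (hg0 z₀ (by rw [hz₀n]; linarith))
  have hhalf := h.half_le_norm hK hs
  -- on `|z| = 5 R` every factor `|z - ζ|` is at least twice the factor `|z₀ - ζ|`
  have hmax : ∀ z : ℂ, ‖z‖ ≤ 5 * R → 2 ^ Fintype.card ι * ‖g z‖ ≤ Real.exp M * ‖g z₀‖ := by
    intro z hz
    have hcl : z ∈ closure (Metric.ball (0 : ℂ) (5 * R)) := by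
      rw [closure_ball _ (by positivity)]; simpa using hz
    have key := Complex.norm_le_of_forall_mem_frontier_norm_le (f := g)
      (C := Real.exp M * ‖g z₀‖ / 2 ^ Fintype.card ι) (Metric.isBounded_ball (x := (0 : ℂ)))
      hg.diffContOnCl (fun w hw => ?_) hcl
    · rw [le_div_iff₀ (by positivity)] at key
      linarith
    · rw [frontier_ball _ (by positivity), mem_sphere_zero_iff_norm] at hw
      rw [le_div_iff₀ (by positivity)]
      have h1 : 2 ^ Fintype.card ι * ∏ i, ‖z₀ - ζ i‖ ≤ ∏ i, ‖w - ζ i‖ := by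
        have : ∏ i : ι, (2 * ‖z₀ - ζ i‖) = 2 ^ Fintype.card ι * ∏ i, ‖z₀ - ζ i‖ := by
          rw [Finset.prod_mul_distrib, Finset.prod_const, Finset.card_univ]
        rw [← this]
        refine Finset.prod_le_prod (fun _ _ => by positivity) fun i _ => ?_
        have h2 : ‖w‖ - ‖ζ i‖ ≤ ‖w - ζ i‖ := norm_sub_norm_le _ _
        have h3 : ‖z₀ - ζ i‖ ≤ ‖z₀‖ + ‖ζ i‖ := norm_sub_le _ _
        have := hζ i
        rw [hz₀n] at h3
        linarith
      have h4 : ‖ψ w‖ = (∏ i, ‖w - ζ i‖) * ‖g w‖ := by rw [hfg, norm_mul, norm_prod]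
      have h5 : ‖ψ z₀‖ = (∏ i, ‖z₀ - ζ i‖) * ‖g z₀‖ := by rw [hfg, norm_mul, norm_prod]
      have h6 : ‖ψ w‖ ≤ K * Real.exp (5 * b * R) := by
        refine (h.norm_le w).trans ?_
        have : |w.im| ≤ 5 * R := (Complex.abs_im_le_norm w).trans hw.le
        have : b * |w.im| ≤ 5 * b * R := by nlinarith
        gcongr
      refine le_of_mul_le_mul_left ?_ hP0
      calc (∏ i, ‖z₀ - ζ i‖) * (‖g w‖ * 2 ^ Fintype.card ι)
          = (2 ^ Fintype.card ι * ∏ i, ‖z₀ - ζ i‖) * ‖g w‖ := by ring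
        _ ≤ ‖ψ w‖ := by rw [h4]; gcongr
        _ ≤ K * Real.exp (5 * b * R) := h6
        _ ≤ K * Real.exp (5 * b * R) * (2 * ‖ψ z₀‖) :=
            le_mul_of_one_le_right (by positivity) (by linarith)
        _ = _ := by rw [h5, hexpM]; ring
  refine ⟨hdist, ?_, ?_⟩
  · have := hmax z₀ (by rw [hz₀n]; linarith)
    exact le_of_mul_le_mul_right this hgz0
  · have hz₀b : z₀ ∈ Metric.ball (0 : ℂ) R := by rw [mem_ball_zero_iff, hz₀n]; linarith
    obtain ⟨H, hHd, hH0, hH⟩ := exists_log_on_ball hg hz₀b fun z hz =>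
      hg0 z (mem_ball_zero_iff.1 hz).le
    refine ⟨H, hHd, hH0, fun z hz => ?_, fun z hz => ?_⟩
    · rw [hfg z, hfg z₀, hH z hz]; ring
    · refine borelCaratheodory_centered hM0 hR hHd (by rw [hz₀n]; exact hsR) hH0
        (fun w hw => ?_) hz
      have h1 := hmax w (by linarith [mem_ball_zero_iff.1 hw])
      rw [hH w hw, norm_mul, Complex.norm_exp] at h1
      have h2 : (1 : ℝ) ≤ 2 ^ Fintype.card ι := one_le_pow₀ (by norm_num)
      have h3 : ‖g z₀‖ * Real.exp (H w).re ≤ ‖g z₀‖ * Real.exp M := by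
        nlinarith [mul_nonneg hgz0.le (Real.exp_nonneg (H w).re)]
      exact Real.exp_le_exp.1 (le_of_mul_le_mul_left h3 hgz0)

end HasJostGrowth

theorem norm_mul_sub_one_le {u v : ℂ} {x y : ℝ} (hu : ‖u - 1‖ ≤ x) (hv : ‖v - 1‖ ≤ y) :
    ‖u * v - 1‖ ≤ x + y + x * y := by
  have e : u * v - 1 = (u - 1) * (v - 1) + (u - 1) + (v - 1) := by ring
  have h0 : 0 ≤ x := (norm_nonneg _).trans hu
  calc _ ≤ ‖(u - 1) * (v - 1)‖ + ‖u - 1‖ + ‖v - 1‖ := by rw [e]; exact norm_add₃_le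
    _ ≤ x * y + x + y := by rw [norm_mul]; gcongr
    _ = _ := by ring

/-- A quotient of five factors close to `1` is close to `1`. -/
theorem norm_sub_one_le_of_mul_eq {T A B C D E : ℂ} {x : ℝ} (hx : x ≤ 1 / 20)
    (hA : ‖A - 1‖ ≤ x) (hB : ‖B - 1‖ ≤ x) (hC : ‖C - 1‖ ≤ x) (hD : ‖D - 1‖ ≤ x)
    (hE : ‖E - 1‖ ≤ x) (h : T * (A * B * C) = D * E) : ‖T - 1‖ ≤ 20 * x := by
  have h0 : 0 ≤ x := (norm_nonneg _).trans hA
  have hU : ‖A * B * C - 1‖ ≤ 4 * x :=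
    (norm_mul_sub_one_le (norm_mul_sub_one_le hA hB) hC).trans (by nlinarith)
  have hV : ‖D * E - 1‖ ≤ 3 * x := (norm_mul_sub_one_le hD hE).trans (by nlinarith)
  have e : (T - 1) = (D * E - 1) - (A * B * C - 1) - (T - 1) * (A * B * C - 1) := by
    rw [← h]; ring
  have h1 : ‖T - 1‖ ≤ 3 * x + 4 * x + ‖T - 1‖ * (4 * x) := by
    calc ‖T - 1‖ = ‖(D * E - 1) - (A * B * C - 1) - (T - 1) * (A * B * C - 1)‖ := by rw [← e]
      _ ≤ ‖D * E - 1‖ + ‖A * B * C - 1‖ + ‖T - 1‖ * ‖A * B * C - 1‖ := by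
          rw [← norm_mul]
          exact (norm_sub_le _ _).trans (add_le_add_left (norm_sub_le _ _) _)
      _ ≤ _ := by gcongr
  nlinarith [norm_nonneg (T - 1)]

/-- A holomorphic function that is `O(R)` on `|z| ≤ R / 4` and small at the three points `i s`,
`2 i s`, `3 i s`, where `s² = R`, is small on `|z| ≤ s`, and its odd part is `O(|z| / R)` there. -/
theorem odd_part_le_of_small_at_three_points {h : ℂ → ℂ} {R s K' e : ℝ} (hs : 0 < s)
    (hsR : s ^ 2 = R) (h12 : 12 * s < R) (hK' : 0 ≤ K')
    (hd : DifferentiableOn ℂ h (Metric.ball 0 (R / 4)))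
    (hB : ∀ z ∈ Metric.ball (0 : ℂ) (R / 4), ‖h z‖ ≤ 8 * (K' * R))
    (h1 : ‖h (Complex.I * s)‖ ≤ e / s) (h2 : ‖h (Complex.I * (2 * s : ℝ))‖ ≤ e / s)
    (h3 : ‖h (Complex.I * (3 * s : ℝ))‖ ≤ e / s) {z : ℂ} (hz : ‖z‖ ≤ s) :
    ‖h z‖ ≤ 18 * (e + 110592 * K') / s ∧
      ‖h z - h (-z)‖ ≤ 18 * (e + 110592 * K') * ‖z‖ / R := by
  have hR : 0 < R := by linarith
  obtain ⟨c₀, c₁, c₂, hT⟩ := exists_quadratic_approx (by positivity) hd hB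
  set p : ℂ → ℂ := fun z => c₀ + c₁ * z + c₂ * z ^ 2 with hp
  have hrem : ∀ w : ℂ, ‖w‖ ≤ 3 * s → ‖h w - p w‖ ≤ 4096 * K' * ‖w‖ ^ 3 / R ^ 2 := by
    intro w hw
    refine (hT w (by rw [mem_ball_zero_iff]; linarith)).trans (le_of_eq ?_)
    field_simp
    ring
  have hrem' : ∀ w : ℂ, ‖w‖ ≤ 3 * s → ‖h w - p w‖ ≤ 110592 * K' / s := by
    intro w hw
    refine (hrem w hw).trans ?_
    calc 4096 * K' * ‖w‖ ^ 3 / R ^ 2 ≤ 4096 * K' * (3 * s) ^ 3 / R ^ 2 := by gcongr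
      _ = _ := by rw [← hsR]; field_simp; ring
  set E := e + 110592 * K' with hE
  have hnode : ∀ w : ℂ, ‖w‖ ≤ 3 * s → ‖h w‖ ≤ e / s → ‖p w‖ ≤ E / s := by
    intro w hw hhw
    have e1 : p w = h w - (h w - p w) := by ring
    rw [e1]
    refine (norm_sub_le _ _).trans ((add_le_add hhw (hrem' w hw)).trans (le_of_eq ?_))
    rw [hE, add_div]
  have n1 : ‖p (Complex.I * s)‖ ≤ E / s := hnode _ (by simp [abs_of_pos hs]; linarith) h1
  have n2 : ‖p (Complex.I * (2 * s : ℝ))‖ ≤ E / s := hnode _ (by simp [abs_of_pos hs]; linarith) h2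
  have n3 : ‖p (Complex.I * (3 * s : ℝ))‖ ≤ E / s := hnode _ (by simp [abs_of_pos hs]) h3
  set p1 := p (Complex.I * s) with hp1
  set p2 := p (Complex.I * (2 * s : ℝ)) with hp2
  set p3 := p (Complex.I * (3 * s : ℝ)) with hp3
  have hcomb : ∀ α β γ : ℂ, ‖α * p1 + β * p2 + γ * p3‖ ≤ (‖α‖ + ‖β‖ + ‖γ‖) * (E / s) := by
    intro α β γ
    calc _ ≤ ‖α‖ * ‖p1‖ + ‖β‖ * ‖p2‖ + ‖γ‖ * ‖p3‖ := by
          rw [← norm_mul, ← norm_mul, ← norm_mul]; exact norm_add₃_le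
      _ ≤ ‖α‖ * (E / s) + ‖β‖ * (E / s) + ‖γ‖ * (E / s) := by gcongr
      _ = _ := by ring
  -- Lagrange interpolation at the three nodes
  have b0 : ‖c₀‖ ≤ 7 * (E / s) := by
    have e0 : c₀ = 3 * p1 + (-3) * p2 + 1 * p3 := by
      simp only [hp1, hp2, hp3, hp]; push_cast; ring
    rw [e0]
    refine (hcomb 3 (-3) 1).trans (le_of_eq ?_)
    norm_num
  have b1 : ‖c₁‖ * s ≤ 8 * (E / s) := by
    have e1 : Complex.I * c₁ * s = (-5 / 2) * p1 + 4 * p2 + (-3 / 2) * p3 := by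
      simp only [hp1, hp2, hp3, hp]; push_cast; ring
    have : ‖c₁‖ * s = ‖Complex.I * c₁ * s‖ := by simp [abs_of_pos hs]
    rw [this, e1]
    refine (hcomb _ _ _).trans (le_of_eq ?_)
    norm_num
  have b2 : ‖c₂‖ * s ^ 2 ≤ 2 * (E / s) := by
    have e2 : -c₂ * s ^ 2 = (1 / 2) * p1 + (-1) * p2 + (1 / 2) * p3 := by
      simp only [hp1, hp2, hp3, hp, mul_pow, Complex.I_sq]; push_cast; ring
    have : ‖c₂‖ * s ^ 2 = ‖-c₂ * s ^ 2‖ := by simp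
    rw [this, e2]
    refine (hcomb _ _ _).trans (le_of_eq ?_)
    norm_num
  have hz3 : ‖z‖ ≤ 3 * s := by linarith
  have hEs : 0 ≤ E / s := (norm_nonneg _).trans n1
  have hE0 : 0 ≤ E := by
    have := mul_nonneg hEs hs.le
    rwa [div_mul_cancel₀ _ hs.ne'] at this
  have he0 : 0 ≤ e := by
    have := mul_nonneg ((norm_nonneg _).trans h1) hs.le
    rwa [div_mul_cancel₀ _ hs.ne'] at this
  constructor
  · have e1 : h z = (h z - p z) + c₀ + c₁ * z + c₂ * z ^ 2 := by simp only [hp]; ring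
    have q1 : ‖c₁‖ * ‖z‖ ≤ 8 * (E / s) :=
      (mul_le_mul_of_nonneg_left hz (norm_nonneg _)).trans b1
    have q2 : ‖c₂‖ * ‖z‖ ^ 2 ≤ 2 * (E / s) :=
      (mul_le_mul_of_nonneg_left (pow_le_pow_left₀ (norm_nonneg _) hz 2) (norm_nonneg _)).trans b2
    have q3 := hrem' z hz3
    have q4 : 110592 * K' / s ≤ E / s := by gcongr; linarith
    have q5 : ‖h z‖ ≤ ‖h z - p z‖ + ‖c₀‖ + ‖c₁‖ * ‖z‖ + ‖c₂‖ * ‖z‖ ^ 2 := by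
      rw [← norm_pow, ← norm_mul, ← norm_mul]
      conv_lhs => rw [e1]
      exact (norm_add_le _ _).trans (add_le_add_left norm_add₃_le _)
    rw [mul_div_assoc]
    linarith
  · have e1 : h z - h (-z) = (h z - p z) - (h (-z) - p (-z)) + 2 * (c₁ * z) := by
      simp only [hp]; ring
    have q1 : ‖c₁‖ * ‖z‖ ≤ 8 * E * ‖z‖ / R := by
      have : ‖c₁‖ ≤ 8 * E / R := by
        rw [le_div_iff₀ hR, ← hsR]
        calc ‖c₁‖ * s ^ 2 = (‖c₁‖ * s) * s := by ring
          _ ≤ 8 * (E / s) * s := by gcongr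
          _ = 8 * E := by field_simp
      calc ‖c₁‖ * ‖z‖ ≤ 8 * E / R * ‖z‖ := by gcongr
        _ = _ := by ring
    have q2 : ∀ w : ℂ, ‖w‖ = ‖z‖ → ‖h w - p w‖ ≤ 4096 * K' * ‖z‖ / R := by
      intro w hw
      refine (hrem w (by rw [hw]; exact hz3)).trans ?_
      rw [hw, div_le_div_iff₀ (by positivity) hR]
      have : ‖z‖ ^ 2 ≤ R := by rw [← hsR]; gcongr
      calc 4096 * K' * ‖z‖ ^ 3 * R = 4096 * K' * ‖z‖ * R * ‖z‖ ^ 2 := by ring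
        _ ≤ 4096 * K' * ‖z‖ * R * R := by gcongr
        _ = _ := by ring
    have q3 := q2 z rfl
    have q4 := q2 (-z) (norm_neg z)
    have q5 : ‖h z - h (-z)‖ ≤ ‖h z - p z‖ + ‖h (-z) - p (-z)‖ + 2 * (‖c₁‖ * ‖z‖) := by
      rw [e1]
      refine (norm_add_le _ _).trans (add_le_add (norm_sub_le _ _) (le_of_eq ?_))
      simp
    have q6 : 4096 * K' * ‖z‖ / R + 4096 * K' * ‖z‖ / R + 2 * (8 * E * ‖z‖ / R) =
        (8192 * K' + 16 * E) * ‖z‖ / R := by ring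
    have q7 : (8192 * K' + 16 * E) * ‖z‖ / R ≤ 18 * E * ‖z‖ / R := by
      gcongr; linarith
    linarith

theorem exists_pos_forall_mul_le {A₁ A₂ A₃ t : ℝ} (h1 : 0 ≤ A₁) (h2 : 0 ≤ A₂) (h3 : 0 ≤ A₃)
    (ht : 0 < t) : ∃ η, 0 < η ∧ A₁ * η ≤ t ∧ A₂ * η ≤ t ∧ A₃ * η ≤ t := by
  have hpos : 0 < A₁ + A₂ + A₃ + 1 := by positivity
  refine ⟨t / (A₁ + A₂ + A₃ + 1), by positivity, ?_, ?_, ?_⟩ <;>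
  · rw [mul_div_assoc', div_le_iff₀ hpos]
    nlinarith

set_option maxHeartbeats 1000000 in
/-- If two functions with the growth of Jost functions have zeros in `|z| ≤ R` that differ by at
most `η`, where `η` is small depending on `R`, then `ψ₁(-z) ψ₂(z) - ψ₁(z) ψ₂(-z)` is
`O((1 + |z|) / R)` for real `z` with `|z| ≤ √R`. -/
theorem exists_norm_cross_difference_le {K b : ℝ} (hK : 1 ≤ K) (hb : 0 ≤ b) :
    ∃ C R₀ : ℝ, 0 < C ∧ 1 ≤ R₀ ∧ ∀ R, R₀ < R → ∃ η, 0 < η ∧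
      ∀ (ψ₁ ψ₂ : ℂ → ℂ), HasJostGrowth K b ψ₁ → HasJostGrowth K b ψ₂ →
      ∀ (ι : Type) [Fintype ι] (ζ₁ ζ₂ : ι → ℂ), (∀ i, ‖ζ₁ i‖ ≤ R) → (∀ i, ‖ζ₂ i‖ ≤ R) →
        (∀ w, ‖w‖ ≤ R → (Nat.card {i // ζ₁ i = w} : ℕ∞) = analyticOrderAt ψ₁ w) →
        (∀ w, ‖w‖ ≤ R → (Nat.card {i // ζ₂ i = w} : ℕ∞) = analyticOrderAt ψ₂ w) →
        (∀ i, ‖ζ₂ i - ζ₁ i‖ ≤ η) →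
        ∀ x : ℝ, |x| ≤ √R →
          ‖ψ₁ (-x) * ψ₂ x - ψ₁ x * ψ₂ (-x)‖ ≤ C * (1 + |x|) / R := by
  set K' := 2 * K + 5 * b with hK'
  have hK'0 : 0 < K' := by positivity
  set E := 40 * K + 110592 * K' with hE
  have hE0 : 0 < E := by positivity
  set S := 100 * K + 36 * E + 13 with hS
  refine ⟨1 + 12 * K ^ 2 * (4 * (18 * E)), S ^ 2, by positivity, ?_, fun R hR => ?_⟩
  · nlinarith
  have hS0 : 0 < S := by positivity
  have hS1 : 1 ≤ S := by rw [hS]; linarith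
  have hRpos : 0 < R := lt_trans (by positivity) hR
  set s := √R with hs
  have hsR : s ^ 2 = R := Real.sq_sqrt hRpos.le
  have hSs : S < s := Real.lt_sqrt_of_sq_lt hR
  have hs0 : 0 < s := hS0.trans hSs
  have hs1 : 1 ≤ s := by linarith
  have h12 : 12 * s < R := by nlinarith
  have hsleR : s ≤ R := by nlinarith
  have hR1 : 1 ≤ R := by linarith
  set M := Real.log (2 * K) + 5 * b * R with hM
  have hMle : M ≤ K' * R := by
    have h1 : Real.log (2 * K) ≤ 2 * K := (Real.log_le_sub_one_of_pos (by positivity)).trans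
      (by linarith)
    have h2 : 2 * K ≤ 2 * K * R := le_mul_of_one_le_right (by positivity) hR1
    rw [hM, hK', add_mul]
    linarith
  -- `n₀` bounds the number of zeros in the disc; it depends on `R`, and so does `η`
  set n₀ := ⌈Real.exp M⌉₊ with hn₀
  obtain ⟨η, hη, hη1, hη2, hη3⟩ := exists_pos_forall_mul_le
    (A₁ := 8 * K * Real.exp (4 * M) * (n₀ * (2 * R) ^ n₀)) (A₂ := n₀ * 2 ^ n₀ * (2 * R))
    (A₃ := 2 * R) (t := 1 / R) (by positivity) (by positivity) (by positivity) (by positivity)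
  refine ⟨η, hη, fun ψ₁ ψ₂ hψ₁ hψ₂ ι _ ζ₁ ζ₂ hζ₁ hζ₂ hc₁ hc₂ hclose x hx => ?_⟩
  have h2K : 2 * K + 2 ≤ s := by linarith
  obtain ⟨hd₁, hN, H₁, hH₁d, hH₁0, hH₁, hH₁b⟩ :=
    hψ₁.exists_log_bound hK hb h2K (by linarith) ζ₁ hζ₁ hc₁
  obtain ⟨hd₂, -, H₂, hH₂d, hH₂0, hH₂, hH₂b⟩ :=
    hψ₂.exists_log_bound hK hb h2K (by linarith) ζ₂ hζ₂ hc₂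
  set N := Fintype.card ι with hNdef
  have hNn : N ≤ n₀ := by
    have h1 : (N : ℝ) ≤ 2 ^ N := by exact_mod_cast Nat.lt_two_pow_self.le
    exact_mod_cast (h1.trans hN).trans (Nat.le_ceil _)
  have hNpow : ∀ B : ℝ, 1 ≤ B → (N : ℝ) * B ^ N ≤ n₀ * B ^ n₀ := fun B hB => by
    gcongr
  have hRinv : 1 / R ≤ 1 / s := by gcongr
  have hRinv1 : 1 / R ≤ 1 := by rw [div_le_one hRpos]; exact hR1
  set z₀ : ℂ := Complex.I * s with hz₀
  set P₁ : ℂ → ℂ := fun z => ∏ i, (z - ζ₁ i) with hP₁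
  set P₂ : ℂ → ℂ := fun z => ∏ i, (z - ζ₂ i) with hP₂
  have hne₁ : ∀ i (y : ℝ), s ≤ y → Complex.I * y - ζ₁ i ≠ 0 := fun i y hy h => by
    have := hd₁ i y hy; rw [h, norm_zero] at this; linarith
  have hne₂ : ∀ i (y : ℝ), s ≤ y → Complex.I * y - ζ₂ i ≠ 0 := fun i y hy h => by
    have := hd₂ i y hy; rw [h, norm_zero] at this; linarith
  have hP₁ne : ∀ y : ℝ, s ≤ y → P₁ (Complex.I * y) ≠ 0 := fun y hy =>
    Finset.prod_ne_zero_iff.2 fun i _ => hne₁ i y hy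
  have hP₂ne : ∀ y : ℝ, s ≤ y → P₂ (Complex.I * y) ≠ 0 := fun y hy =>
    Finset.prod_ne_zero_iff.2 fun i _ => hne₂ i y hy
  -- comparison of the two polynomials, relative in the upper half-plane and absolute in the disc
  have hprod : ∀ (u : ι → ℂ) (t : ℝ), (∀ i, ‖u i - 1‖ ≤ t * η) → t ≤ 2 * R → 0 ≤ t →
      ‖∏ i, u i - 1‖ ≤ 1 / R := by
    intro u t hu ht ht0
    have ht1 : t * η ≤ 1 :=
      (mul_le_mul_of_nonneg_right ht hη.le).trans (hη3.trans hRinv1)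
    have hu2 : ∀ i, ‖u i‖ ≤ 2 := fun i => by
      have : ‖u i‖ ≤ ‖u i - 1‖ + 1 := by simpa using norm_add_le (u i - 1) 1
      linarith [hu i]
    have h1 := norm_prod_sub_prod_le Finset.univ (u := u) (v := fun _ => 1) (M := 2)
      (η := t * η) one_le_two (by positivity) (fun i _ => hu2 i) (fun _ _ => by simp)
      (fun i _ => hu i)
    simp only [Finset.prod_const_one, Finset.card_univ] at h1
    calc _ ≤ N * 2 ^ N * (t * η) := h1
      _ ≤ n₀ * 2 ^ n₀ * (2 * R * η) := by
          gcongr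
          norm_num
      _ = n₀ * 2 ^ n₀ * (2 * R) * η := by ring
      _ ≤ 1 / R := hη2
  have hQ : ∀ y : ℝ, s ≤ y → y ≤ 3 * s → ‖P₂ (Complex.I * y) * P₁ z₀ /
      (P₁ (Complex.I * y) * P₂ z₀) - 1‖ ≤ 1 / R := by
    intro y hy hy3
    have e : P₂ (Complex.I * y) * P₁ z₀ / (P₁ (Complex.I * y) * P₂ z₀) =
        ∏ i, ((Complex.I * y - ζ₂ i) * (z₀ - ζ₁ i) /
          ((Complex.I * y - ζ₁ i) * (z₀ - ζ₂ i))) := by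
      simp only [hP₁, hP₂]
      rw [Finset.prod_div_distrib, Finset.prod_mul_distrib, Finset.prod_mul_distrib]
    rw [e]
    refine hprod _ (2 * s) (fun i => ?_) (by linarith) (by positivity)
    have n1 := hne₁ i y hy
    have n2 := hne₂ i s le_rfl
    have e2 : (Complex.I * y - ζ₂ i) * (z₀ - ζ₁ i) /
          ((Complex.I * y - ζ₁ i) * (z₀ - ζ₂ i)) - 1 =
        (Complex.I * y - z₀) * (ζ₂ i - ζ₁ i) / ((Complex.I * y - ζ₁ i) * (z₀ - ζ₂ i)) := by
      rw [div_sub_one (mul_ne_zero n1 n2)]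
      congr 1
      ring
    rw [e2, norm_div, norm_mul, norm_mul, div_le_iff₀ (by positivity)]
    have h1 : ‖Complex.I * (y : ℂ) - z₀‖ ≤ 2 * s := by
      rw [hz₀, ← mul_sub, ← Complex.ofReal_sub, norm_mul, Complex.norm_I, one_mul,
        Complex.norm_real, Real.norm_of_nonneg (by linarith)]
      linarith
    have h3 : (1 : ℝ) ≤ ‖Complex.I * (y : ℂ) - ζ₁ i‖ * ‖z₀ - ζ₂ i‖ :=
      one_le_mul_of_one_le_of_one_le (hd₁ i y hy) (hd₂ i s le_rfl)
    calc _ ≤ 2 * s * η := mul_le_mul h1 (hclose i) (norm_nonneg _) (by positivity)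
      _ ≤ _ := le_mul_of_one_le_right (by positivity) h3
  have hγ : ‖P₁ z₀ / P₂ z₀ - 1‖ ≤ 1 / R := by
    simp only [hP₁, hP₂]
    rw [← Finset.prod_div_distrib]
    refine hprod _ 1 (fun i => ?_) (by linarith) zero_le_one
    rw [div_sub_one (hne₂ i s le_rfl), norm_div, div_le_iff₀ (by linarith [hd₂ i s le_rfl]),
      one_mul, show Complex.I * (s : ℂ) - ζ₁ i - (Complex.I * s - ζ₂ i) = ζ₂ i - ζ₁ i by ring]
    exact (hclose i).trans (le_mul_of_one_le_right hη.le (hd₂ i s le_rfl))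
  have hΔ : ∀ z : ℂ, ‖z‖ ≤ R → ‖P₂ z - P₁ z‖ ≤ n₀ * (2 * R) ^ n₀ * η := by
    intro z hz
    have h1 := norm_prod_sub_prod_le Finset.univ (u := fun i => z - ζ₂ i)
      (v := fun i => z - ζ₁ i) (M := 2 * R) (η := η) (by linarith) hη.le
      (fun i _ => (norm_sub_le _ _).trans (by linarith [hζ₂ i]))
      (fun i _ => (norm_sub_le _ _).trans (by linarith [hζ₁ i]))
      (fun i _ => by
        rw [show z - ζ₂ i - (z - ζ₁ i) = -(ζ₂ i - ζ₁ i) by ring, norm_neg]; exact hclose i)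
    rw [Finset.card_univ] at h1
    refine h1.trans ?_
    exact mul_le_mul_of_nonneg_right (hNpow _ (by linarith)) hη.le
  -- the difference of the logarithms and its values on the imaginary axis
  set h : ℂ → ℂ := fun z => H₂ z - H₁ z with hh
  have hKs : K / s ≤ 1 / 100 := by rw [div_le_iff₀ hs0]; linarith
  have hmem : ∀ y : ℝ, s ≤ y → y ≤ 3 * s → Complex.I * (y : ℂ) ∈ Metric.ball (0 : ℂ) R := by
    intro y hy hy3
    rw [mem_ball_zero_iff, norm_mul, Complex.norm_I, one_mul, Complex.norm_real,
      Real.norm_of_nonneg (by linarith)]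
    linarith
  have hψ₂z₀ : ‖ψ₂ z₀ - 1‖ ≤ K / s := hψ₂.norm_sub_one_le_div hK hs1 le_rfl
  have hψ₁z₀ : ‖ψ₁ z₀ - 1‖ ≤ K / s := hψ₁.norm_sub_one_le_div hK hs1 le_rfl
  have hT : ∀ y : ℝ, s ≤ y → y ≤ 3 * s →
      ‖Complex.exp (h (Complex.I * y)) - 1‖ ≤ 20 * (K / s) := by
    intro y hy hy3
    have a1 := hψ₁.norm_sub_one_le_div hK hs1 hy
    have a2 := hψ₂.norm_sub_one_le_div hK hs1 hy
    have a3 : 1 / R ≤ K / s := hRinv.trans (by gcongr)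
    refine norm_sub_one_le_of_mul_eq (by linarith) a1 hψ₂z₀ ((hQ y hy hy3).trans a3) a2 hψ₁z₀ ?_
    have f1 := hH₁ _ (hmem y hy hy3)
    have f2 := hH₂ _ (hmem y hy hy3)
    have n1 := hP₁ne y hy
    have n2 := hP₂ne s le_rfl
    have n3 := hP₁ne s le_rfl
    change ψ₁ (Complex.I * y) * P₁ z₀ = P₁ (Complex.I * y) * ψ₁ z₀ *
      Complex.exp (H₁ (Complex.I * y)) at f1
    change ψ₂ (Complex.I * y) * P₂ z₀ = P₂ (Complex.I * y) * ψ₂ z₀ *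
      Complex.exp (H₂ (Complex.I * y)) at f2
    change P₂ z₀ ≠ 0 at n2
    have g1 : ψ₁ (Complex.I * y) * P₁ z₀ / P₁ (Complex.I * y) = ψ₁ z₀ *
      Complex.exp (H₁ (Complex.I * y)) := by rw [f1]; field_simp
    have g2 : ψ₂ (Complex.I * y) = P₂ (Complex.I * y) * ψ₂ z₀ *
      Complex.exp (H₂ (Complex.I * y)) / P₂ z₀ := by rw [← f2]; field_simp
    have g3 : Complex.exp (h (Complex.I * y)) * Complex.exp (H₁ (Complex.I * y)) =
      Complex.exp (H₂ (Complex.I * y)) := by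
      rw [← Complex.exp_add]; congr 1; simp [hh]
    calc _ = Complex.exp (h (Complex.I * y)) * (ψ₁ (Complex.I * y) * P₁ z₀ / P₁ (Complex.I * y)) *
          ψ₂ z₀ * (P₂ (Complex.I * y) / P₂ z₀) := by field_simp
      _ = (Complex.exp (h (Complex.I * y)) * Complex.exp (H₁ (Complex.I * y))) * ψ₁ z₀ *
          ψ₂ z₀ * (P₂ (Complex.I * y) / P₂ z₀) := by rw [g1]; ring
      _ = _ := by rw [g3, g2]; ring
  have hhd : DifferentiableOn ℂ h (Metric.ball 0 R) := hH₂d.sub hH₁d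
  have hh0 : h z₀ = 0 := by simp only [hh]; rw [hH₁0, hH₂0, sub_zero]
  -- `h` vanishes at `i s`, which fixes the branch of the logarithm along the imaginary axis
  have hnode : ∀ y : ℝ, s ≤ y → y ≤ 3 * s → ‖h (Complex.I * y)‖ ≤ 40 * K / s := by
    intro y hy hy3
    have := norm_le_two_mul_of_norm_exp_sub_one_le (f := fun y : ℝ => h (Complex.I * y)) hy
      (hhd.continuousOn.comp (by fun_prop) fun t ht => hmem t ht.1 (ht.2.trans hy3)) hh0
      (η := 20 * (K / s)) (by linarith) fun t ht => hT t ht.1 (ht.2.trans hy3)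
    refine this.trans (le_of_eq (by ring))
  have hhB : ∀ z : ℂ, ‖z‖ ≤ R / 4 → ‖h z‖ ≤ 8 * (K' * R) := fun z hz =>
    (norm_sub_le _ _).trans (by linarith [hH₁b z hz, hH₂b z hz])
  have hodd : ∀ z : ℂ, ‖z‖ ≤ s → ‖h z‖ ≤ 18 * E / s ∧ ‖h z - h (-z)‖ ≤ 18 * E * ‖z‖ / R :=
    fun z hz => odd_part_le_of_small_at_three_points hs0 hsR h12 hK'0.le
      (hhd.mono (Metric.ball_subset_ball (by linarith)))
      (fun w hw => hhB w (mem_ball_zero_iff.1 hw).le) (hnode s le_rfl (by linarith))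
      (hnode (2 * s) (by linarith) (by linarith)) (hnode (3 * s) (by linarith) le_rfl) hz
  have hsmall : ∀ z : ℂ, ‖z‖ ≤ s → ‖h z‖ ≤ 1 / 2 := fun z hz => by
    refine (hodd z hz).1.trans ?_
    rw [div_le_iff₀ hs0]; linarith
  -- both Jost functions in terms of the common polynomial
  have hxs : ‖(x : ℂ)‖ ≤ s := by simpa using hx
  have hxs' : ‖(-x : ℂ)‖ ≤ s := by simpa using hx
  set γ := P₁ z₀ / P₂ z₀ with hγdef
  have hrep : ∀ z : ℂ, ‖z‖ ≤ s → ψ₂ z = (ψ₂ z₀ / ψ₁ z₀ * γ) * (ψ₁ z * Complex.exp (h z)) +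
      ψ₂ z₀ / P₂ z₀ * ((P₂ z - P₁ z) * Complex.exp (H₂ z)) := by
    intro z hz
    have hzb : z ∈ Metric.ball (0 : ℂ) R := by rw [mem_ball_zero_iff]; linarith
    have f1 := hH₁ _ hzb
    have f2 := hH₂ _ hzb
    have n2 : P₂ z₀ ≠ 0 := hP₂ne s le_rfl
    have n4 : ψ₁ z₀ ≠ 0 := by
      have := hψ₁.half_le_norm hK h2K
      exact norm_pos_iff.1 (lt_of_lt_of_le (by norm_num) this)
    change ψ₁ z * P₁ z₀ = P₁ z * ψ₁ z₀ * Complex.exp (H₁ z) at f1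
    change ψ₂ z * P₂ z₀ = P₂ z * ψ₂ z₀ * Complex.exp (H₂ z) at f2
    have g3 : Complex.exp (H₁ z) * Complex.exp (h z) = Complex.exp (H₂ z) := by
      rw [← Complex.exp_add]; congr 1; simp [hh]
    apply mul_right_cancel₀ n2
    rw [f2]
    have e1 : (ψ₂ z₀ / ψ₁ z₀ * γ) * (ψ₁ z * Complex.exp (h z)) * P₂ z₀ =
        ψ₂ z₀ / ψ₁ z₀ * (ψ₁ z * P₁ z₀) * Complex.exp (h z) := by
      rw [hγdef]; field_simp
    rw [add_mul, e1, f1, ← g3]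
    field_simp
    ring
  have hρ1 : ‖ψ₂ z₀ / ψ₁ z₀ * γ‖ ≤ 12 := by
    have q1 : ‖ψ₂ z₀‖ ≤ 2 := by
      have : ‖ψ₂ z₀‖ ≤ ‖ψ₂ z₀ - 1‖ + 1 := by simpa using norm_add_le (ψ₂ z₀ - 1) 1
      linarith
    have q2 := hψ₁.half_le_norm hK h2K
    have q3 : ‖γ‖ ≤ 2 := by
      have : ‖γ‖ ≤ ‖γ - 1‖ + 1 := by simpa using norm_add_le (γ - 1) 1
      linarith
    rw [norm_mul, norm_div]
    have q4 : ‖ψ₂ z₀‖ / ‖ψ₁ z₀‖ ≤ 4 := by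
      rw [div_le_iff₀ (by linarith)]; linarith
    exact (mul_le_mul q4 q3 (norm_nonneg _) (by norm_num)).trans (by norm_num)
  have hρ2 : ‖ψ₂ z₀ / P₂ z₀‖ ≤ 2 := by
    have q1 : ‖ψ₂ z₀‖ ≤ 2 := by
      have : ‖ψ₂ z₀‖ ≤ ‖ψ₂ z₀ - 1‖ + 1 := by simpa using norm_add_le (ψ₂ z₀ - 1) 1
      linarith
    have q2 : 1 ≤ ‖P₂ z₀‖ := by
      simp only [hP₂]
      rw [norm_prod]
      have := Finset.prod_le_prod (s := (Finset.univ : Finset ι)) (f := fun _ => (1 : ℝ))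
        (g := fun i => ‖z₀ - ζ₂ i‖) (fun _ _ => zero_le_one) (fun i _ => hd₂ i s le_rfl)
      simpa using this
    rw [norm_div, div_le_iff₀ (by linarith)]; linarith
  have hB1 : ∀ y : ℝ, |y| ≤ s → ‖(P₂ y - P₁ y) * Complex.exp (H₂ y)‖ ≤
      n₀ * (2 * R) ^ n₀ * η * Real.exp (4 * M) := by
    intro y hy
    have hy' : ‖(y : ℂ)‖ ≤ s := by simpa using hy
    rw [norm_mul, Complex.norm_exp]
    have := (Complex.re_le_norm (H₂ y)).trans (hH₂b y (by linarith))
    gcongr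
    exact hΔ y (by linarith)
  -- the even parts of `h` cancel, and the error from the two polynomials is absorbed by `η`
  set Δ : ℂ → ℂ := fun z => (P₂ z - P₁ z) * Complex.exp (H₂ z) with hΔdef
  have e : ψ₁ (-x) * ψ₂ x - ψ₁ x * ψ₂ (-x) =
      (ψ₂ z₀ / ψ₁ z₀ * γ) * (ψ₁ x * ψ₁ (-x)) * (Complex.exp (h x) - Complex.exp (h (-x))) +
      ψ₂ z₀ / P₂ z₀ * (ψ₁ (-x) * Δ x - ψ₁ x * Δ (-x)) := by
    rw [hrep x hxs, hrep (-x) hxs']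
    simp only [hΔdef]
    ring
  have k1 : ‖ψ₁ x‖ ≤ K := hψ₁.norm_ofReal_le x
  have k2 : ‖ψ₁ (-x)‖ ≤ K := by simpa using hψ₁.norm_ofReal_le (-x)
  have k3 : ‖Complex.exp (h x) - Complex.exp (h (-x))‖ ≤ 4 * (18 * E * |x| / R) := by
    refine (norm_exp_sub_exp_le (hsmall _ hxs) (hsmall _ hxs')).trans ?_
    have := (hodd x hxs).2
    rw [Complex.norm_real, Real.norm_eq_abs] at this
    linarith
  have k4 : ‖Δ x‖ ≤ n₀ * (2 * R) ^ n₀ * η * Real.exp (4 * M) := hB1 x hx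
  have k5 : ‖Δ (-x)‖ ≤ n₀ * (2 * R) ^ n₀ * η * Real.exp (4 * M) := by
    have := hB1 (-x) (by simpa using hx)
    rwa [Complex.ofReal_neg] at this
  set W := (n₀ : ℝ) * (2 * R) ^ n₀ * η * Real.exp (4 * M) with hW
  have hW0 : 0 ≤ W := by positivity
  calc _ ≤ ‖ψ₂ z₀ / ψ₁ z₀ * γ‖ * (‖ψ₁ x‖ * ‖ψ₁ (-x)‖) *
        ‖Complex.exp (h x) - Complex.exp (h (-x))‖ +
        ‖ψ₂ z₀ / P₂ z₀‖ * (‖ψ₁ (-x)‖ * ‖Δ x‖ + ‖ψ₁ x‖ * ‖Δ (-x)‖) := by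
        rw [e]
        refine (norm_add_le _ _).trans (add_le_add (le_of_eq ?_) ?_)
        · rw [norm_mul, norm_mul, norm_mul (ψ₁ x)]
        · rw [norm_mul, ← norm_mul (ψ₁ (-x)), ← norm_mul (ψ₁ x)]
          gcongr
          exact norm_sub_le _ _
    _ ≤ 12 * (K * K) * (4 * (18 * E * |x| / R)) + 2 * (K * W + K * W) := by gcongr
    _ ≤ 12 * (K * K) * (4 * (18 * E * |x| / R)) + 1 / R := by
        gcongr
        refine le_trans ?_ hη1
        have e8 : 8 * K * Real.exp (4 * M) * (n₀ * (2 * R) ^ n₀) * η = 8 * (K * W) := by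
          rw [hW]; ring
        have : 0 ≤ K * W := by positivity
        linarith
    _ ≤ _ := by
        rw [← sub_nonneg]
        have : (1 + 12 * K ^ 2 * (4 * (18 * E))) * (1 + |x|) / R -
            (12 * (K * K) * (4 * (18 * E * |x| / R)) + 1 / R) =
            (|x| + 12 * K ^ 2 * (4 * (18 * E))) / R := by ring
        rw [this]; positivity

/-- The Jost functions of two potentials whose zeros are `ε`-close in `|z| ≤ R`. -/
theorem exists_norm_cross_difference_le_of_zerosClose {K b : ℝ} (hK : 1 ≤ K) (hb : 0 ≤ b) :
    ∃ C R₀ : ℝ, 0 < C ∧ 1 ≤ R₀ ∧ ∀ R, R₀ < R → ∃ ε₀, 0 < ε₀ ∧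
      ∀ ε ≤ ε₀, ∀ (ψ₁ ψ₂ : ℂ → ℂ), HasJostGrowth K b ψ₁ → HasJostGrowth K b ψ₂ →
        ZerosClose ψ₁ ψ₂ R ε → ∀ x : ℝ, |x| ≤ √R →
          ‖ψ₁ (-x) * ψ₂ x - ψ₁ x * ψ₂ (-x)‖ ≤ C * (1 + |x|) / R := by
  obtain ⟨C, R₀, hC, hR₀, H⟩ := exists_norm_cross_difference_le hK hb
  refine ⟨C, R₀, hC, hR₀, fun R hR => ?_⟩
  obtain ⟨η, hη, H⟩ := H R hR
  have hR0 : 0 < R := by linarith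
  refine ⟨η / R ^ 2, by positivity, fun ε hε ψ₁ ψ₂ hψ₁ hψ₂ hz => ?_⟩
  obtain ⟨h0, N, ζ₁, ζ₂, hl₁, hl₂, hclose⟩ := hz
  -- the order at the origin is finite, since the functions do not vanish identically
  have hfin : ∃ m : ℕ, analyticOrderAt ψ₁ 0 = m := by
    have hne : analyticOrderAt ψ₁ 0 ≠ ⊤ := by
      intro htop
      rw [analyticOrderAt_eq_top] at htop
      have ha : AnalyticOnNhd ℂ ψ₁ univ :=
        hψ₁.differentiable.differentiableOn.analyticOnNhd isOpen_univ
      have hz : AnalyticOnNhd ℂ (fun _ : ℂ => (0 : ℂ)) univ := fun _ _ => analyticAt_const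
      have := ha.eq_of_eventuallyEq hz htop
      have h1 := hψ₁.half_le_norm hK (s := 2 * K + 2) le_rfl
      rw [this] at h1
      simp at h1
      linarith
    exact ⟨_, (ENat.natCast_toNat_eq_self.2 hne).symm⟩
  obtain ⟨m, hm⟩ := hfin
  have hcount : ∀ (ψ : ℂ → ℂ) (ζ : Fin N → ℂ), analyticOrderAt ψ 0 = m →
      IsNonzeroZeroList ψ R ζ → (∀ i, ‖(Sum.elim (fun _ : Fin m => 0) ζ) i‖ ≤ R) ∧
      ∀ w, ‖w‖ ≤ R → (Nat.card {i // (Sum.elim (fun _ : Fin m => (0 : ℂ)) ζ) i = w} : ℕ∞) =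
        analyticOrderAt ψ w := by
    intro ψ ζ hψ hl
    refine ⟨?_, fun w hw => ?_⟩
    · rintro (i | i)
      · simpa using hR0.le
      · exact (hl.1 i).2
    · have e : Nat.card {i // (Sum.elim (fun _ : Fin m => (0 : ℂ)) ζ) i = w} =
          Nat.card {i : Fin m // (0 : ℂ) = w} + Nat.card {i // ζ i = w} := by
        rw [← Nat.card_sum]
        exact Nat.card_congr (Equiv.subtypeSum)
      rw [e]
      rcases eq_or_ne w 0 with rfl | hw0
      · have e2 : Nat.card {i // ζ i = 0} = 0 := by
          rw [Nat.card_eq_zero]; left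
          exact ⟨fun i => (hl.1 i.1).1 i.2⟩
        rw [e2, hψ]
        simp
      · have e2 : Nat.card {i : Fin m // (0 : ℂ) = w} = 0 := by
          rw [Nat.card_eq_zero]; left
          exact ⟨fun i => hw0 i.2.symm⟩
        rw [e2, zero_add, hl.2 w hw0 hw]
  obtain ⟨b1, c1⟩ := hcount ψ₁ ζ₁ hm hl₁
  obtain ⟨b2, c2⟩ := hcount ψ₂ ζ₂ (h0 ▸ hm) hl₂
  refine H ψ₁ ψ₂ hψ₁ hψ₂ (Fin m ⊕ Fin N) _ _ b1 b2 c1 c2 ?_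
  rintro (i | i)
  · simpa using hη.le
  · have n1 := (hl₁.1 i).1
    have n2 := (hl₂.1 i).1
    have e : ζ₂ i - ζ₁ i = -(ζ₁ i * ζ₂ i * (1 / ζ₂ i - 1 / ζ₁ i)) := by
      field_simp; ring
    simp only [Sum.elim_inr]
    rw [e, norm_neg, norm_mul, norm_mul]
    calc _ ≤ R * R * (η / R ^ 2) := by
          gcongr
          · exact (hl₁.1 i).2
          · exact (hl₂.1 i).2
          · exact (hclose i).le.trans hε
      _ = η := by field_simp

/-! ### Functions that are Fourier transforms of bounded kernels, in dual form -/

/-- The transform `τ ↦ ∫ m(z) e^{izτ} dz` of a test function on the real spectral axis. -/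
noncomputable def testTransform (m : ℝ → ℂ) (τ : ℝ) : ℂ :=
  ∫ z : ℝ, m z * Complex.exp (Complex.I * z * τ)

/-- Dual form of the statement that `F` is the Fourier transform of a kernel that is bounded by `C`
and supported in `[-x, x]`. -/
def FourierDominated (x C : ℝ) (F : ℝ → ℂ) : Prop :=
  ∀ m : ℝ → ℂ, Integrable m → ‖∫ z, m z * F z‖ ≤ C * ∫ τ in (-x)..x, ‖testTransform m τ‖

theorem norm_exp_I_mul_real (z τ : ℝ) : ‖Complex.exp (Complex.I * z * τ)‖ = 1 := by
  rw [Complex.norm_exp]; simp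

theorem integrable_mul_exp {m : ℝ → ℂ} (hm : Integrable m) (τ : ℝ) :
    Integrable fun z : ℝ => m z * Complex.exp (Complex.I * z * τ) :=
  hm.mul_bdd (c := 1) (by fun_prop) (Eventually.of_forall fun z => (norm_exp_I_mul_real z τ).le)

theorem continuous_testTransform {m : ℝ → ℂ} (hm : Integrable m) :
    Continuous (testTransform m) := by
  refine continuous_of_dominated (bound := fun z => ‖m z‖)
    (fun τ => (integrable_mul_exp hm τ).aestronglyMeasurable)
    (fun τ => Eventually.of_forall fun z => ?_) hm.norm (Eventually.of_forall fun z => ?_)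
  · rw [norm_mul, norm_exp_I_mul_real, mul_one]
  · fun_prop

theorem testTransform_mul_exp (m : ℝ → ℂ) (σ τ : ℝ) :
    testTransform (fun z : ℝ => m z * Complex.exp (Complex.I * z * σ)) τ =
      testTransform m (τ + σ) := by
  refine integral_congr_ae (Eventually.of_forall fun z => ?_)
  simp only
  rw [mul_assoc, ← Complex.exp_add]
  congr 2; push_cast; ring

theorem integral_norm_testTransform_mono {m : ℝ → ℂ} (hm : Integrable m) {a b c d : ℝ}
    (hca : c ≤ a) (hab : a ≤ b) (hbd : b ≤ d) :
    ∫ τ in a..b, ‖testTransform m τ‖ ≤ ∫ τ in c..d, ‖testTransform m τ‖ :=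
  intervalIntegral.integral_mono_interval hca hab hbd
    (Eventually.of_forall fun _ => norm_nonneg _)
    ((continuous_testTransform hm).norm.intervalIntegrable _ _)

theorem integral_norm_testTransform_nonneg (m : ℝ → ℂ) {x : ℝ} (hx : 0 ≤ x) :
    0 ≤ ∫ τ in (-x)..x, ‖testTransform m τ‖ :=
  intervalIntegral.integral_nonneg (by linarith) fun _ _ => norm_nonneg _

theorem integral_norm_testTransform_shift_le {m : ℝ → ℂ} (hm : Integrable m) {x u σ : ℝ}
    (hx : 0 ≤ x) (hσ : |σ| ≤ u) :
    ∫ τ in (-x)..x, ‖testTransform m (τ + σ)‖ ≤ ∫ τ in (-(x + u))..(x + u), ‖testTransform m τ‖ := by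
  rw [intervalIntegral.integral_comp_add_right (fun τ => ‖testTransform m τ‖)]
  rw [abs_le] at hσ
  exact integral_norm_testTransform_mono hm (by linarith) (by linarith) (by linarith)

/-- Fubini's theorem for a test function on the spectral axis and a bounded kernel. -/
theorem integral_mul_intervalIntegral_swap {m k : ℝ → ℂ} (hm : Integrable m) {a b : ℝ}
    (hab : a ≤ b) (hk : IntervalIntegrable k volume a b) {G : ℝ → ℝ → ℂ}
    (hG : Measurable (Function.uncurry G)) {B : ℝ} (hB : ∀ z, ∀ x ∈ Ioc a b, ‖G z x‖ ≤ B) :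
    ∫ z, m z * ∫ x in a..b, k x * G z x = ∫ x in a..b, k x * ∫ z, m z * G z x := by
  have hk' : Integrable k (volume.restrict (Ioc a b)) := by
    rwa [intervalIntegrable_iff_integrableOn_Ioc_of_le hab] at hk
  have hprod : Integrable (fun p : ℝ × ℝ => m p.1 * k p.2 * G p.1 p.2)
      (volume.prod (volume.restrict (Ioc a b))) := by
    refine (hm.mul_prod hk').mul_bdd (c := B) hG.aestronglyMeasurable ?_
    have : (volume : Measure ℝ).prod (volume.restrict (Ioc a b)) =
        ((volume : Measure ℝ).prod volume).restrict (univ ×ˢ Ioc a b) := by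
      rw [← Measure.prod_restrict, Measure.restrict_univ]
    rw [this]
    exact ae_restrict_of_forall_mem (MeasurableSet.univ.prod measurableSet_Ioc)
      fun p hp => hB p.1 p.2 hp.2
  have hswap := integral_integral_swap (f := fun z x => m z * k x * G z x) hprod
  simp only [intervalIntegral.integral_of_le hab]
  calc _ = ∫ z, ∫ x in Ioc a b, m z * k x * G z x := by
        refine integral_congr_ae (Eventually.of_forall fun z => ?_)
        simp only
        rw [← integral_const_mul]
        simp only [mul_assoc]
    _ = ∫ x in Ioc a b, ∫ z, m z * k x * G z x := hswap
    _ = _ := by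
        refine integral_congr_ae (Eventually.of_forall fun x => ?_)
        simp only
        rw [← integral_const_mul]
        refine integral_congr_ae (Eventually.of_forall fun z => ?_)
        simp only
        ring

theorem sinKer_eq_integral_exp (z u : ℝ) :
    sinKer z u = ∫ σ in (-u)..u, (1 / 2 : ℂ) * Complex.exp (Complex.I * z * σ) := by
  have h1 : ∀ σ : ℝ, HasDerivAt (fun σ : ℝ => (1 / 2 : ℂ) * sinKer z σ)
      ((1 / 2 : ℂ) * Complex.cos (z * σ)) σ := fun σ => (hasDerivAt_sinKer z σ).const_mul _
  have hc : ∫ σ in (-u)..u, (1 / 2 : ℂ) * Complex.cos ((z : ℂ) * σ) = sinKer z u := by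
    rw [intervalIntegral.integral_eq_sub_of_hasDerivAt (fun σ _ => h1 σ)
      ((continuous_const.mul (continuous_cos_mul_ofReal z)).intervalIntegrable _ _)]
    have : sinKer z (-u) = -sinKer z u := by
      have := sinKer_sub z 0 u
      simpa using this
    rw [this]; ring
  have hs : ∫ σ in (-u)..u, (1 / 2 : ℂ) * (Complex.I * Complex.sin ((z : ℂ) * σ)) = 0 := by
    have := intervalIntegral.integral_comp_neg (a := -u) (b := u)
      (fun σ : ℝ => (1 / 2 : ℂ) * (Complex.I * Complex.sin ((z : ℂ) * σ)))
    simp only [neg_neg, Complex.ofReal_neg, mul_neg, Complex.sin_neg] at this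
    rw [intervalIntegral.integral_neg] at this
    exact self_eq_neg.1 this.symm
  have hsc : Continuous fun σ : ℝ => Complex.sin ((z : ℂ) * σ) := by fun_prop
  have i1 : IntervalIntegrable (fun σ : ℝ => (1 / 2 : ℂ) * Complex.cos ((z : ℂ) * σ)) volume
      (-u) u := (continuous_const.mul (continuous_cos_mul_ofReal z)).intervalIntegrable _ _
  have i2 : IntervalIntegrable (fun σ : ℝ => (1 / 2 : ℂ) * (Complex.I * Complex.sin ((z : ℂ) * σ)))
      volume (-u) u := (continuous_const.mul (continuous_const.mul hsc)).intervalIntegrable _ _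
  rw [← hc, ← add_zero (∫ σ in (-u)..u, (1 / 2 : ℂ) * Complex.cos ((z : ℂ) * σ)), ← hs,
    ← intervalIntegral.integral_add i1 i2]
  refine intervalIntegral.integral_congr fun σ _ => ?_
  rw [show Complex.I * (z : ℂ) * σ = (z * σ) * Complex.I by ring, Complex.exp_mul_I]
  ring

namespace FourierDominated

variable {x C : ℝ} {F : ℝ → ℂ}

theorem norm_integral_exp_mul_le (h : FourierDominated x C F) {m : ℝ → ℂ} (hm : Integrable m)
    (σ : ℝ) : ‖∫ z : ℝ, m z * (Complex.exp (Complex.I * z * σ) * F z)‖ ≤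
      C * ∫ τ in (-x)..x, ‖testTransform m (τ + σ)‖ := by
  have := h _ (integrable_mul_exp hm σ)
  simp only [testTransform_mul_exp] at this
  simpa only [mul_assoc] using this

end FourierDominated

/-- Multiplication by `sin (u z) / z` averages the exponentials `e^{izσ}` over `|σ| ≤ u`, so a bound
`w σ` for each of them integrates to a bound for the product. -/
theorem norm_integral_mul_sinKer_mul_le {m F : ℝ → ℂ} (hm : Integrable m) {u B A : ℝ}
    (hu : 0 ≤ u) (hF : Measurable F) (hB : ∀ z, ‖F z‖ ≤ B) {w : ℝ → ℝ}
    (hw : IntervalIntegrable w volume (-u) u)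
    (h : ∀ σ ∈ Ioc (-u) u, ‖∫ z : ℝ, m z * (Complex.exp (Complex.I * z * σ) * F z)‖ ≤ w σ)
    (hA : ∫ σ in (-u)..u, w σ ≤ A) :
    ‖∫ z : ℝ, m z * (sinKer z u * F z)‖ ≤ A / 2 := by
  have e : ∀ z : ℝ, m z * (sinKer z u * F z) = m z * ∫ σ in (-u)..u, (1 / 2 : ℂ) *
      (Complex.exp (Complex.I * z * σ) * F z) := by
    intro z
    rw [sinKer_eq_integral_exp, ← intervalIntegral.integral_mul_const]
    simp only [mul_assoc]
  simp only [e]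
  rw [integral_mul_intervalIntegral_swap hm (by linarith) (k := fun _ => (1 / 2 : ℂ))
    intervalIntegrable_const (G := fun z σ => Complex.exp (Complex.I * z * σ) * F z) ?_ (B := B) ?_]
  · have h2 : ∫ σ in (-u)..u, (1 / 2 : ℝ) * w σ ≤ A / 2 := by
      rw [intervalIntegral.integral_const_mul]; linarith
    refine le_trans ?_ h2
    refine intervalIntegral.norm_integral_le_of_norm_le (by linarith) (Eventually.of_forall ?_)
      (hw.const_mul _)
    intro σ hσ
    rw [norm_mul]
    have := h σ hσ
    have e2 : ‖(1 / 2 : ℂ)‖ = 1 / 2 := by norm_num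
    rw [e2]
    gcongr
  · have : Measurable fun p : ℝ × ℝ => Complex.exp (Complex.I * p.1 * p.2) * F p.1 :=
      (by fun_prop : Measurable fun p : ℝ × ℝ => Complex.exp (Complex.I * p.1 * p.2)).mul
        (hF.comp measurable_fst)
    exact this
  · intro z σ _
    rw [norm_mul, norm_exp_I_mul_real, one_mul]
    exact hB z

/-- Multiplication by `sin (u z) / z` widens the support of the kernel by `u` and multiplies its
bound by `u`. -/
theorem FourierDominated.sinKer_mul {x C u B : ℝ} {F : ℝ → ℂ} (h : FourierDominated x C F)
    (hC : 0 ≤ C) (hx : 0 ≤ x) (hu : 0 ≤ u) (hF : Measurable F) (hB : ∀ z, ‖F z‖ ≤ B) :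
    FourierDominated (x + u) (u * C) fun z => sinKer z u * F z := by
  intro m hm
  have := norm_integral_mul_sinKer_mul_le (A := 2 * (u * C *
    ∫ τ in (-(x + u))..(x + u), ‖testTransform m τ‖)) hm hu hF hB
    (w := fun _ => C * ∫ τ in (-(x + u))..(x + u), ‖testTransform m τ‖) intervalIntegrable_const
    (fun σ hσ => (h.norm_integral_exp_mul_le hm σ).trans (mul_le_mul_of_nonneg_left
      (integral_norm_testTransform_shift_le hm hx (abs_le.2 ⟨hσ.1.le, hσ.2⟩)) hC)) (by
      rw [intervalIntegral.integral_const, smul_eq_mul]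
      exact le_of_eq (by ring))
  linarith

theorem sin_eq_exp_sub_exp (z x : ℝ) : Complex.sin ((z : ℂ) * x) =
    (Complex.exp (Complex.I * z * x) - Complex.exp (Complex.I * z * (-x : ℝ))) *
      (1 / (2 * Complex.I)) := by
  have e1 : Complex.I * (z : ℂ) * ((-x : ℝ) : ℂ) = (-(z * x)) * Complex.I := by push_cast; ring
  rw [e1, show Complex.I * (z : ℂ) * x = (z * x) * Complex.I by ring, Complex.exp_mul_I,
    Complex.exp_mul_I, Complex.cos_neg, Complex.sin_neg]
  field_simp
  ring

theorem norm_sin_real_le (z x : ℝ) : ‖Complex.sin ((z : ℂ) * x)‖ ≤ 1 := by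
  rw [← Complex.ofReal_mul, ← Complex.ofReal_sin, Complex.norm_real, Real.norm_eq_abs]
  exact Real.abs_sin_le_one _

theorem norm_one_div_two_I : ‖(1 / (2 * Complex.I) : ℂ)‖ = 1 / 2 := by simp

/-- The case of `sinKer z u * sin (z t)`, where the kernel of the second factor is a difference of
point masses. Here the convolution with the indicator of `[-u, u]` makes the kernel bounded. -/
theorem fourierDominated_sinKer_mul_sin {t u : ℝ} (ht : 0 ≤ t) (hu : 0 ≤ u) :
    FourierDominated (t + u) (1 / 2) fun z => sinKer z u * Complex.sin ((z : ℂ) * t) := by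
  intro m hm
  have hcont := (continuous_testTransform hm).norm
  have hi : ∀ c : ℝ, IntervalIntegrable (fun σ => ‖testTransform m (σ + c)‖) volume (-u) u :=
    fun c => (hcont.comp (continuous_id.add continuous_const)).intervalIntegrable _ _
  have key := norm_integral_mul_sinKer_mul_le (m := m) (F := fun z : ℝ => Complex.sin ((z : ℂ) * t))
    (A := ∫ τ in (-(t + u))..(t + u), ‖testTransform m τ‖) hm hu (by fun_prop)
    (fun z => norm_sin_real_le z t)
    (w := fun σ => (‖testTransform m (σ + t)‖ + ‖testTransform m (σ + -t)‖) * (1 / 2))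
    (((hi t).add (hi (-t))).mul_const _) (fun σ _ => ?_) ?_
  · linarith
  · have e : ∀ z : ℝ, m z * (Complex.exp (Complex.I * z * σ) * Complex.sin ((z : ℂ) * t)) =
        (m z * Complex.exp (Complex.I * z * (σ + t : ℝ)) -
          m z * Complex.exp (Complex.I * z * (σ + -t : ℝ))) * (1 / (2 * Complex.I)) := by
      intro z
      rw [sin_eq_exp_sub_exp, show Complex.I * (z : ℂ) * (σ + t : ℝ) =
        Complex.I * z * σ + Complex.I * z * t by push_cast; ring,
        show Complex.I * (z : ℂ) * (σ + -t : ℝ) =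
        Complex.I * z * σ + Complex.I * z * (-t : ℝ) by push_cast; ring, Complex.exp_add,
        Complex.exp_add]
      ring
    simp only [e]
    rw [integral_mul_const, integral_sub (integrable_mul_exp hm _) (integrable_mul_exp hm _),
      norm_mul, norm_one_div_two_I]
    gcongr
    exact norm_sub_le _ _
  · rw [intervalIntegral.integral_mul_const, intervalIntegral.integral_add (hi t) (hi (-t)),
      intervalIntegral.integral_comp_add_right (fun τ => ‖testTransform m τ‖),
      intervalIntegral.integral_comp_add_right (fun τ => ‖testTransform m τ‖)]
    have h1 := integral_norm_testTransform_mono hm (a := -u + t) (b := u + t) (c := -(t + u))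
      (d := t + u) (by linarith) (by linarith) (by linarith)
    have h2 := integral_norm_testTransform_mono hm (a := -u + -t) (b := u + -t) (c := -(t + u))
      (d := t + u) (by linarith) (by linarith) (by linarith)
    linarith

/-! ### Transformation operator bounds for the regular solution -/

namespace FourierDominated

variable {x y C C' u : ℝ} {F G : ℝ → ℂ}

theorem mono (h : FourierDominated x C F) (hx : 0 ≤ x) (hC : C ≤ C') :
    FourierDominated x C' F := fun m hm =>
  (h m hm).trans (mul_le_mul_of_nonneg_right hC (integral_norm_testTransform_nonneg m hx))

theorem add (hF : FourierDominated x C F) (hG : FourierDominated x C' G) {B B' : ℝ}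
    (hFm : Measurable F) (hFB : ∀ z, ‖F z‖ ≤ B) (hGm : Measurable G) (hGB : ∀ z, ‖G z‖ ≤ B') :
    FourierDominated x (C + C') fun z => F z + G z := by
  intro m hm
  simp only [mul_add]
  rw [integral_add (hm.mul_bdd hFm.aestronglyMeasurable (Eventually.of_forall hFB))
    (hm.mul_bdd hGm.aestronglyMeasurable (Eventually.of_forall hGB)), add_mul]
  exact (norm_add_le _ _).trans (add_le_add (hF m hm) (hG m hm))

theorem sin_mul (h : FourierDominated x C F) (hC : 0 ≤ C) (hx : 0 ≤ x) (hu : 0 ≤ u) {B : ℝ}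
    (hFm : Measurable F) (hFB : ∀ z, ‖F z‖ ≤ B) :
    FourierDominated (x + u) C fun z => Complex.sin ((z : ℂ) * u) * F z := by
  intro m hm
  have hi : ∀ σ : ℝ, Integrable fun z : ℝ => m z * (Complex.exp (Complex.I * z * σ) * F z) := by
    intro σ
    have := (integrable_mul_exp hm σ).mul_bdd hFm.aestronglyMeasurable (Eventually.of_forall hFB)
    simpa only [mul_assoc] using this
  have e : ∀ z : ℝ, m z * (Complex.sin ((z : ℂ) * u) * F z) =
      (m z * (Complex.exp (Complex.I * z * u) * F z) -
        m z * (Complex.exp (Complex.I * z * (-u : ℝ)) * F z)) * (1 / (2 * Complex.I)) := by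
    intro z
    rw [sin_eq_exp_sub_exp]; ring
  simp only [e]
  rw [integral_mul_const, integral_sub (hi u) (hi (-u)), norm_mul, norm_one_div_two_I]
  have h1 := h.norm_integral_exp_mul_le hm u
  have h2 := h.norm_integral_exp_mul_le hm (-u)
  have h3 := mul_le_mul_of_nonneg_left (integral_norm_testTransform_shift_le hm hx
    (abs_of_nonneg hu).le) hC
  have h4 := mul_le_mul_of_nonneg_left (integral_norm_testTransform_shift_le hm hx
    (σ := -u) (by rw [abs_neg, abs_of_nonneg hu])) hC
  have h5 := norm_sub_le (∫ z : ℝ, m z * (Complex.exp (Complex.I * z * u) * F z))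
    (∫ z : ℝ, m z * (Complex.exp (Complex.I * z * (-u : ℝ)) * F z))
  linarith

/-- The kernel of a product is the convolution of the kernels. -/
theorem mul (hF : FourierDominated x C F) (hG : FourierDominated y C' G) (hC : 0 ≤ C)
    (hC' : 0 ≤ C') (hx : 0 ≤ x) (hy : 0 ≤ y) {B : ℝ} (hFm : Measurable F)
    (hFB : ∀ z, ‖F z‖ ≤ B) :
    FourierDominated (x + y) (2 * y * C * C') fun z => F z * G z := by
  intro m hm
  have hmF : Integrable fun z => m z * F z :=
    hm.mul_bdd hFm.aestronglyMeasurable (Eventually.of_forall hFB)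
  have h1 := hG _ hmF
  simp only [mul_assoc] at h1 ⊢
  set I := ∫ τ in (-(x + y))..(x + y), ‖testTransform m τ‖
  refine h1.trans ?_
  have h2 : ∫ τ in (-y)..y, ‖testTransform (fun z => m z * F z) τ‖ ≤
      ∫ _ in (-y)..y, C * I := by
    refine intervalIntegral.integral_mono_on (by linarith)
      ((continuous_testTransform hmF).norm.intervalIntegrable _ _) intervalIntegrable_const ?_
    intro τ hτ
    have h3 := hF.norm_integral_exp_mul_le hm τ
    have h4 := mul_le_mul_of_nonneg_left (integral_norm_testTransform_shift_le hm hx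
      (abs_le.2 ⟨hτ.1, hτ.2⟩)) hC
    refine le_trans (le_of_eq ?_) (h3.trans h4)
    rw [testTransform]
    congr 1
    refine integral_congr_ae (Eventually.of_forall fun z => ?_)
    simp only
    ring
  rw [intervalIntegral.integral_const, smul_eq_mul] at h2
  calc _ ≤ C' * ((y - -y) * (C * I)) := mul_le_mul_of_nonneg_left h2 hC'
    _ = _ := by ring

theorem of_hasSum {f : ℕ → ℝ → ℂ} {c b : ℕ → ℝ} (hf : ∀ n, FourierDominated x (c n) (f n))
    (hfm : ∀ n, Measurable (f n)) (hfb : ∀ n z, ‖f n z‖ ≤ b n) (hb : Summable b)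
    (hc : HasSum c C) (hF : ∀ z, HasSum (fun n => f n z) (F z)) : FourierDominated x C F := by
  intro m hm
  have h : HasSum (fun n => ∫ z, m z * f n z) (∫ z, m z * F z) := by
    refine hasSum_integral_of_dominated_convergence (fun n z => ‖m z‖ * b n)
      (fun n => hm.aestronglyMeasurable.mul (hfm n).aestronglyMeasurable)
      (fun n => Eventually.of_forall fun z => ?_)
      (Eventually.of_forall fun z => hb.mul_left _) ?_
      (Eventually.of_forall fun z => (hF z).mul_left _)
    · rw [norm_mul]; gcongr; exact hfb n z
    · simp only [tsum_mul_left]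
      exact hm.norm.mul_const _
  exact h.norm_le_of_bounded (hc.mul_right _) fun n => hf n m hm

end FourierDominated

section Picard

variable {q : ℝ → ℂ} {a Q : ℝ}

theorem mul_picard_succ (n : ℕ) (z x : ℝ) :
    (z : ℂ) * picard q 0 1 (n + 1) z x =
      ∫ t in (0 : ℝ)..x, q t * (sinKer z (x - t) * (z * picard q 0 1 n z t)) := by
  rw [picard, ← intervalIntegral.integral_const_mul]
  refine intervalIntegral.integral_congr fun t _ => ?_
  ring

theorem mul_picard_zero (z x : ℝ) :
    (z : ℂ) * picard q 0 1 0 z x = Complex.sin ((z : ℂ) * x) := by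
  rw [picard, zero_mul, zero_add, one_mul, mul_sinKer]

theorem measurable_mul_picard (hq : Integrable q) (n : ℕ) (x : ℝ) :
    Measurable fun z : ℝ => (z : ℂ) * picard q 0 1 n z x :=
  Complex.measurable_ofReal.mul
    ((differentiable_picard hq 0 1 n x).continuous.comp Complex.continuous_ofReal).measurable

theorem norm_mul_picard_le (hq : Integrable q) (n : ℕ) (z : ℝ) {x : ℝ} (hx : x ∈ Icc 0 a) :
    ‖(z : ℂ) * picard q 0 1 n z x‖ ≤ (a * ∫ t in (0 : ℝ)..x, ‖q t‖) ^ n / n.factorial := by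
  have ha : 0 ≤ a := hx.1.trans hx.2
  have h0 : 0 ≤ ∫ t in (0 : ℝ)..x, ‖q t‖ :=
    intervalIntegral.integral_nonneg hx.1 fun _ _ => norm_nonneg _
  rcases eq_or_ne z 0 with rfl | hz
  · rw [Complex.ofReal_zero, zero_mul, norm_zero]; positivity
  have hz0 : 0 < ‖(z : ℂ)‖ := by simpa using hz
  have h := norm_picard_le hq (C := 0) (S := 1) (z := (z : ℂ)) (M := ‖(z : ℂ)‖⁻¹) ha
    (fun u hu => norm_sinKer_le_of_mem_Icc (z : ℂ) hu) (fun u hu => by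
      rw [picard, zero_mul, zero_add, one_mul, inv_mul_eq_div, le_div_iff₀ hz0, mul_comm]
      exact norm_mul_sinKer_le _ hu.1) n hx
  rw [norm_mul]
  calc _ ≤ ‖(z : ℂ)‖ * _ := mul_le_mul_of_nonneg_left h hz0.le
    _ = _ := by
      rw [Complex.ofReal_im, abs_zero, zero_mul, Real.exp_zero, mul_one, ← mul_assoc,
        mul_inv_cancel₀ hz0.ne', one_mul]

/-- One step of the successive approximations, in terms of the bounds `w t` on the kernels that
are superposed. -/
theorem fourierDominated_mul_picard_succ (hq : Integrable q) (n : ℕ) {x A : ℝ} (hx : 0 ≤ x)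
    {w : ℝ → ℝ} (hw : IntervalIntegrable (fun t => ‖q t‖ * w t) volume 0 x)
    (h : ∀ t ∈ Ioc 0 x,
      FourierDominated x (w t) fun z : ℝ => sinKer z (x - t) * (z * picard q 0 1 n z t))
    (hA : ∫ t in (0 : ℝ)..x, ‖q t‖ * w t ≤ A) :
    FourierDominated x A fun z : ℝ => z * picard q 0 1 (n + 1) z x := by
  intro m hm
  have hqi : ∀ a b, IntervalIntegrable (fun t => ‖q t‖) volume a b :=
    fun a b => hq.norm.intervalIntegrable
  simp only [mul_picard_succ]
  rw [integral_mul_intervalIntegral_swap hm hx hq.intervalIntegrable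
    (G := fun z t => sinKer z (x - t) * (z * picard q 0 1 n z t)) ?_
    (B := x * ((x * ∫ t in (0 : ℝ)..x, ‖q t‖) ^ n / n.factorial)) ?_]
  · refine le_trans ?_ (mul_le_mul_of_nonneg_right hA
      (integral_norm_testTransform_nonneg m hx))
    rw [← intervalIntegral.integral_mul_const]
    refine intervalIntegral.norm_integral_le_of_norm_le hx (Eventually.of_forall ?_)
      (hw.mul_const _)
    intro t ht
    rw [norm_mul, mul_assoc]
    exact mul_le_mul_of_nonneg_left (h t ht m hm) (norm_nonneg _)
  · have h1 : Measurable (Function.uncurry fun t z : ℝ => (z : ℂ) * picard q 0 1 n z t) :=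
      measurable_uncurry_of_continuous_of_measurable
        (fun z => continuous_const.mul (continuous_picard hq 0 1 n z))
        (fun t => measurable_mul_picard hq n t)
    have h2 : Measurable fun p : ℝ × ℝ => sinKer (p.1 : ℂ) (x - p.2) :=
      (continuous_sinKer.comp ((Complex.continuous_ofReal.comp continuous_fst).prodMk
        (continuous_const.sub continuous_snd))).measurable
    exact h2.mul (h1.comp measurable_swap)
  · intro z t ht
    rw [norm_mul]
    have h1 : ‖sinKer (z : ℂ) (x - t)‖ ≤ x := by
      have := norm_sinKer_le (z : ℂ) (u := x - t) (by linarith [ht.2])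
      rw [Complex.ofReal_im, abs_zero, zero_mul, Real.exp_zero, mul_one] at this
      linarith [ht.1]
    have h2 := norm_mul_picard_le hq n z (x := t) (a := x) ⟨ht.1.le, ht.2⟩
    refine mul_le_mul h1 (h2.trans ?_) (norm_nonneg _) hx
    have h3 : ∫ t in (0 : ℝ)..t, ‖q t‖ ≤ ∫ t in (0 : ℝ)..x, ‖q t‖ :=
      intervalIntegral.integral_mono_interval le_rfl ht.1.le ht.2
        (Eventually.of_forall fun _ => norm_nonneg _) (hqi _ _)
    have h4 : 0 ≤ ∫ t in (0 : ℝ)..t, ‖q t‖ :=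
      intervalIntegral.integral_nonneg ht.1.le fun _ _ => norm_nonneg _
    gcongr

theorem fourierDominated_mul_picard (hq : Integrable q) (n : ℕ) {x : ℝ} (hx : x ∈ Icc 0 a) :
    FourierDominated x
      (1 / 2 * a ^ n * ((∫ t in (0 : ℝ)..x, ‖q t‖) ^ (n + 1) / (n + 1).factorial))
      fun z : ℝ => z * picard q 0 1 (n + 1) z x := by
  have ha : 0 ≤ a := hx.1.trans hx.2
  have hqi : ∀ a b, IntervalIntegrable (fun t => ‖q t‖) volume a b :=
    fun a b => hq.norm.intervalIntegrable
  have hcont : Continuous fun x => ∫ t in (0 : ℝ)..x, ‖q t‖ :=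
    intervalIntegral.continuous_primitive hqi 0
  induction n generalizing x with
  | zero =>
    refine fourierDominated_mul_picard_succ hq 0 hx.1 (w := fun _ => 1 / 2)
      ((hqi _ _).mul_const _) (fun t ht => ?_) ?_
    · simp only [mul_picard_zero]
      have := fourierDominated_sinKer_mul_sin ht.1.le (u := x - t) (by linarith [ht.2])
      rwa [add_sub_cancel] at this
    · rw [intervalIntegral.integral_mul_const]
      apply le_of_eq
      simp
      ring
  | succ n ih =>
    set w : ℝ → ℝ := fun t =>
      1 / 2 * a ^ (n + 1) * ((∫ s in (0 : ℝ)..t, ‖q s‖) ^ (n + 1) / (n + 1).factorial) with hwdef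
    have hw : Continuous w := continuous_const.mul ((hcont.pow _).div_const _)
    refine fourierDominated_mul_picard_succ hq (n + 1) hx.1 (w := w)
      ((hqi _ _).mul_continuousOn hw.continuousOn) (fun t ht => ?_) ?_
    · have h0 : 0 ≤ ∫ s in (0 : ℝ)..t, ‖q s‖ :=
        intervalIntegral.integral_nonneg ht.1.le fun _ _ => norm_nonneg _
      have := (ih (x := t) ⟨ht.1.le, ht.2.trans hx.2⟩).sinKer_mul (by positivity) ht.1.le
        (u := x - t) (by linarith [ht.2]) (measurable_mul_picard hq _ _)
        (fun z => norm_mul_picard_le hq (n + 1) z (a := a) ⟨ht.1.le, ht.2.trans hx.2⟩)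
      rw [add_sub_cancel] at this
      refine this.mono hx.1 ?_
      rw [hwdef]
      simp only
      calc _ ≤ a * (1 / 2 * a ^ n *
            ((∫ s in (0 : ℝ)..t, ‖q s‖) ^ (n + 1) / (n + 1).factorial)) := by
            gcongr
            linarith [ht.1, hx.2]
        _ = _ := by ring
    · apply le_of_eq
      have := integral_mul_primitive_pow_real (hqi 0 x) (n + 1)
      calc _ = ∫ t in (0 : ℝ)..x, (1 / 2 * a ^ (n + 1) / (n + 1).factorial) *
            (‖q t‖ * (∫ s in (0 : ℝ)..t, ‖q s‖) ^ (n + 1)) := by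
            refine intervalIntegral.integral_congr fun t _ => ?_
            simp only [hwdef]; ring
        _ = _ := by
            rw [intervalIntegral.integral_const_mul, this, Nat.factorial_succ (n + 1)]
            push_cast
            field_simp

/-- `z φ(x, z) - sin (z x)`, where `φ` is the regular solution. -/
noncomputable def regularRemainder (q : ℝ → ℂ) (x z : ℝ) : ℂ :=
  z * cauchySol q 0 1 z x - Complex.sin ((z : ℂ) * x)

theorem measurable_regularRemainder (hq : Integrable q) {x : ℝ} (hx : 0 ≤ x) :
    Measurable (regularRemainder q x) :=
  (Complex.measurable_ofReal.mul
    ((differentiable_cauchySol hq 0 1 hx).continuous.comp Complex.continuous_ofReal).measurable).sub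
    (by fun_prop)

theorem hasSum_regularRemainder (hq : Integrable q) {x : ℝ} (hx : 0 ≤ x) (z : ℝ) :
    HasSum (fun n => (z : ℂ) * picard q 0 1 (n + 1) z x) (regularRemainder q x z) := by
  have h := (hasSum_picard hq 0 1 z hx).mul_left (z : ℂ)
  rw [← hasSum_nat_add_iff' 1] at h
  simpa only [Finset.sum_range_one, mul_picard_zero, regularRemainder] using h

theorem norm_mul_cauchySol_real_le (hq : Integrable q) (hQ : ∫ t, ‖q t‖ ≤ Q) (z : ℝ) {x : ℝ}
    (hx : x ∈ Icc 0 a) : ‖(z : ℂ) * cauchySol q 0 1 z x‖ ≤ Real.exp (a * Q) := by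
  have ha : 0 ≤ a := hx.1.trans hx.2
  have h := (hasSum_picard hq 0 1 z hx.1).mul_left (z : ℂ)
  have h2 := NormedSpace.expSeries_div_hasSum_exp (a * Q)
  rw [← Real.exp_eq_exp_ℝ] at h2
  refine h.norm_le_of_bounded h2 fun n => (norm_mul_picard_le hq n z hx).trans ?_
  have h4 : 0 ≤ ∫ t in (0 : ℝ)..x, ‖q t‖ :=
    intervalIntegral.integral_nonneg hx.1 fun _ _ => norm_nonneg _
  have := intervalIntegral_norm_le hq hQ hx.1
  gcongr

theorem norm_regularRemainder_le (hq : Integrable q) (hQ : ∫ t, ‖q t‖ ≤ Q) (z : ℝ) {x : ℝ}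
    (hx : x ∈ Icc 0 a) : ‖regularRemainder q x z‖ ≤ Real.exp (a * Q) + 1 :=
  (norm_sub_le _ _).trans
    (add_le_add (norm_mul_cauchySol_real_le hq hQ z hx) (norm_sin_real_le z x))

/-- Boundedness of the kernel of the transformation operator. -/
theorem fourierDominated_regularRemainder (hq : Integrable q) (hQ : ∫ t, ‖q t‖ ≤ Q) {x : ℝ}
    (hx : x ∈ Icc 0 a) :
    FourierDominated x (1 / 2 * Q * Real.exp (a * Q)) (regularRemainder q x) := by
  have ha : 0 ≤ a := hx.1.trans hx.2
  have h0 : 0 ≤ ∫ t in (0 : ℝ)..x, ‖q t‖ :=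
    intervalIntegral.integral_nonneg hx.1 fun _ _ => norm_nonneg _
  have hle := intervalIntegral_norm_le hq hQ hx.1
  have hQ0 : 0 ≤ Q := h0.trans hle
  have hexp := NormedSpace.expSeries_div_hasSum_exp (a * Q)
  rw [← Real.exp_eq_exp_ℝ] at hexp
  refine FourierDominated.of_hasSum (c := fun n => 1 / 2 * Q * ((a * Q) ^ n / n.factorial))
    (b := fun n => (a * Q) ^ (n + 1) / (n + 1).factorial) (fun n => ?_)
    (fun n => measurable_mul_picard hq (n + 1) x) (fun n z => ?_)
    ((summable_nat_add_iff 1).2 (Real.summable_pow_div_factorial (a * Q)))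
    (hexp.mul_left _) (hasSum_regularRemainder hq hx.1)
  · refine (fourierDominated_mul_picard hq n hx).mono hx.1 ?_
    have hf : ((n.factorial : ℕ) : ℝ) ≤ (n + 1).factorial := by
      exact_mod_cast Nat.factorial_le (Nat.le_succ n)
    calc _ ≤ 1 / 2 * a ^ n * (Q ^ (n + 1) / n.factorial) := by gcongr
      _ = _ := by rw [mul_pow, pow_succ]; ring
  · refine (norm_mul_picard_le hq (n + 1) z hx).trans ?_
    gcongr

/-- The constant bounding the kernel of the product of two regular solutions. -/
noncomputable def productKernelBound (a Q : ℝ) : ℝ :=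
  2 * (1 / 2 * Q * Real.exp (a * Q)) + 2 * a * (1 / 2 * Q * Real.exp (a * Q)) ^ 2

theorem productKernelBound_nonneg (ha : 0 ≤ a) (hQ : 0 ≤ Q) : 0 ≤ productKernelBound a Q := by
  unfold productKernelBound; positivity

/-- The product of two regular solutions differs from the free product `sin² (z x)` by the transform
of a bounded kernel, since `(s + F₁) (s + F₂) - s² = s F₁ + s F₂ + F₁ F₂`. -/
theorem fourierDominated_mul_cauchySol_mul_sub {q₁ q₂ : ℝ → ℂ} (hq₁ : Integrable q₁)
    (hq₂ : Integrable q₂) (hQ₁ : ∫ t, ‖q₁ t‖ ≤ Q) (hQ₂ : ∫ t, ‖q₂ t‖ ≤ Q) {x : ℝ}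
    (hx : x ∈ Icc 0 a) :
    FourierDominated (2 * x) (productKernelBound a Q) fun z : ℝ =>
      (z * cauchySol q₁ 0 1 z x) * (z * cauchySol q₂ 0 1 z x) -
        Complex.sin ((z : ℂ) * x) ^ 2 := by
  have hQ0 : 0 ≤ Q := (integral_nonneg fun _ => norm_nonneg _).trans hQ₁
  have ha : 0 ≤ a := hx.1.trans hx.2
  set C := 1 / 2 * Q * Real.exp (a * Q) with hCdef
  have hC : 0 ≤ C := by positivity
  set B := Real.exp (a * Q) + 1 with hB
  have hF₁ := fourierDominated_regularRemainder hq₁ hQ₁ hx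
  have hF₂ := fourierDominated_regularRemainder hq₂ hQ₂ hx
  have m₁ := measurable_regularRemainder hq₁ hx.1
  have m₂ := measurable_regularRemainder hq₂ hx.1
  have b₁ : ∀ z, ‖regularRemainder q₁ x z‖ ≤ B := fun z => norm_regularRemainder_le hq₁ hQ₁ z hx
  have b₂ : ∀ z, ‖regularRemainder q₂ x z‖ ≤ B := fun z => norm_regularRemainder_le hq₂ hQ₂ z hx
  have ms : Measurable fun z : ℝ => Complex.sin ((z : ℂ) * x) := by fun_prop
  have bs : ∀ {F : ℝ → ℂ}, (∀ z, ‖F z‖ ≤ B) → ∀ z : ℝ, ‖Complex.sin ((z : ℂ) * x) * F z‖ ≤ B := by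
    intro F hF z
    rw [norm_mul]
    have := mul_le_mul (norm_sin_real_le z x) (hF z) (norm_nonneg _) zero_le_one
    linarith
  have bB : ∀ z, ‖regularRemainder q₁ x z * regularRemainder q₂ x z‖ ≤ B * B := fun z => by
    rw [norm_mul]
    exact mul_le_mul (b₁ z) (b₂ z) (norm_nonneg _) ((norm_nonneg _).trans (b₁ z))
  have key := ((hF₁.sin_mul hC hx.1 hx.1 m₁ b₁).add (hF₂.sin_mul hC hx.1 hx.1 m₂ b₂)
    (ms.mul m₁) (bs b₁) (ms.mul m₂) (bs b₂)).add
    (hF₁.mul hF₂ hC hC hx.1 hx.1 m₁ b₁) ((ms.mul m₁).add (ms.mul m₂))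
    (fun z => norm_add_le_of_le (bs b₁ z) (bs b₂ z)) (m₁.mul m₂) bB
  rw [← two_mul] at key
  have h2 := key.mono (C' := productKernelBound a Q) (by linarith [hx.1]) (by
    have : 2 * x * C * C ≤ 2 * a * C * C := by gcongr; exact hx.2
    rw [productKernelBound, ← hCdef]; linarith [this])
  convert h2 using 2 with z
  rw [regularRemainder, regularRemainder]
  ring

end Picard

/-! ### The Wronskian identity tested against a function of the spectral parameter -/

/-- The Wronskian-type combination `ψ₁(-z) ψ₂(z) - ψ₁(z) ψ₂(-z)`. -/
def crossDifference (ψ₁ ψ₂ : ℂ → ℂ) (z : ℂ) : ℂ := ψ₁ (-z) * ψ₂ z - ψ₁ z * ψ₂ (-z)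

theorem continuous_integral_norm_testTransform {m : ℝ → ℂ} (hm : Integrable m) :
    Continuous fun x : ℝ => ∫ τ in (-(2 * x))..(2 * x), ‖testTransform m τ‖ := by
  have hc := (continuous_testTransform hm).norm
  have hp : Continuous fun x => ∫ τ in (0 : ℝ)..x, ‖testTransform m τ‖ :=
    intervalIntegral.continuous_primitive (fun _ _ => hc.intervalIntegrable _ _) 0
  have e : (fun x : ℝ => ∫ τ in (-(2 * x))..(2 * x), ‖testTransform m τ‖) = fun x =>
      (∫ τ in (0 : ℝ)..(2 * x), ‖testTransform m τ‖) -
        ∫ τ in (0 : ℝ)..(-(2 * x)), ‖testTransform m τ‖ := by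
    ext x
    rw [intervalIntegral.integral_interval_sub_left (hc.intervalIntegrable _ _)
      (hc.intervalIntegrable _ _)]
  rw [e]
  exact (hp.comp (by fun_prop)).sub (hp.comp (by fun_prop))

theorem integral_mul_sin_sq {m : ℝ → ℂ} (hm : Integrable m) (x : ℝ) :
    ∫ z : ℝ, m z * Complex.sin ((z : ℂ) * x) ^ 2 =
      1 / 2 * (∫ z, m z) - 1 / 4 * (testTransform m (2 * x) + testTransform m (-(2 * x))) := by
  have e : ∀ z : ℝ, m z * Complex.sin ((z : ℂ) * x) ^ 2 = 1 / 2 * m z - 1 / 4 *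
      (m z * Complex.exp (Complex.I * z * (2 * x : ℝ)) +
        m z * Complex.exp (Complex.I * z * (-(2 * x) : ℝ))) := by
    intro z
    have e1 : Complex.exp (Complex.I * z * (2 * x : ℝ)) = Complex.exp (Complex.I * z * x) ^ 2 := by
      rw [← Complex.exp_nat_mul]; congr 1; push_cast; ring
    have e2 : Complex.exp (Complex.I * z * (-(2 * x) : ℝ)) =
        Complex.exp (Complex.I * z * (-x : ℝ)) ^ 2 := by
      rw [← Complex.exp_nat_mul]; congr 1; push_cast; ring
    have e3 : Complex.exp (Complex.I * z * x) * Complex.exp (Complex.I * z * (-x : ℝ)) = 1 := by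
      rw [← Complex.exp_add]; push_cast
      rw [mul_neg, add_neg_cancel, Complex.exp_zero]
    have e4 : (1 / (2 * Complex.I)) ^ 2 = (-(1 / 4) : ℂ) := by
      rw [div_pow, mul_pow, Complex.I_sq]; norm_num
    rw [sin_eq_exp_sub_exp, mul_pow, e4, e1, e2]
    linear_combination (m z * (1 / 2)) * e3
  simp only [e]
  have i1 : Integrable fun z : ℝ => 1 / 4 * (m z * Complex.exp (Complex.I * z * (2 * x : ℝ)) +
      m z * Complex.exp (Complex.I * z * (-(2 * x) : ℝ))) :=
    ((integrable_mul_exp hm _).add (integrable_mul_exp hm _)).const_mul _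
  rw [integral_sub (hm.const_mul _) i1, integral_const_mul, integral_const_mul,
    integral_add (integrable_mul_exp hm _) (integrable_mul_exp hm _)]
  rfl

/-- The Wronskian identity integrated against a test function `m` on the real spectral axis. The
constant part of `sin² (z x)` drops out because `q₂ - q₁` has mean value zero; the oscillating part
produces the values of the transform of `m` at `± 2 x`. -/
theorem norm_integral_sub_mul_testTransform_le {q₁ q₂ m : ℝ → ℂ} {a Q : ℝ} (ha : 0 ≤ a)
    (hq₁ : Integrable q₁) (hq₂ : Integrable q₂) (hQ₁ : ∫ t, ‖q₁ t‖ ≤ Q) (hQ₂ : ∫ t, ‖q₂ t‖ ≤ Q)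
    (h0 : ∫ t in (0 : ℝ)..a, (q₂ t - q₁ t) = 0) (hm : Integrable m) :
    ‖∫ x in (0 : ℝ)..a, (q₂ x - q₁ x) * (testTransform m (2 * x) + testTransform m (-(2 * x)))‖ ≤
      4 * ‖∫ z : ℝ, m z * (z * crossDifference (jostIntegral q₁ a) (jostIntegral q₂ a) z /
        (2 * Complex.I))‖ + 4 * productKernelBound a Q *
        ∫ x in (0 : ℝ)..a, ‖q₂ x - q₁ x‖ * ∫ τ in (-(2 * x))..(2 * x), ‖testTransform m τ‖ := by
  have hg : Integrable fun t => q₂ t - q₁ t := hq₂.sub hq₁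
  have hgi : IntervalIntegrable (fun t => q₂ t - q₁ t) volume 0 a := hg.intervalIntegrable
  set P : ℝ → ℝ → ℂ := fun z x => (z * cauchySol q₁ 0 1 z x) * (z * cauchySol q₂ 0 1 z x) with hP
  set G : ℝ → ℝ → ℂ := fun z x => P z (max x 0) with hG
  have hPG : ∀ z, ∀ x ∈ uIcc 0 a, G z x = P z x := by
    intro z x hx
    rw [uIcc_of_le ha] at hx
    rw [hG]; simp only; rw [max_eq_left hx.1]
  have hmeas : Measurable (Function.uncurry G) := by
    have h1 : Measurable (Function.uncurry fun x z : ℝ => G z x) := by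
      refine measurable_uncurry_of_continuous_of_measurable (fun z => ?_) (fun x => ?_)
      · have hc : ∀ {q : ℝ → ℂ}, Integrable q →
            Continuous fun x : ℝ => cauchySol q 0 1 z (max x 0) := fun hq =>
          (continuousOn_cauchySol hq 0 1 z).comp_continuous (by fun_prop)
            fun x => le_max_right x 0
        exact (continuous_const.mul (hc hq₁)).mul (continuous_const.mul (hc hq₂))
      · have hc : ∀ {q : ℝ → ℂ}, Integrable q →
            Measurable fun z : ℝ => cauchySol q 0 1 z (max x 0) := fun hq =>
          ((differentiable_cauchySol hq 0 1 (le_max_right x 0)).continuous.comp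
            Complex.continuous_ofReal).measurable
        exact (Complex.measurable_ofReal.mul (hc hq₁)).mul (Complex.measurable_ofReal.mul (hc hq₂))
    exact h1.comp measurable_swap
  have hB : ∀ z, ∀ x ∈ Ioc 0 a, ‖G z x‖ ≤ Real.exp (a * Q) * Real.exp (a * Q) := by
    intro z x hx
    rw [hPG z x (by rw [uIcc_of_le ha]; exact ⟨hx.1.le, hx.2⟩), hP, norm_mul]
    exact mul_le_mul (norm_mul_cauchySol_real_le hq₁ hQ₁ z ⟨hx.1.le, hx.2⟩)
      (norm_mul_cauchySol_real_le hq₂ hQ₂ z ⟨hx.1.le, hx.2⟩) (norm_nonneg _) (Real.exp_nonneg _)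
  have hswap := integral_mul_intervalIntegral_swap hm ha hgi hmeas hB
  have hleft : ∀ z : ℝ, ∫ x in (0 : ℝ)..a, (q₂ x - q₁ x) * G z x =
      z * crossDifference (jostIntegral q₁ a) (jostIntegral q₂ a) z / (2 * Complex.I) := by
    intro z
    rw [crossDifference, ← integral_sub_mul_cauchySol_mul_cauchySol hq₁ hq₂ ha]
    refine intervalIntegral.integral_congr fun x hx => ?_
    rw [hPG z x hx]
  simp only [hleft] at hswap
  have hT : Continuous fun x : ℝ => testTransform m (2 * x) + testTransform m (-(2 * x)) :=
    ((continuous_testTransform hm).comp (by fun_prop)).add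
      ((continuous_testTransform hm).comp (by fun_prop))
  -- the part of the product that is dominated by the transform of the test function
  set E : ℝ → ℂ := fun x => (∫ z, m z * G z x) - (1 / 2 * (∫ z, m z) -
    1 / 4 * (testTransform m (2 * x) + testTransform m (-(2 * x)))) with hE
  have hEle : ∀ x ∈ Ioc 0 a, ‖E x‖ ≤ productKernelBound a Q *
      ∫ τ in (-(2 * x))..(2 * x), ‖testTransform m τ‖ := by
    intro x hx
    have hx' : x ∈ Icc 0 a := ⟨hx.1.le, hx.2⟩
    have h := fourierDominated_mul_cauchySol_mul_sub hq₁ hq₂ hQ₁ hQ₂ hx' m hm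
    refine le_trans (le_of_eq ?_) h
    rw [hE]
    simp only
    rw [← integral_mul_sin_sq hm, ← integral_sub]
    · congr 1
      refine integral_congr_ae (Eventually.of_forall fun z => ?_)
      simp only
      rw [hPG z x (by rwa [uIcc_of_le ha])]
      ring
    · exact hm.mul_bdd (hmeas.comp measurable_prodMk_right).aestronglyMeasurable
        (Eventually.of_forall fun z => hB z x hx)
    · refine hm.mul_bdd (c := 1) (by fun_prop) (Eventually.of_forall fun z => ?_)
      rw [norm_pow]
      exact pow_le_one₀ (norm_nonneg _) (norm_sin_real_le z x)
  have hcontJ := continuous_integral_norm_testTransform hm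
  have hgT : IntervalIntegrable (fun x => (q₂ x - q₁ x) * (testTransform m (2 * x) +
      testTransform m (-(2 * x)))) volume 0 a := hgi.mul_continuousOn hT.continuousOn
  have hEmeas : AEStronglyMeasurable (fun x => (q₂ x - q₁ x) * E x)
      (volume.restrict (Ioc 0 a)) := by
    refine hg.aestronglyMeasurable.restrict.mul ?_
    refine AEStronglyMeasurable.sub ?_ ?_
    · have h1 : AEStronglyMeasurable (Function.uncurry fun x z : ℝ => m z * G z x)
          ((volume.restrict (Ioc 0 a)).prod volume) :=
        (hm.aestronglyMeasurable.comp_snd).mul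
          (hmeas.comp measurable_swap).aestronglyMeasurable
      exact h1.integral_prod_right'
    · exact (continuous_const.sub (continuous_const.mul hT)).aestronglyMeasurable
  have hbound : IntervalIntegrable (fun x => ‖q₂ x - q₁ x‖ * (productKernelBound a Q *
      ∫ τ in (-(2 * x))..(2 * x), ‖testTransform m τ‖)) volume 0 a :=
    hgi.norm.mul_continuousOn (continuous_const.mul hcontJ).continuousOn
  have hgE : IntervalIntegrable (fun x => (q₂ x - q₁ x) * E x) volume 0 a := by
    rw [intervalIntegrable_iff_integrableOn_Ioc_of_le ha] at hbound ⊢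
    refine Integrable.mono' hbound hEmeas (ae_restrict_of_forall_mem measurableSet_Ioc ?_)
    intro x hx
    rw [norm_mul]
    exact mul_le_mul_of_nonneg_left (hEle x hx) (norm_nonneg _)
  have hsplit : ∫ x in (0 : ℝ)..a, (q₂ x - q₁ x) * ∫ z, m z * G z x =
      (∫ x in (0 : ℝ)..a, (q₂ x - q₁ x) * E x) - 1 / 4 * ∫ x in (0 : ℝ)..a, (q₂ x - q₁ x) *
        (testTransform m (2 * x) + testTransform m (-(2 * x))) := by
    rw [← intervalIntegral.integral_const_mul, ← intervalIntegral.integral_sub hgE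
      (hgT.const_mul _)]
    have : ∫ x in (0 : ℝ)..a, (q₂ x - q₁ x) * (1 / 2 * ∫ z, m z) = 0 := by
      rw [intervalIntegral.integral_mul_const, h0, zero_mul]
    rw [← add_zero (∫ x in (0 : ℝ)..a, _ - _), ← this, ← intervalIntegral.integral_add
      (hgE.sub (hgT.const_mul _)) (hgi.mul_const _)]
    refine intervalIntegral.integral_congr fun x _ => ?_
    simp only [hE]
    ring
  have hEint : ‖∫ x in (0 : ℝ)..a, (q₂ x - q₁ x) * E x‖ ≤ productKernelBound a Q *
      ∫ x in (0 : ℝ)..a, ‖q₂ x - q₁ x‖ * ∫ τ in (-(2 * x))..(2 * x), ‖testTransform m τ‖ := by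
    rw [← intervalIntegral.integral_const_mul]
    refine (intervalIntegral.norm_integral_le_of_norm_le ha (Eventually.of_forall ?_)
      hbound).trans (le_of_eq (intervalIntegral.integral_congr fun x _ => by ring))
    intro x hx
    rw [norm_mul]
    exact mul_le_mul_of_nonneg_left (hEle x hx) (norm_nonneg _)
  have hfinal : ∫ x in (0 : ℝ)..a, (q₂ x - q₁ x) *
      (testTransform m (2 * x) + testTransform m (-(2 * x))) =
      4 * ((∫ x in (0 : ℝ)..a, (q₂ x - q₁ x) * E x) - ∫ z : ℝ, m z *
        (z * crossDifference (jostIntegral q₁ a) (jostIntegral q₂ a) z / (2 * Complex.I))) := by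
    rw [hswap, hsplit]; ring
  rw [hfinal, norm_mul, show ‖(4 : ℂ)‖ = 4 by norm_num]
  have := norm_sub_le (∫ x in (0 : ℝ)..a, (q₂ x - q₁ x) * E x) (∫ z : ℝ, m z *
        (z * crossDifference (jostIntegral q₁ a) (jostIntegral q₂ a) z / (2 * Complex.I)))
  linarith

/-! ### Gaussian test functions -/

/-- The Gaussian on the spectral axis whose transform is `τ ↦ exp (-σ² τ² / 2)`. -/
noncomputable def gaussianTest (σ z : ℝ) : ℝ :=
  (√(2 * Real.pi) * σ)⁻¹ * Real.exp (-(1 / (2 * σ ^ 2)) * z ^ 2)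

theorem integrable_gaussianTest {σ : ℝ} (hσ : 0 < σ) :
    Integrable fun z : ℝ => (gaussianTest σ z : ℂ) :=
  ((integrable_exp_neg_mul_sq (b := 1 / (2 * σ ^ 2)) (by positivity)).const_mul _).ofReal

theorem testTransform_gaussianTest {σ : ℝ} (hσ : 0 < σ) (τ : ℝ) :
    testTransform (fun z => (gaussianTest σ z : ℂ)) τ = (Real.exp (-(σ ^ 2 * τ ^ 2 / 2)) : ℝ) := by
  have hb : 0 < (((1 / (2 * σ ^ 2) : ℝ) : ℂ)).re := by
    rw [Complex.ofReal_re]; positivity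
  have h := fourierIntegral_gaussian hb (τ : ℂ)
  have hpi : ((Real.pi : ℂ) / ((1 / (2 * σ ^ 2) : ℝ) : ℂ)) ^ (1 / 2 : ℂ) =
      ((√(2 * Real.pi) * σ : ℝ) : ℂ) := by
    rw [← Complex.ofReal_div, show (1 / 2 : ℂ) = ((1 / 2 : ℝ) : ℂ) by push_cast; ring,
      ← Complex.ofReal_cpow (by positivity), ← Real.sqrt_eq_rpow,
      show Real.pi / (1 / (2 * σ ^ 2)) = (2 * Real.pi) * σ ^ 2 by field_simp,
      Real.sqrt_mul (by positivity), Real.sqrt_sq hσ.le]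
  have h0 : (√(2 * Real.pi) * σ) ≠ 0 := by positivity
  have e : ∀ z : ℝ, (gaussianTest σ z : ℂ) * Complex.exp (Complex.I * z * τ) =
      (((√(2 * Real.pi) * σ)⁻¹ : ℝ) : ℂ) * (Complex.exp (Complex.I * τ * z) *
        Complex.exp (-((1 / (2 * σ ^ 2) : ℝ) : ℂ) * z ^ 2)) := by
    intro z
    rw [gaussianTest]
    push_cast
    rw [show Complex.I * (z : ℂ) * τ = Complex.I * τ * z by ring]
    ring
  rw [testTransform]
  simp only [e]
  rw [integral_const_mul, h, hpi, ← mul_assoc, ← Complex.ofReal_mul, inv_mul_cancel₀ h0,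
    Complex.ofReal_one, one_mul, Complex.ofReal_exp]
  congr 1
  push_cast
  have : (σ : ℂ) ≠ 0 := by exact_mod_cast hσ.ne'
  field_simp
  ring

/-- The modulated Gaussian, whose transform is concentrated near `2 t`. -/
noncomputable def shiftedGaussian (σ t z : ℝ) : ℂ :=
  gaussianTest σ z * Complex.exp (Complex.I * z * (-(2 * t) : ℝ))

theorem integrable_shiftedGaussian {σ : ℝ} (hσ : 0 < σ) (t : ℝ) :
    Integrable (shiftedGaussian σ t) := integrable_mul_exp (integrable_gaussianTest hσ) _

theorem testTransform_shiftedGaussian {σ : ℝ} (hσ : 0 < σ) (t τ : ℝ) :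
    testTransform (shiftedGaussian σ t) τ = (Real.exp (-(σ ^ 2 * (τ - 2 * t) ^ 2 / 2)) : ℝ) := by
  unfold shiftedGaussian
  rw [testTransform_mul_exp, testTransform_gaussianTest hσ, ← sub_eq_add_neg]

theorem norm_testTransform_shiftedGaussian {σ : ℝ} (hσ : 0 < σ) (t τ : ℝ) :
    ‖testTransform (shiftedGaussian σ t) τ‖ = Real.exp (-(σ ^ 2 * (τ - 2 * t) ^ 2 / 2)) := by
  rw [testTransform_shiftedGaussian hσ, Complex.norm_real, Real.norm_eq_abs, Real.abs_exp]

theorem norm_shiftedGaussian {σ : ℝ} (hσ : 0 < σ) (t z : ℝ) :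
    ‖shiftedGaussian σ t z‖ = gaussianTest σ z := by
  rw [shiftedGaussian, norm_mul, norm_exp_I_mul_real, mul_one, Complex.norm_real,
    Real.norm_of_nonneg]
  unfold gaussianTest; positivity

theorem intervalIntegral_exp_neg_mul_sq_le {c : ℝ} (hc : 0 < c) (s : ℝ) {a b : ℝ} (hab : a ≤ b) :
    ∫ x in a..b, Real.exp (-c * (x - s) ^ 2) ≤ √(Real.pi / c) := by
  rw [intervalIntegral.integral_of_le hab, ← integral_gaussian c,
    ← integral_sub_right_eq_self (fun x => Real.exp (-c * x ^ 2)) s]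
  exact setIntegral_le_integral ((integrable_exp_neg_mul_sq hc).comp_sub_right s)
    (Eventually.of_forall fun _ => Real.exp_nonneg _)

theorem integral_norm_testTransform_shiftedGaussian_le {σ : ℝ} (hσ : 0 < σ) (t : ℝ) {x : ℝ}
    (hx : 0 ≤ x) :
    ∫ τ in (-(2 * x))..(2 * x), ‖testTransform (shiftedGaussian σ t) τ‖ ≤ 3 / σ := by
  have h := intervalIntegral_exp_neg_mul_sq_le (c := σ ^ 2 / 2) (by positivity) (2 * t)
    (a := -(2 * x)) (b := 2 * x) (by linarith)
  have e : ∀ τ, ‖testTransform (shiftedGaussian σ t) τ‖ =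
      Real.exp (-(σ ^ 2 / 2) * (τ - 2 * t) ^ 2) := fun τ => by
    rw [norm_testTransform_shiftedGaussian hσ]; congr 1; ring
  simp only [e]
  refine h.trans ?_
  rw [Real.sqrt_le_left (by positivity), div_pow, div_div_eq_mul_div]
  have := Real.pi_lt_four
  gcongr
  linarith

/-- To the left of the centre, the mass of the transform decays like a Gaussian. -/
theorem integral_norm_testTransform_shiftedGaussian_le_exp {σ : ℝ} (hσ : 0 < σ) {t x : ℝ}
    (hx : 0 ≤ x) (hxt : x ≤ t) :
    ∫ τ in (-(2 * x))..(2 * x), ‖testTransform (shiftedGaussian σ t) τ‖ ≤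
      4 / σ * Real.exp (-σ ^ 2 * (x - t) ^ 2) := by
  have h := intervalIntegral_exp_neg_mul_sq_le (c := σ ^ 2 / 4) (by positivity) (2 * t)
    (a := -(2 * x)) (b := 2 * x) (by linarith)
  have h1 : ∫ τ in (-(2 * x))..(2 * x), ‖testTransform (shiftedGaussian σ t) τ‖ ≤
      ∫ τ in (-(2 * x))..(2 * x), Real.exp (-σ ^ 2 * (x - t) ^ 2) *
        Real.exp (-(σ ^ 2 / 4) * (τ - 2 * t) ^ 2) := by
    refine intervalIntegral.integral_mono_on (by linarith)
      ((continuous_testTransform (integrable_shiftedGaussian hσ t)).norm.intervalIntegrable _ _)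
      (Continuous.intervalIntegrable (by fun_prop) _ _) fun τ hτ => ?_
    rw [norm_testTransform_shiftedGaussian hσ, ← Real.exp_add]
    apply Real.exp_le_exp.2
    have h2 : (2 * (t - x)) ^ 2 ≤ (2 * t - τ) ^ 2 :=
      pow_le_pow_left₀ (by linarith) (by linarith [hτ.2]) 2
    nlinarith [mul_le_mul_of_nonneg_left h2 (sq_nonneg σ)]
  rw [intervalIntegral.integral_const_mul] at h1
  refine h1.trans ?_
  rw [mul_comm]
  refine mul_le_mul_of_nonneg_right (h.trans ?_) (Real.exp_nonneg _)
  rw [Real.sqrt_le_left (by positivity), div_pow, div_div_eq_mul_div]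
  have := Real.pi_lt_four
  gcongr
  linarith

theorem pow_seven_le_exp {v : ℝ} (hv : 0 ≤ v) : v ^ 7 ≤ 6145 * Real.exp (v ^ 2 / 4) := by
  have h1 := Real.pow_div_factorial_le_exp (v ^ 2 / 4) (by positivity) 4
  have h0 := Real.one_le_exp (x := v ^ 2 / 4) (by positivity)
  have h2 : v ^ 7 ≤ 1 + v ^ 8 := by
    rcases le_total v 1 with h | h
    · have := pow_le_one₀ hv h (n := 7); have : 0 ≤ v ^ 8 := by positivity
      linarith
    · have := pow_le_pow_right₀ h (show 7 ≤ 8 by norm_num); linarith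
  have e : (v ^ 2 / 4) ^ 4 / (Nat.factorial 4 : ℕ) = v ^ 8 / 6144 := by
    rw [show Nat.factorial 4 = 24 by rfl]; push_cast; ring
  rw [e] at h1
  linarith

theorem add_sq_le_exp {v : ℝ} : v + v ^ 2 ≤ 9 * Real.exp (v ^ 2 / 4) := by
  have := Real.add_one_le_exp (v ^ 2 / 4)
  nlinarith [sq_nonneg (v - 1)]

/-- Moments of the Gaussian against a function of polynomial growth. -/
theorem norm_integral_shiftedGaussian_mul_le {σ R E : ℝ} (hσ : 1 ≤ σ) (hR : 0 < R) (hE : 0 ≤ E)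
    (t : ℝ) {D : ℝ → ℂ} (hD : ∀ z, ‖D z‖ ≤ E * ((1 + |z|) / R + |z| ^ 6 / R ^ 3)) :
    ‖∫ z : ℝ, shiftedGaussian σ t z * (z * D z / (2 * Complex.I))‖ ≤
      6145 * E * (σ ^ 2 / R + σ ^ 7 / R ^ 3) := by
  have hσ0 : 0 < σ := by linarith
  set S := σ ^ 2 / R + σ ^ 7 / R ^ 3 with hS
  set c := 6145 * E * S * ((√(2 * Real.pi) * σ)⁻¹ / 2) with hc
  have hc0 : 0 ≤ c := by positivity
  have hint := integrable_exp_neg_mul_sq (b := 1 / (4 * σ ^ 2)) (by positivity)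
  have hbound : ∀ z : ℝ, ‖shiftedGaussian σ t z * (z * D z / (2 * Complex.I))‖ ≤
      c * Real.exp (-(1 / (4 * σ ^ 2)) * z ^ 2) := by
    intro z
    rw [norm_mul, norm_shiftedGaussian hσ0, norm_div, norm_mul, Complex.norm_real,
      Real.norm_eq_abs, show ‖2 * Complex.I‖ = 2 by simp, gaussianTest]
    set v := |z| / σ with hv
    have hv0 : 0 ≤ v := by positivity
    have hz : |z| = σ * v := by rw [hv]; field_simp
    have hpoly : |z| * ((1 + |z|) / R + |z| ^ 6 / R ^ 3) ≤
        6145 * S * Real.exp (v ^ 2 / 4) := by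
      have h1 : |z| * (1 + |z|) ≤ σ ^ 2 * (v + v ^ 2) := by
        rw [hz]
        nlinarith [mul_nonneg (mul_nonneg hσ0.le hv0) (sub_nonneg.2 hσ)]
      have h2 : v + v ^ 2 ≤ 6145 * Real.exp (v ^ 2 / 4) := by
        have := add_sq_le_exp (v := v)
        have := Real.exp_nonneg (v ^ 2 / 4)
        linarith
      have h3 := pow_seven_le_exp hv0
      calc _ = (|z| * (1 + |z|)) / R + |z| ^ 7 / R ^ 3 := by ring
        _ ≤ σ ^ 2 * (v + v ^ 2) / R + |z| ^ 7 / R ^ 3 := by gcongr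
        _ = σ ^ 2 / R * (v + v ^ 2) + σ ^ 7 / R ^ 3 * v ^ 7 := by rw [hz]; ring
        _ ≤ σ ^ 2 / R * (6145 * Real.exp (v ^ 2 / 4)) +
            σ ^ 7 / R ^ 3 * (6145 * Real.exp (v ^ 2 / 4)) := by gcongr
        _ = _ := by rw [hS]; ring
    have hexp : Real.exp (-(1 / (2 * σ ^ 2)) * z ^ 2) * Real.exp (v ^ 2 / 4) =
        Real.exp (-(1 / (4 * σ ^ 2)) * z ^ 2) := by
      rw [← Real.exp_add, hv, div_pow, sq_abs]
      congr 1
      field_simp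
      ring
    calc _ ≤ (√(2 * Real.pi) * σ)⁻¹ * Real.exp (-(1 / (2 * σ ^ 2)) * z ^ 2) *
          (|z| * (E * ((1 + |z|) / R + |z| ^ 6 / R ^ 3)) / 2) := by gcongr; exact hD z
      _ = (√(2 * Real.pi) * σ)⁻¹ * Real.exp (-(1 / (2 * σ ^ 2)) * z ^ 2) *
          (E * (|z| * ((1 + |z|) / R + |z| ^ 6 / R ^ 3)) / 2) := by ring
      _ ≤ (√(2 * Real.pi) * σ)⁻¹ * Real.exp (-(1 / (2 * σ ^ 2)) * z ^ 2) *
          (E * (6145 * S * Real.exp (v ^ 2 / 4)) / 2) := by gcongr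
      _ = _ := by rw [← hexp, hc]; ring
  refine (norm_integral_le_of_norm_le (hint.const_mul c) (Eventually.of_forall hbound)).trans ?_
  rw [integral_const_mul, integral_gaussian]
  have h1 : √(Real.pi / (1 / (4 * σ ^ 2))) ≤ 2 * (√(2 * Real.pi) * σ) := by
    rw [Real.sqrt_le_left (by positivity), mul_pow, mul_pow, Real.sq_sqrt (by positivity)]
    field_simp
    nlinarith [Real.pi_pos]
  calc _ ≤ c * (2 * (√(2 * Real.pi) * σ)) := by gcongr
    _ = _ := by
      rw [hc]
      have : √(2 * Real.pi) * σ ≠ 0 := by positivity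
      field_simp

/-! ### The pointwise estimate and Gronwall's inequality -/

theorem one_add_mul_exp_le {v : ℝ} : (1 + v) * Real.exp (-(2 * v ^ 2)) ≤ 2 * Real.exp (-v ^ 2) := by
  have h1 : 1 + v ≤ 2 * Real.exp (v ^ 2) := by
    have := Real.add_one_le_exp (v ^ 2)
    nlinarith [sq_nonneg (v - 1)]
  calc _ ≤ 2 * Real.exp (v ^ 2) * Real.exp (-(2 * v ^ 2)) := by gcongr
    _ = _ := by rw [mul_assoc, ← Real.exp_add]; congr 2; ring

/-- The even part of the Gaussian centred at `t`, in the variable of the potentials. -/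
noncomputable def evenGaussian (σ t x : ℝ) : ℝ :=
  Real.exp (-(2 * (σ * (x - t)) ^ 2)) + Real.exp (-(2 * (σ * (x + t)) ^ 2))

theorem testTransform_shiftedGaussian_add {σ : ℝ} (hσ : 0 < σ) (t x : ℝ) :
    testTransform (shiftedGaussian σ t) (2 * x) + testTransform (shiftedGaussian σ t) (-(2 * x)) =
      (evenGaussian σ t x : ℝ) := by
  rw [testTransform_shiftedGaussian hσ, testTransform_shiftedGaussian hσ, evenGaussian,
    Complex.ofReal_add]
  congr 3 <;> congr 1 <;> ring

theorem continuous_evenGaussian (σ t : ℝ) : Continuous (evenGaussian σ t) := by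
  unfold evenGaussian; fun_prop

theorem evenGaussian_nonneg (σ t x : ℝ) : 0 ≤ evenGaussian σ t x := by
  unfold evenGaussian; positivity

theorem evenGaussian_le (σ : ℝ) {t x : ℝ} (ht : 0 ≤ t) (hx : 0 ≤ x) :
    evenGaussian σ t x ≤ 2 * Real.exp (-(2 * (σ * (x - t)) ^ 2)) := by
  have : Real.exp (-(2 * (σ * (x + t)) ^ 2)) ≤ Real.exp (-(2 * (σ * (x - t)) ^ 2)) := by
    apply Real.exp_le_exp.2
    have : 0 ≤ σ ^ 2 * (x * t) := by positivity
    nlinarith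
  rw [evenGaussian]; linarith

theorem one_div_le_integral_evenGaussian {σ a t : ℝ} (ha : 0 < a) (hσ : 2 / a ≤ σ)
    (ht : t ∈ Icc 0 a) : 1 / (8 * σ) ≤ ∫ x in (0 : ℝ)..a, evenGaussian σ t x := by
  have hσ0 : 0 < σ := lt_of_lt_of_le (by positivity) hσ
  have hσa : 2 * σ⁻¹ ≤ a := by
    rw [div_le_iff₀ ha] at hσ
    rw [← div_eq_mul_inv, div_le_iff₀ hσ0]; linarith
  have hs : 0 < σ⁻¹ := by positivity
  obtain ⟨c, hc0, hca, hc⟩ : ∃ c, 0 ≤ c ∧ c + σ⁻¹ ≤ a ∧ ∀ x ∈ Icc c (c + σ⁻¹), |x - t| ≤ σ⁻¹ := by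
    rcases le_total t (a - σ⁻¹) with h | h
    · exact ⟨t, ht.1, by linarith, fun x hx => abs_le.2 ⟨by linarith [hx.1], by linarith [hx.2]⟩⟩
    · exact ⟨t - σ⁻¹, by linarith, by linarith [ht.2],
        fun x hx => abs_le.2 ⟨by linarith [hx.1], by linarith [hx.2]⟩⟩
  have hi : ∀ u v, IntervalIntegrable (evenGaussian σ t) volume u v :=
    fun u v => (continuous_evenGaussian σ t).intervalIntegrable u v
  have h1 : ∫ x in c..(c + σ⁻¹), evenGaussian σ t x ≤ ∫ x in (0 : ℝ)..a, evenGaussian σ t x :=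
    intervalIntegral.integral_mono_interval hc0 (by linarith) hca
      (Eventually.of_forall fun x => evenGaussian_nonneg σ t x) (hi _ _)
  have h2 : ∫ _ in c..(c + σ⁻¹), (1 / 8 : ℝ) ≤ ∫ x in c..(c + σ⁻¹), evenGaussian σ t x := by
    refine intervalIntegral.integral_mono_on (by linarith) intervalIntegrable_const (hi _ _)
      fun x hx => ?_
    have h3 : (σ * (x - t)) ^ 2 ≤ 1 := by
      rw [← sq_abs, abs_mul, abs_of_pos hσ0]
      refine pow_le_one₀ (by positivity) ?_
      calc _ ≤ σ * σ⁻¹ := by gcongr; exact hc x hx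
        _ = 1 := mul_inv_cancel₀ hσ0.ne'
    have h4 : Real.exp 2 ≤ 8 := by
      have h5 := Real.exp_one_lt_d9
      have : Real.exp 2 = Real.exp 1 * Real.exp 1 := by rw [← Real.exp_add]; norm_num
      rw [this]; nlinarith [Real.exp_pos 1]
    have h5 : (1 / 8 : ℝ) ≤ Real.exp (-2) := by
      rw [Real.exp_neg, one_div]
      exact inv_anti₀ (Real.exp_pos _) h4
    have h6 : Real.exp (-2) ≤ Real.exp (-(2 * (σ * (x - t)) ^ 2)) :=
      Real.exp_le_exp.2 (by linarith)
    have h7 := Real.exp_nonneg (-(2 * (σ * (x + t)) ^ 2))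
    rw [evenGaussian]; linarith
  rw [intervalIntegral.integral_const, smul_eq_mul] at h2
  have e : (c + σ⁻¹ - c) * (1 / 8) = 1 / (8 * σ) := by field_simp; ring
  linarith

theorem intervalIntegral_exp_neg_sq_mul_sq_le {σ : ℝ} (hσ : 0 < σ) (s : ℝ) {a b : ℝ}
    (hab : a ≤ b) : ∫ x in a..b, Real.exp (-σ ^ 2 * (x - s) ^ 2) ≤ 2 / σ := by
  refine (intervalIntegral_exp_neg_mul_sq_le (c := σ ^ 2) (by positivity) s hab).trans ?_
  rw [Real.sqrt_le_left (by positivity), div_pow]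
  have := Real.pi_lt_four
  gcongr
  linarith

/-- A function that varies by at most `η` on the scale `1 / σ` is recovered from its average
against the Gaussian of width `1 / σ`, up to an error of order `η`. -/
theorem norm_le_of_integral_mul_evenGaussian {h : ℝ → ℂ} {σ a t η : ℝ} (ha : 0 < a)
    (hσ : 2 / a ≤ σ) (ht : t ∈ Icc 0 a) (hh : ContinuousOn h (Icc 0 a)) (hη : 0 ≤ η)
    (hosc : ∀ x ∈ Icc 0 a, ‖h x - h t‖ ≤ η * (1 + σ * |x - t|)) :
    ‖h t‖ ≤ 8 * σ * ‖∫ x in (0 : ℝ)..a, h x * (evenGaussian σ t x : ℝ)‖ + 64 * η := by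
  have hσ0 : 0 < σ := lt_of_lt_of_le (by positivity) hσ
  have hw := continuous_evenGaussian σ t
  have hwc : Continuous fun x => (evenGaussian σ t x : ℂ) := Complex.continuous_ofReal.comp hw
  have hi1 : IntervalIntegrable (fun x => h x * (evenGaussian σ t x : ℝ)) volume 0 a :=
    (hh.mul hwc.continuousOn).intervalIntegrable_of_Icc ha.le
  have hi2 : IntervalIntegrable (fun x => (h x - h t) * (evenGaussian σ t x : ℝ)) volume 0 a :=
    ((hh.sub continuousOn_const).mul hwc.continuousOn).intervalIntegrable_of_Icc ha.le
  have hsplit : h t * ((∫ x in (0 : ℝ)..a, evenGaussian σ t x : ℝ) : ℂ) =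
      (∫ x in (0 : ℝ)..a, h x * (evenGaussian σ t x : ℝ)) -
        ∫ x in (0 : ℝ)..a, (h x - h t) * (evenGaussian σ t x : ℝ) := by
    rw [← intervalIntegral.integral_ofReal, ← intervalIntegral.integral_const_mul,
      ← intervalIntegral.integral_sub hi1 hi2]
    refine intervalIntegral.integral_congr fun x _ => ?_
    ring
  have herr : ‖∫ x in (0 : ℝ)..a, (h x - h t) * (evenGaussian σ t x : ℝ)‖ ≤ 8 * η / σ := by
    have h1 : ‖∫ x in (0 : ℝ)..a, (h x - h t) * (evenGaussian σ t x : ℝ)‖ ≤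
        ∫ x in (0 : ℝ)..a, 4 * η * Real.exp (-σ ^ 2 * (x - t) ^ 2) := by
      refine intervalIntegral.norm_integral_le_of_norm_le ha.le (Eventually.of_forall ?_)
        (Continuous.intervalIntegrable (by fun_prop) _ _)
      intro x hx
      rw [norm_mul, Complex.norm_real, Real.norm_of_nonneg (evenGaussian_nonneg σ t x)]
      have h2 := one_add_mul_exp_le (v := σ * |x - t|)
      rw [mul_pow, sq_abs] at h2
      calc _ ≤ η * (1 + σ * |x - t|) * (2 * Real.exp (-(2 * (σ * (x - t)) ^ 2))) :=
            mul_le_mul (hosc x ⟨hx.1.le, hx.2⟩) (evenGaussian_le σ ht.1 hx.1.le)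
              (evenGaussian_nonneg σ t x) (by positivity)
        _ = 2 * η * ((1 + σ * |x - t|) * Real.exp (-(2 * (σ ^ 2 * (x - t) ^ 2)))) := by
            rw [mul_pow]; ring
        _ ≤ 2 * η * (2 * Real.exp (-(σ ^ 2 * (x - t) ^ 2))) := by gcongr
        _ = _ := by rw [neg_mul]; ring
    rw [intervalIntegral.integral_const_mul] at h1
    calc _ ≤ _ := h1
      _ ≤ 4 * η * (2 / σ) := by
        gcongr
        exact intervalIntegral_exp_neg_sq_mul_sq_le hσ0 t ha.le
      _ = _ := by ring
  have hW := one_div_le_integral_evenGaussian ha hσ ht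
  set W := ∫ x in (0 : ℝ)..a, evenGaussian σ t x with hWdef
  have hW0 : 0 ≤ W := le_trans (by positivity) hW
  have hn : ‖h t‖ * W = ‖h t * (W : ℂ)‖ := by
    rw [norm_mul, Complex.norm_real, Real.norm_of_nonneg hW0]
  have h3 : ‖h t‖ * (1 / (8 * σ)) ≤
      ‖∫ x in (0 : ℝ)..a, h x * (evenGaussian σ t x : ℝ)‖ + 8 * η / σ := by
    calc _ ≤ ‖h t‖ * W := by gcongr
      _ = _ := hn
      _ ≤ _ := by
        rw [hsplit]
        exact (norm_sub_le _ _).trans (by gcongr)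
  calc ‖h t‖ = 8 * σ * (‖h t‖ * (1 / (8 * σ))) := by field_simp
    _ ≤ 8 * σ * (‖∫ x in (0 : ℝ)..a, h x * (evenGaussian σ t x : ℝ)‖ + 8 * η / σ) := by gcongr
    _ = _ := by field_simp; ring

theorem integral_norm_mul_integral_norm_testTransform_le {h : ℝ → ℂ} {σ a t M : ℝ} (hσ : 0 < σ)
    (ht : t ∈ Icc 0 a) (hh : ContinuousOn h (Icc 0 a)) (hM : ∀ x ∈ Icc 0 a, ‖h x‖ ≤ M) :
    ∫ x in (0 : ℝ)..a, ‖h x‖ * ∫ τ in (-(2 * x))..(2 * x), ‖testTransform (shiftedGaussian σ t) τ‖ ≤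
      8 * M / σ ^ 2 + 3 / σ * ∫ x in t..a, ‖h x‖ := by
  have hM0 : 0 ≤ M := (norm_nonneg _).trans (hM t ht)
  have hJ := continuous_integral_norm_testTransform (integrable_shiftedGaussian hσ t)
  have hc : ContinuousOn (fun x => ‖h x‖ * ∫ τ in (-(2 * x))..(2 * x),
      ‖testTransform (shiftedGaussian σ t) τ‖) (Icc 0 a) := hh.norm.mul hJ.continuousOn
  have hi0 := (hc.mono (Icc_subset_Icc_right ht.2)).intervalIntegrable_of_Icc (μ := volume) ht.1
  have hi1 := (hc.mono (Icc_subset_Icc_left ht.1)).intervalIntegrable_of_Icc (μ := volume) ht.2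
  have hi2 : IntervalIntegrable (fun x => ‖h x‖) volume t a :=
    (hh.norm.mono (Icc_subset_Icc_left ht.1)).intervalIntegrable_of_Icc ht.2
  rw [← intervalIntegral.integral_add_adjacent_intervals hi0 hi1]
  refine add_le_add ?_ ?_
  · calc _ ≤ ∫ x in (0 : ℝ)..t, M * (4 / σ) * Real.exp (-σ ^ 2 * (x - t) ^ 2) := by
          refine intervalIntegral.integral_mono_on ht.1 hi0
            (Continuous.intervalIntegrable (by fun_prop) _ _) fun x hx => ?_
          rw [mul_assoc]
          exact mul_le_mul (hM x ⟨hx.1, hx.2.trans ht.2⟩)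
            (integral_norm_testTransform_shiftedGaussian_le_exp hσ hx.1 hx.2)
            (integral_norm_testTransform_nonneg _ (by linarith [hx.1])) hM0
      _ ≤ M * (4 / σ) * (2 / σ) := by
          rw [intervalIntegral.integral_const_mul]
          gcongr
          exact intervalIntegral_exp_neg_sq_mul_sq_le hσ t ht.1
      _ = _ := by field_simp; ring
  · rw [← intervalIntegral.integral_const_mul]
    refine intervalIntegral.integral_mono_on ht.2 hi1 (hi2.const_mul _) fun x hx => ?_
    rw [mul_comm]
    gcongr
    exact integral_norm_testTransform_shiftedGaussian_le hσ t (ht.1.trans hx.1)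

/-- Gronwall's inequality for an integral over `[t, a]`. -/
theorem le_of_le_add_integral {u : ℝ → ℝ} {a A B : ℝ} (ha : 0 ≤ a) (hA : 0 ≤ A) (hB : 0 < B)
    (hu : ContinuousOn u (Icc 0 a)) (hu0 : ∀ t ∈ Icc 0 a, 0 ≤ u t)
    (h : ∀ t ∈ Icc 0 a, u t ≤ A + B * ∫ x in t..a, u x) {t : ℝ} (ht : t ∈ Icc 0 a) :
    u t ≤ 2 * A * Real.exp (2 * B * a) := by
  have hc : ContinuousOn (fun t => u t * Real.exp (-(2 * B * (a - t)))) (Icc 0 a) :=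
    hu.mul (by fun_prop)
  obtain ⟨s, hs, hmax⟩ := isCompact_Icc.exists_isMaxOn (nonempty_Icc.2 ha) hc
  set m := u s * Real.exp (-(2 * B * (a - s))) with hm
  have hm0 : 0 ≤ m := mul_nonneg (hu0 s hs) (Real.exp_nonneg _)
  have hle : ∀ x ∈ Icc 0 a, u x ≤ m * Real.exp (2 * B * (a - x)) := by
    intro x hx
    have h1 : u x * Real.exp (-(2 * B * (a - x))) ≤ m := hmax hx
    calc u x = u x * Real.exp (-(2 * B * (a - x))) * Real.exp (2 * B * (a - x)) := by
          rw [mul_assoc, ← Real.exp_add, neg_add_cancel, Real.exp_zero, mul_one]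
      _ ≤ _ := by gcongr
  have hint : ∫ x in s..a, Real.exp (2 * B * (a - x)) =
      (Real.exp (2 * B * (a - s)) - 1) / (2 * B) := by
    have hd : ∀ x ∈ uIcc s a, HasDerivAt (fun x => -Real.exp (2 * B * (a - x)) / (2 * B))
        (Real.exp (2 * B * (a - x))) x := by
      intro x _
      have h1 : HasDerivAt (fun x => 2 * B * (a - x)) (2 * B * (-1)) x :=
        ((hasDerivAt_id x).const_sub a).const_mul _
      refine (h1.exp.neg.div_const (2 * B)).congr_deriv ?_
      field_simp
    rw [intervalIntegral.integral_eq_sub_of_hasDerivAt hd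
      (Continuous.intervalIntegrable (by fun_prop) _ _), sub_self, mul_zero, Real.exp_zero]
    ring
  have h2 : ∫ x in s..a, u x ≤ m * ((Real.exp (2 * B * (a - s)) - 1) / (2 * B)) := by
    rw [← hint, ← intervalIntegral.integral_const_mul]
    exact intervalIntegral.integral_mono_on hs.2
      ((hu.mono (Icc_subset_Icc_left hs.1)).intervalIntegrable_of_Icc hs.2)
      (Continuous.intervalIntegrable (by fun_prop) _ _)
      fun x hx => hle x ⟨hs.1.trans hx.1, hx.2⟩
  have h3 : u s = m * Real.exp (2 * B * (a - s)) := by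
    rw [hm, mul_assoc, ← Real.exp_add, neg_add_cancel, Real.exp_zero, mul_one]
  have h4 : m * Real.exp (2 * B * (a - s)) ≤
      A + m * ((Real.exp (2 * B * (a - s)) - 1) / 2) := by
    rw [← h3]
    refine (h s hs).trans ?_
    have := mul_le_mul_of_nonneg_left h2 hB.le
    have e : B * (m * ((Real.exp (2 * B * (a - s)) - 1) / (2 * B))) =
        m * ((Real.exp (2 * B * (a - s)) - 1) / 2) := by field_simp
    linarith
  have h5 : m ≤ 2 * A := by
    have h6 : 1 ≤ Real.exp (2 * B * (a - s)) :=
      Real.one_le_exp (mul_nonneg (by positivity) (by linarith [hs.2]))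
    nlinarith
  calc u t ≤ m * Real.exp (2 * B * (a - t)) := hle t ht
    _ ≤ 2 * A * Real.exp (2 * B * a) := by
      gcongr
      linarith [ht.1]

/-- The stability estimate at a fixed resolution `σ`, in terms of a bound for the cross difference
of the Jost functions on the real axis. -/
theorem norm_le_of_norm_crossDifference_le {q₁ q₂ h : ℝ → ℂ} {a Q σ R E M η : ℝ} (ha : 0 < a)
    (hQ : 0 < Q) (hq₁ : Integrable q₁) (hq₂ : Integrable q₂) (hQ₁ : ∫ t, ‖q₁ t‖ ≤ Q)
    (hQ₂ : ∫ t, ‖q₂ t‖ ≤ Q) (h0 : ∫ t in (0 : ℝ)..a, (q₂ t - q₁ t) = 0)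
    (hqh : ∀ᵐ x ∂volume.restrict (Ioc 0 a), q₂ x - q₁ x = h x)
    (hσ1 : 1 ≤ σ) (hσ : 2 / a ≤ σ) (hR : 0 < R) (hE : 0 ≤ E) (hη : 0 ≤ η)
    (hh : ContinuousOn h (Icc 0 a)) (hM : ∀ x ∈ Icc 0 a, ‖h x‖ ≤ M)
    (hosc : ∀ x ∈ Icc 0 a, ∀ t ∈ Icc 0 a, ‖h x - h t‖ ≤ η * (1 + σ * |x - t|))
    (hD : ∀ z : ℝ, ‖crossDifference (jostIntegral q₁ a) (jostIntegral q₂ a) z‖ ≤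
      E * ((1 + |z|) / R + |z| ^ 6 / R ^ 3)) {t : ℝ} (ht : t ∈ Icc 0 a) :
    ‖h t‖ ≤ 2 * (200000 * E * (σ ^ 3 / R + σ ^ 8 / R ^ 3) +
      256 * productKernelBound a Q * M / σ + 64 * η) *
        Real.exp (2 * (96 * productKernelBound a Q) * a) := by
  have hσ0 : 0 < σ := by linarith
  have hP : 0 < productKernelBound a Q := by unfold productKernelBound; positivity
  have hM0 : 0 ≤ M := (norm_nonneg _).trans (hM t ht)
  refine le_of_le_add_integral (u := fun t => ‖h t‖) ha.le (by positivity)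
    (by positivity : 0 < 96 * productKernelBound a Q) hh.norm (fun _ _ => norm_nonneg _) ?_ ht
  intro s hs
  have h1 := norm_le_of_integral_mul_evenGaussian ha hσ hs hh hη fun x hx => hosc x hx s hs
  have h2 := norm_integral_sub_mul_testTransform_le ha.le hq₁ hq₂ hQ₁ hQ₂ h0
    (integrable_shiftedGaussian hσ0 s)
  simp only [testTransform_shiftedGaussian_add hσ0] at h2
  rw [intervalIntegral.integral_congr_ae_restrict (g := fun x => h x * (evenGaussian σ s x : ℂ))
      (by rw [uIoc_of_le ha.le]; filter_upwards [hqh] with x hx; rw [hx]),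
    intervalIntegral.integral_congr_ae_restrict (f := fun x => ‖q₂ x - q₁ x‖ *
        ∫ τ in (-(2 * x))..(2 * x), ‖testTransform (shiftedGaussian σ s) τ‖)
      (g := fun x => ‖h x‖ *
        ∫ τ in (-(2 * x))..(2 * x), ‖testTransform (shiftedGaussian σ s) τ‖)
      (by rw [uIoc_of_le ha.le]; filter_upwards [hqh] with x hx; rw [hx])] at h2
  have h3 := norm_integral_shiftedGaussian_mul_le hσ1 hR hE s hD
  have h4 := integral_norm_mul_integral_norm_testTransform_le hσ0 hs hh hM
  set P := productKernelBound a Q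
  set J := ∫ x in s..a, ‖h x‖
  have h5 : ‖∫ x in (0 : ℝ)..a, h x * (evenGaussian σ s x : ℂ)‖ ≤
      4 * (6145 * E * (σ ^ 2 / R + σ ^ 7 / R ^ 3)) + 4 * P * (8 * M / σ ^ 2 + 3 / σ * J) :=
    h2.trans (add_le_add (by linarith) (mul_le_mul_of_nonneg_left h4 (by positivity)))
  calc ‖h s‖ ≤ 8 * σ * (4 * (6145 * E * (σ ^ 2 / R + σ ^ 7 / R ^ 3)) +
        4 * P * (8 * M / σ ^ 2 + 3 / σ * J)) + 64 * η := h1.trans (by gcongr)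
    _ = 196640 * E * (σ ^ 3 / R + σ ^ 8 / R ^ 3) + 256 * P * M / σ + 64 * η + 96 * P * J := by
      field_simp; ring
    _ ≤ 200000 * E * (σ ^ 3 / R + σ ^ 8 / R ^ 3) + 256 * P * M / σ + 64 * η + 96 * P * J := by
      gcongr; norm_num

/-! ### Hölder continuity, truncated potentials and exponents -/

/-- An absolutely continuous function with derivative in `L_r` is Hölder continuous with
exponent `1 - 1 / r`. For `r = ∞` this reads `1 - 1 / 0 = 1`, as it should. -/
theorem AbsolutelyContinuousOnInterval.norm_sub_le_rpow {h : ℝ → ℂ} {a D : ℝ} {r : ℝ≥0∞}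
    (ha : 0 ≤ a) (hD : 0 ≤ D) (hr : 1 ≤ r) (hh : AbsolutelyContinuousOnInterval h 0 a)
    (hd : eLpNorm (deriv h) r (volume.restrict (Icc 0 a)) ≤ ENNReal.ofReal D) {x t : ℝ}
    (hx : x ∈ Icc 0 a) (ht : t ∈ Icc 0 a) :
    ‖h x - h t‖ ≤ D * |x - t| ^ (1 - 1 / r.toReal) := by
  wlog htx : t ≤ x generalizing x t
  · rw [norm_sub_rev, abs_sub_comm]
    exact this ht hx (not_le.1 htx).le
  have hα : 0 ≤ 1 - 1 / r.toReal := by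
    rcases eq_or_ne r ⊤ with rfl | hr'
    · simp
    · have : 1 ≤ r.toReal := by
        rw [← ENNReal.toReal_one]; exact ENNReal.toReal_mono hr' hr
      rw [sub_nonneg, div_le_one (by linarith)]; exact this
  have hsub : uIcc t x ⊆ uIcc 0 a := by
    rw [uIcc_of_le htx, uIcc_of_le ha]
    exact Icc_subset_Icc ht.1 hx.2
  obtain ⟨hi, he⟩ := (hh.mono hsub).integral_deriv_eq_sub_complex
  rw [intervalIntegrable_iff_integrableOn_Ioc_of_le htx] at hi
  have h1 : ENNReal.ofReal ‖h x - h t‖ ≤ ENNReal.ofReal (D * |x - t| ^ (1 - 1 / r.toReal)) := by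
    calc ENNReal.ofReal ‖h x - h t‖ ≤ eLpNorm (deriv h) 1 (volume.restrict (Ioc t x)) := by
          rw [← he, intervalIntegral.integral_of_le htx, eLpNorm_one_eq_lintegral_enorm,
            ofReal_norm]
          exact enorm_integral_le_lintegral_enorm _
      _ ≤ eLpNorm (deriv h) r (volume.restrict (Ioc t x)) *
          (volume.restrict (Ioc t x)) univ ^ (1 / (1 : ℝ≥0∞).toReal - 1 / r.toReal) :=
          eLpNorm_le_eLpNorm_mul_rpow_measure_univ hr hi.aestronglyMeasurable
      _ ≤ ENNReal.ofReal D * ENNReal.ofReal |x - t| ^ (1 - 1 / r.toReal) := by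
          rw [Measure.restrict_apply_univ, Real.volume_Ioc, ENNReal.toReal_one, div_one,
            abs_of_nonneg (sub_nonneg.2 htx)]
          gcongr
          refine (eLpNorm_mono_measure _ (Measure.restrict_mono ?_ le_rfl)).trans hd
          exact Ioc_subset_Icc_self.trans (Icc_subset_Icc ht.1 hx.2)
      _ = _ := by
          rw [ENNReal.ofReal_rpow_of_nonneg (abs_nonneg _) hα, ← ENNReal.ofReal_mul hD]
  exact (ENNReal.ofReal_le_ofReal_iff (by positivity)).1 h1

theorem rpow_le_one_add {v α : ℝ} (hv : 0 ≤ v) (hα0 : 0 ≤ α) (hα1 : α ≤ 1) : v ^ α ≤ 1 + v := by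
  rcases le_total v 1 with h | h
  · have := Real.rpow_le_one hv h hα0
    linarith
  · have := Real.rpow_le_rpow_of_exponent_le h hα1
    rw [Real.rpow_one] at this
    linarith

/-- On the scale `1 / σ`, a Hölder modulus of continuity is a multiple of `σ ^ (-α)`. -/
theorem mul_rpow_le_scaled {D σ α v : ℝ} (hD : 0 ≤ D) (hσ : 0 < σ) (hv : 0 ≤ v) (hα0 : 0 ≤ α)
    (hα1 : α ≤ 1) : D * v ^ α ≤ D * σ ^ (-α) * (1 + σ * v) := by
  have h := rpow_le_one_add (mul_nonneg hσ.le hv) hα0 hα1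
  rw [Real.mul_rpow hσ.le hv] at h
  have e : v ^ α = σ ^ (-α) * (σ ^ α * v ^ α) := by
    rw [← mul_assoc, ← Real.rpow_add hσ, neg_add_cancel, Real.rpow_zero, one_mul]
  rw [e, mul_assoc]
  gcongr

/-- A function whose values oscillate by at most `ω` is bounded by its mean plus `ω`. -/
theorem norm_le_of_integral_norm_le {h : ℝ → ℂ} {a S ω : ℝ} (ha : 0 < a)
    (hh : ContinuousOn h (Icc 0 a)) (hS : ∫ x in (0 : ℝ)..a, ‖h x‖ ≤ S)
    (hosc : ∀ x ∈ Icc 0 a, ∀ t ∈ Icc 0 a, ‖h x - h t‖ ≤ ω) {x : ℝ} (hx : x ∈ Icc 0 a) :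
    ‖h x‖ ≤ S / a + ω := by
  have h1 : ∫ _ in (0 : ℝ)..a, (‖h x‖ - ω) ≤ ∫ t in (0 : ℝ)..a, ‖h t‖ := by
    refine intervalIntegral.integral_mono_on ha.le intervalIntegrable_const
      (hh.norm.intervalIntegrable_of_Icc ha.le) fun t ht => ?_
    have h2 := hosc x hx t ht
    have h3 := norm_sub_norm_le (h x) (h t)
    linarith
  rw [intervalIntegral.integral_const, smul_eq_mul, sub_zero] at h1
  have h4 : ‖h x‖ - ω ≤ S / a := by
    rw [le_div_iff₀ ha]; linarith
  linarith

section Truncation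

variable {a Q : ℝ} {q : ℝ → ℂ}

/-- The restriction of a potential to `(0, a]`, extended by zero to the whole line. -/
noncomputable def truncation (a : ℝ) (q : ℝ → ℂ) : ℝ → ℂ := (Ioc 0 a).indicator q

theorem truncation_of_mem {x : ℝ} (hx : x ∈ Ioc 0 a) : truncation a q x = q x :=
  indicator_of_mem hx q

theorem integrable_truncation (hq : IsAdmissiblePotential a Q q) :
    Integrable (truncation a q) := by
  rw [truncation, integrable_indicator_iff measurableSet_Ioc]
  have h : IntegrableOn q (Ioi 0) := memLp_one_iff_integrable.1 hq.1
  exact h.mono_set Ioc_subset_Ioi_self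

theorem integral_norm_truncation_le (hQ : 0 ≤ Q) (hq : IsAdmissiblePotential a Q q) :
    ∫ x, ‖truncation a q x‖ ≤ Q := by
  have hi : Integrable q halfLine := memLp_one_iff_integrable.1 hq.1
  have h1 : ∫ x, ‖truncation a q x‖ = ∫ x in Ioc 0 a, ‖q x‖ := by
    rw [truncation, ← integral_indicator measurableSet_Ioc]
    simp only [norm_indicator_eq_indicator_norm]
  have h2 : ∫ x in Ioc 0 a, ‖q x‖ ≤ ∫ x, ‖q x‖ ∂halfLine :=
    setIntegral_mono_set (show IntegrableOn (fun x => ‖q x‖) (Ioi 0) volume from hi.norm)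
      (Eventually.of_forall fun _ => norm_nonneg _) Ioc_subset_Ioi_self.eventuallyLE
  have h3 := hq.2.2
  rw [eLpNorm_one_eq_lintegral_enorm, ← ofReal_integral_norm_eq_lintegral_enorm hi,
    ENNReal.ofReal_le_ofReal_iff hQ] at h3
  linarith

theorem ae_eq_truncation (hq : IsAdmissiblePotential a Q q) : q =ᵐ[halfLine] truncation a q := by
  have h := hq.2.1
  rw [halfLine] at h ⊢
  filter_upwards [h, ae_restrict_mem measurableSet_Ioi] with x hx hx0
  rcases le_or_gt x a with h1 | h1
  · rw [truncation_of_mem ⟨hx0, h1⟩]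
  · rw [hx h1, truncation, indicator_of_notMem fun h2 => h1.not_ge h2.2]

theorem jostFunction_eq_of_isAdmissiblePotential (ha : 0 ≤ a) (hq : IsAdmissiblePotential a Q q) :
    jostFunction q = jostIntegral (truncation a q) a :=
  jostFunction_eq_jostIntegral (integrable_truncation hq) ha
    (fun _ ht => indicator_of_notMem (fun h => ht.not_ge h.2) q) (ae_eq_truncation hq)

theorem integral_truncation_sub_eq_zero {q₁ q₂ : ℝ → ℂ} (ha : 0 ≤ a)
    (hq₁ : IsAdmissiblePotential a Q q₁) (hq₂ : IsAdmissiblePotential a Q q₂)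
    (h : ∫ t in (0 : ℝ)..a, q₁ t = ∫ t in (0 : ℝ)..a, q₂ t) :
    ∫ t in (0 : ℝ)..a, (truncation a q₂ t - truncation a q₁ t) = 0 := by
  have e : ∀ q : ℝ → ℂ, ∫ t in (0 : ℝ)..a, truncation a q t = ∫ t in (0 : ℝ)..a, q t := by
    intro q
    rw [intervalIntegral.integral_of_le ha, intervalIntegral.integral_of_le ha]
    exact setIntegral_congr_fun measurableSet_Ioc fun x hx => truncation_of_mem hx
  rw [intervalIntegral.integral_sub (integrable_truncation hq₂).intervalIntegrable
    (integrable_truncation hq₁).intervalIntegrable, e, e, h, sub_self]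

end Truncation

/-- The constant in the growth bounds for the Jost functions. -/
noncomputable def jostGrowthBound (a Q : ℝ) : ℝ :=
  1 + a * Real.exp (a * Q) * Q + Real.exp Q * Q

theorem hasJostGrowth_jostIntegral {q : ℝ → ℂ} {a Q : ℝ} (hq : Integrable q) (ha : 0 ≤ a)
    (hQ : ∫ t, ‖q t‖ ≤ Q) : HasJostGrowth (jostGrowthBound a Q) (2 * a) (jostIntegral q a) := by
  have hQ0 : 0 ≤ Q := (integral_nonneg fun _ => norm_nonneg _).trans hQ
  refine ⟨differentiable_jostIntegral hq ha, fun z => ?_, fun z hz hz1 => ?_⟩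
  · refine (norm_jostIntegral_le hq ha hQ z).trans ?_
    have : 0 ≤ Real.exp Q * Q := by positivity
    gcongr
    rw [jostGrowthBound]; linarith
  · refine (norm_jostIntegral_sub_one_le hq ha hQ hz hz1).trans ?_
    have : 0 ≤ a * Real.exp (a * Q) * Q := by positivity
    gcongr
    rw [jostGrowthBound]; linarith

/-- Outside the interval where the zeros control the cross difference, boundedness on the real
axis gives a bound that is small after integration against a Gaussian. -/
theorem norm_crossDifference_le_of_sqrt {ψ₁ ψ₂ : ℂ → ℂ} {K b C R : ℝ} (hR : 0 < R) (hC : 0 ≤ C)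
    (h₁ : HasJostGrowth K b ψ₁) (h₂ : HasJostGrowth K b ψ₂)
    (h : ∀ x : ℝ, |x| ≤ √R → ‖crossDifference ψ₁ ψ₂ x‖ ≤ C * (1 + |x|) / R) (x : ℝ) :
    ‖crossDifference ψ₁ ψ₂ x‖ ≤ (C + 2 * K ^ 2) * ((1 + |x|) / R + |x| ^ 6 / R ^ 3) := by
  have hK : 0 ≤ K := (norm_nonneg _).trans (h₁.norm_ofReal_le 0)
  rcases le_total |x| (√R) with hx | hx
  · calc _ ≤ C * ((1 + |x|) / R) := by rw [← mul_div_assoc]; exact h x hx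
      _ ≤ _ := by
        apply mul_le_mul _ _ (by positivity) (by positivity)
        · nlinarith [sq_nonneg K]
        · have : 0 ≤ |x| ^ 6 / R ^ 3 := by positivity
          linarith
  · have h1 : 1 ≤ |x| ^ 6 / R ^ 3 := by
      rw [one_le_div (by positivity)]
      calc R ^ 3 = (√R) ^ 6 := by
            rw [show (√R) ^ 6 = ((√R) ^ 2) ^ 3 by ring, Real.sq_sqrt hR.le]
        _ ≤ |x| ^ 6 := by gcongr
    have h2 : ‖crossDifference ψ₁ ψ₂ x‖ ≤ 2 * K ^ 2 := by
      have a1 := h₁.norm_ofReal_le x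
      have a2 := h₂.norm_ofReal_le x
      have a3 := h₁.norm_ofReal_le (-x)
      have a4 := h₂.norm_ofReal_le (-x)
      push_cast at a3 a4
      calc _ ≤ ‖ψ₁ (-x)‖ * ‖ψ₂ x‖ + ‖ψ₁ x‖ * ‖ψ₂ (-x)‖ := by
            rw [crossDifference, ← norm_mul, ← norm_mul]; exact norm_sub_le _ _
        _ ≤ K * K + K * K := by gcongr
        _ = _ := by ring
    have h3 : 0 ≤ (1 + |x|) / R := by positivity
    calc _ ≤ 2 * K ^ 2 * 1 := by rw [mul_one]; exact h2
      _ ≤ _ := by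
        apply mul_le_mul _ _ zero_le_one (by positivity)
        · linarith
        · linarith

/-- The choice of the resolution: with `σ = R ^ (1 / (3 (1 + α)))` all error terms are of order
`R ^ (-α / (3 (1 + α)))`. -/
theorem resolution_bounds {R α σ : ℝ} (hR : 1 ≤ R) (hα0 : 0 ≤ α) (hα1 : α ≤ 1)
    (hσ : σ = R ^ (1 / (3 * (1 + α)))) :
    σ ^ 3 / R + σ ^ 8 / R ^ 3 ≤ 2 * R ^ (-(α / (3 * (1 + α)))) ∧
      1 / σ ≤ R ^ (-(α / (3 * (1 + α)))) ∧ σ ^ (-α) = R ^ (-(α / (3 * (1 + α)))) := by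
  have hR0 : 0 < R := by linarith
  have hα : 0 < 1 + α := by linarith
  have hpow : ∀ n : ℕ, σ ^ n = R ^ (n / (3 * (1 + α))) := by
    intro n
    rw [hσ, ← Real.rpow_natCast, ← Real.rpow_mul hR0.le]
    congr 1; ring
  refine ⟨?_, ?_, ?_⟩
  · have h1 : σ ^ 3 / R ≤ R ^ (-(α / (3 * (1 + α)))) := by
      rw [hpow, ← Real.rpow_sub_one hR0.ne']
      apply Real.rpow_le_rpow_of_exponent_le hR
      push_cast
      rw [← neg_div, div_sub_one (by positivity)]
      gcongr
      linarith
    have h2 : σ ^ 8 / R ^ 3 ≤ R ^ (-(α / (3 * (1 + α)))) := by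
      rw [hpow, ← Real.rpow_natCast R 3, ← Real.rpow_sub hR0]
      apply Real.rpow_le_rpow_of_exponent_le hR
      push_cast
      rw [← neg_div, div_sub' (by positivity)]
      gcongr
      linarith
    linarith
  · rw [hσ, one_div, ← Real.rpow_neg hR0.le]
    apply Real.rpow_le_rpow_of_exponent_le hR
    rw [neg_le_neg_iff]
    gcongr
  · rw [hσ, ← Real.rpow_mul hR0.le]
    congr 1; ring

theorem expP_le {p : ℝ≥0∞} (hp : 1 < p) : 0 ≤ expP p ∧ expP p ≤ 1 / 3 := by
  unfold expP
  split_ifs with h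
  · norm_num
  · have : 1 < p.toReal := by
      rw [← ENNReal.toReal_one]; exact (ENNReal.toReal_lt_toReal (by simp) h).2 hp
    refine ⟨div_nonneg (by linarith) (by linarith), ?_⟩
    rw [div_le_div_iff₀ (by linarith) (by norm_num)]
    linarith

theorem expR_eq {r : ℝ≥0∞} (hr : 1 < r) :
    expR r = (1 - 1 / r.toReal) / (1 + (1 - 1 / r.toReal)) := by
  unfold expR
  split_ifs with h
  · rw [h]; norm_num
  · have h1 : 1 < r.toReal := by
      rw [← ENNReal.toReal_one]; exact (ENNReal.toReal_lt_toReal (by simp) h).2 hr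
    have h2 : 2 * r.toReal - 1 ≠ 0 := by linarith
    have h3 : 1 + (1 - 1 / r.toReal) ≠ 0 := by
      have : 1 / r.toReal < 1 := by rw [div_lt_one (by linarith)]; exact h1
      linarith
    rw [div_eq_div_iff h2 h3]
    field_simp
    ring

theorem one_div_toReal_mem {r : ℝ≥0∞} (hr : 1 < r) : 0 ≤ 1 / r.toReal ∧ 1 / r.toReal < 1 := by
  refine ⟨by positivity, ?_⟩
  rcases eq_or_ne r ⊤ with rfl | h
  · simp
  · have h1 : 1 < r.toReal := by
      rw [← ENNReal.toReal_one]; exact (ENNReal.toReal_lt_toReal (by simp) h).2 hr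
    rw [div_lt_one (by linarith)]; exact h1

/-! ### Stability -/

/-- The a priori bound for the difference of two admissible potentials. -/
noncomputable def aprioriBound (a Q D α : ℝ) : ℝ := 2 * Q / a + D * a ^ α

/-- A priori and stability bounds for the absolutely continuous representative `h` of the
difference, in the presence of a bound for the cross difference of the Jost functions. -/
theorem exists_norm_le_of_norm_crossDifference_le {a Q D E : ℝ} {r : ℝ≥0∞} (ha : 0 < a)
    (hQ : 0 < Q) (hD : 0 ≤ D) (hE : 0 ≤ E) (hr : 1 < r) :
    ∃ C R₁ : ℝ, 0 < C ∧ 1 ≤ R₁ ∧ ∀ q₁ q₂ h : ℝ → ℂ, IsAdmissiblePotential a Q q₁ →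
      IsAdmissiblePotential a Q q₂ → ∫ t in (0 : ℝ)..a, q₁ t = ∫ t in (0 : ℝ)..a, q₂ t →
      (q₂ - q₁) =ᵐ[volume.restrict (Icc 0 a)] h → AbsolutelyContinuousOnInterval h 0 a →
      eLpNorm (deriv h) r (volume.restrict (Icc 0 a)) ≤ ENNReal.ofReal D →
      (∀ x ∈ Icc 0 a, ‖h x‖ ≤ aprioriBound a Q D (1 - 1 / r.toReal)) ∧
      ∀ R, R₁ < R → (∀ z : ℝ, ‖crossDifference (jostFunction q₁) (jostFunction q₂) z‖ ≤
          E * ((1 + |z|) / R + |z| ^ 6 / R ^ 3)) →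
        ∀ x ∈ Icc 0 a, ‖h x‖ ≤ C * R ^ (-(expR r / 3)) := by
  set α := 1 - 1 / r.toReal with hα
  obtain ⟨hr0, hr1⟩ := one_div_toReal_mem hr
  have hα0 : 0 ≤ α := by rw [hα]; linarith
  have hα1 : α ≤ 1 := by rw [hα]; linarith
  have hκ : 0 < 1 / (3 * (1 + α)) := by positivity
  set M := aprioriBound a Q D α with hM
  have hM0 : 0 ≤ M := by rw [hM, aprioriBound]; positivity
  obtain ⟨R₁, hR₁⟩ := eventually_atTop.1
    ((tendsto_rpow_atTop hκ).eventually (eventually_ge_atTop (max 1 (2 / a))))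
  have hP := productKernelBound_nonneg ha.le hQ.le
  set c := 2 * (200000 * E * 2 + 256 * productKernelBound a Q * M + 64 * D) *
        Real.exp (2 * (96 * productKernelBound a Q) * a) with hc
  have hc0 : 0 ≤ c := by positivity
  refine ⟨c + 1, max 1 R₁, by linarith, le_max_left _ _,
    fun q₁ q₂ h hq₁ hq₂ hint hqh hh hd => ?_⟩
  have hhc : ContinuousOn h (Icc 0 a) := by
    have := hh.continuousOn
    rwa [uIcc_of_le ha.le] at this
  have hhol : ∀ x ∈ Icc 0 a, ∀ t ∈ Icc 0 a, ‖h x - h t‖ ≤ D * |x - t| ^ α :=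
    fun x hx t ht => hh.norm_sub_le_rpow ha.le hD hr.le hd hx ht
  have hqh' : ∀ᵐ x ∂volume.restrict (Ioc 0 a), truncation a q₂ x - truncation a q₁ x = h x := by
    filter_upwards [ae_restrict_of_ae_restrict_of_subset Ioc_subset_Icc_self hqh,
      ae_restrict_mem measurableSet_Ioc] with x hx hx0
    rw [truncation_of_mem hx0, truncation_of_mem hx0, ← hx, Pi.sub_apply]
  have i₁ := integrable_truncation hq₁
  have i₂ := integrable_truncation hq₂
  have n₁ := integral_norm_truncation_le hQ.le hq₁
  have n₂ := integral_norm_truncation_le hQ.le hq₂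
  have hapr : ∀ x ∈ Icc 0 a, ‖h x‖ ≤ M := by
    intro x hx
    have hmean : ∫ x in (0 : ℝ)..a, ‖h x‖ ≤ 2 * Q := by
      rw [← intervalIntegral.integral_congr_ae_restrict
        (f := fun x => ‖truncation a q₂ x - truncation a q₁ x‖)
        (by rw [uIoc_of_le ha.le]; filter_upwards [hqh'] with x hx; rw [hx])]
      calc _ ≤ ∫ x in (0 : ℝ)..a, (‖truncation a q₂ x‖ + ‖truncation a q₁ x‖) :=
            intervalIntegral.integral_mono_on ha.le (i₂.sub i₁).norm.intervalIntegrable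
              (i₂.norm.add i₁.norm).intervalIntegrable fun x _ => norm_sub_le _ _
        _ = (∫ x in (0 : ℝ)..a, ‖truncation a q₂ x‖) +
              ∫ x in (0 : ℝ)..a, ‖truncation a q₁ x‖ :=
            intervalIntegral.integral_add i₂.norm.intervalIntegrable i₁.norm.intervalIntegrable
        _ ≤ Q + Q := add_le_add (intervalIntegral_norm_le i₂ n₂ ha.le)
            (intervalIntegral_norm_le i₁ n₁ ha.le)
        _ = 2 * Q := by ring
    refine norm_le_of_integral_norm_le ha hhc hmean (fun x hx t ht => ?_) hx
    refine (hhol x hx t ht).trans ?_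
    gcongr
    exact abs_le.2 ⟨by linarith [hx.1, ht.2], by linarith [hx.2, ht.1]⟩
  refine ⟨hapr, fun R hR hcross x hx => ?_⟩
  have hR1 : 1 ≤ R := (le_max_left _ _).trans hR.le
  have hR0 : 0 < R := by linarith
  set σ := R ^ (1 / (3 * (1 + α))) with hσ
  have hσge : max 1 (2 / a) ≤ σ := hR₁ R ((le_max_right _ _).trans hR.le)
  have hσ1 : 1 ≤ σ := (le_max_left _ _).trans hσge
  have hσ0 : 0 < σ := by linarith
  rw [jostFunction_eq_of_isAdmissiblePotential ha.le hq₁,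
    jostFunction_eq_of_isAdmissiblePotential ha.le hq₂] at hcross
  have key := norm_le_of_norm_crossDifference_le ha hQ i₁ i₂ n₁ n₂
    (integral_truncation_sub_eq_zero ha.le hq₁ hq₂ hint) hqh' hσ1 ((le_max_right _ _).trans hσge)
    hR0 hE (η := D * σ ^ (-α)) (by positivity) hhc hapr
    (fun x hx t ht => (hhol x hx t ht).trans
      (mul_rpow_le_scaled hD hσ0 (abs_nonneg _) hα0 hα1)) hcross hx
  obtain ⟨b1, b2, b3⟩ := resolution_bounds hR1 hα0 hα1 hσ
  have hexp : expR r / 3 = α / (3 * (1 + α)) := by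
    rw [expR_eq hr, ← hα]
    field_simp
  rw [hexp]
  set ρ := R ^ (-(α / (3 * (1 + α)))) with hρ
  have hρ0 : 0 ≤ ρ := by positivity
  calc ‖h x‖ ≤ _ := key
    _ ≤ 2 * (200000 * E * (2 * ρ) + 256 * productKernelBound a Q * M * ρ + 64 * (D * ρ)) *
        Real.exp (2 * (96 * productKernelBound a Q) * a) := by
      rw [b3, div_eq_mul_one_div _ σ]
      gcongr
    _ = c * ρ := by rw [hc]; ring
    _ ≤ (c + 1) * ρ := by gcongr; linarith

theorem mainTheorem2 (a Q₁ Dp Dr' δ : ℝ) (p r : ℝ≥0∞)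
    (ha : 0 < a) (hQ₁ : 0 < Q₁) (hDp : 0 < Dp) (hDr' : 0 ≤ Dr')
    (hp : 1 < p) (hr : 1 < r) (hδ₀ : 0 < δ) (hδ₁ : δ < 1) :
    ∃ (C₀' R₀' : ℝ) (ψ' : ℝ → ℝ → ℝ) (χ' : ℝ → ℝ), 0 < C₀' ∧ 0 < R₀' ∧
      (∀ R : ℝ, R₀' < R → (fun ε : ℝ => ψ' R ε) =O[𝓝[>] 0] (fun ε : ℝ => ε)) ∧
      χ' =O[atTop] Real.log ∧
      ∀ q₁ q₂ : ℝ → ℂ, IsAdmissiblePotential a Q₁ q₁ → IsAdmissiblePotential a Q₁ q₂ →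
        eLpNorm (q₂ - q₁) p halfLine ≤ ENNReal.ofReal Dp →
        ∫ t in (0 : ℝ)..a, q₁ t = ∫ t in (0 : ℝ)..a, q₂ t →
        HasACRepresentative a r Dr' (q₂ - q₁) →
        ∀ R ε : ℝ, R₀' < R → 0 < ε → ZerosClose (jostFunction q₁) (jostFunction q₂) R ε →
          ∀ᵐ x ∂halfLine,
            ‖q₁ x - q₂ x‖ ≤
              ψ' R ε + C₀' * R ^ (-((1 - δ) * expR r * expP p)) * (1 + χ' R) := by
  set K := jostGrowthBound a Q₁ with hK
  have hK1 : 1 ≤ K := by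
    have h1 : 0 ≤ a * Real.exp (a * Q₁) * Q₁ := by positivity
    have h2 : 0 ≤ Real.exp Q₁ * Q₁ := by positivity
    rw [hK, jostGrowthBound]; linarith
  obtain ⟨C₁, R₀, hC₁, hR₀, hzeros⟩ :=
    exists_norm_cross_difference_le_of_zerosClose hK1 (b := 2 * a) (by positivity)
  choose! ε₀ hε₀ hzeros using hzeros
  have hE : 0 ≤ C₁ + 2 * K ^ 2 := by positivity
  obtain ⟨C, R₁, hC, hR₁, hstab⟩ :=
    exists_norm_le_of_norm_crossDifference_le ha hQ₁ hDr' hE hr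
  set M := aprioriBound a Q₁ Dr' (1 - 1 / r.toReal) with hM
  have hM0 : 0 ≤ M := by rw [hM, aprioriBound]; positivity
  -- For `ε` beyond the threshold `ε₀ R` the a priori bound is absorbed by the term linear in `ε`.
  refine ⟨C, max R₀ R₁, fun R ε => M / ε₀ R * ε, fun _ => 0, hC, ?_, ?_,
    isBigO_zero _ _, ?_⟩
  · exact lt_of_lt_of_le (by linarith) (le_max_left _ _)
  · exact fun R _ => isBigO_const_mul_self _ _ _
  intro q₁ q₂ hq₁ hq₂ _ hint hac R ε hR hε hclose
  obtain ⟨h, hqh, hh, hd⟩ := hac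
  obtain ⟨hapr, hst⟩ := hstab q₁ q₂ h hq₁ hq₂ hint hqh hh hd
  have hRR₀ : R₀ < R := (le_max_left _ _).trans_lt hR
  have hRR₁ : R₁ < R := (le_max_right _ _).trans_lt hR
  have hR1 : 1 ≤ R := by linarith
  have hε₀R := hε₀ R hRR₀
  set B := M / ε₀ R * ε + C * R ^ (-((1 - δ) * expR r * expP p)) * (1 + 0) with hB
  have hpow : 0 ≤ C * R ^ (-((1 - δ) * expR r * expP p)) := by positivity
  have hlin : 0 ≤ M / ε₀ R * ε := by positivity
  have hB0 : 0 ≤ B := by rw [hB]; linarith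
  have hhB : ∀ x ∈ Icc 0 a, ‖h x‖ ≤ B := by
    intro x hx
    rcases le_total ε (ε₀ R) with hle | hle
    · have g₁ := hasJostGrowth_jostIntegral (integrable_truncation hq₁) ha.le
        (integral_norm_truncation_le hQ₁.le hq₁)
      have g₂ := hasJostGrowth_jostIntegral (integrable_truncation hq₂) ha.le
        (integral_norm_truncation_le hQ₁.le hq₂)
      rw [← jostFunction_eq_of_isAdmissiblePotential ha.le hq₁] at g₁
      rw [← jostFunction_eq_of_isAdmissiblePotential ha.le hq₂] at g₂
      have hx1 := hst R hRR₁ (norm_crossDifference_le_of_sqrt (by linarith) hC₁.le g₁ g₂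
        (hzeros R hRR₀ ε hle _ _ g₁ g₂ hclose)) x hx
      -- the exponent obtained is at least as good as the one claimed, because `expP p ≤ 1 / 3`
      have hexp : (1 - δ) * expR r * expP p ≤ expR r / 3 := by
        obtain ⟨hr0, hr1⟩ := one_div_toReal_mem hr
        have hR0 : 0 ≤ expR r := by
          rw [expR_eq hr]; exact div_nonneg (by linarith) (by linarith)
        obtain ⟨hp0, hp1⟩ := expP_le hp
        have h1 : (1 - δ) * expR r ≤ 1 * expR r := by gcongr; linarith
        calc _ ≤ 1 * expR r * (1 / 3) :=
              mul_le_mul h1 hp1 hp0 (by linarith)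
          _ = _ := by ring
      have hmono : R ^ (-(expR r / 3)) ≤ R ^ (-((1 - δ) * expR r * expP p)) :=
        Real.rpow_le_rpow_of_exponent_le hR1 (neg_le_neg hexp)
      have := mul_le_mul_of_nonneg_left hmono hC.le
      rw [hB]; linarith
    · have h1 : M ≤ M / ε₀ R * ε := by
        rw [div_mul_eq_mul_div, le_div_iff₀ hε₀R]
        gcongr
      have := hapr x hx
      rw [hB]; linarith
  have hv₁ := hq₁.2.1
  have hv₂ := hq₂.2.1
  have hqh' := (ae_restrict_iff' measurableSet_Icc).1 hqh
  have hqh'' : ∀ᵐ x ∂halfLine, x ∈ Icc 0 a → (q₂ - q₁) x = h x := by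
    rw [halfLine]; exact ae_restrict_of_ae hqh'
  have hpos : ∀ᵐ x ∂halfLine, 0 < x := by
    rw [halfLine]; exact ae_restrict_mem measurableSet_Ioi
  filter_upwards [hv₁, hv₂, hqh'', hpos] with x h1 h2 h3 h4
  rcases le_or_gt x a with hxa | hxa
  · rw [norm_sub_rev, ← Pi.sub_apply, h3 ⟨h4.le, hxa⟩]
    exact hhB x ⟨h4.le, hxa⟩
  · rw [h1 hxa, h2 hxa, sub_zero, norm_zero]
    exact hB0
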